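/- Consider the class of boundary value problems $$u_t=(d(u)u_x)_x\ \ (t>\tau,\ x>0),\qquad d(u)u_x=q(t)\ \ (x=0,\ t>\tau),\qquad u=u_\infty\ \ (x=+\infty,\ t>\tau),$$ where $\tau\in\mathbb R$, $d$ is a smooth, strictly positive, non-constant function on an open interval $I\subseteq\mathbb R$, $q$ is a smooth function on $(\tau,\infty)$, and $u_\infty\in\overline I$ is a (finite) constant. *Groups of invariance.* A local Lie group $G$ of point transformations $t^*=T(t,x,\varepsilon)$, $x^*=X(t,x,\varepsilon)$, $u^*=U(t,x,u,\varepsilon)$ of the variables $t>\tau$, $x\ge 0$, $u\in I$ (and a neighbourhood of this region), $\varepsilon\in\mathbb R^N$ near $0$, is a group of invariance of the problem if: the manifold $u_t=(d(u)u_x)_x$, $x>0$, is invariant under the second prolongation of $G$; the manifold $x=0$, $d(u)u_x=q(t)$ is invariant under the first prolongation of $G$; and the manifold $x=+\infty$, $u=u_\infty$ is invariant under $G$, i.e. the transformations near the identity are defined near it and $x^*\to+\infty$, $u^*\to u_\infty$ as $x\to+\infty$, $u\to u_\infty$. The maximal group of invariance (MGI) is the group of invariance that contains every group of invariance as a (local)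 subgroup. *Equivalence.* $E_{\mathrm{eq}}^{\mathrm{BVP}}$ is the group of transformations $\tilde t=e_1t+t_0$, $\tilde x=e_2x$, $\tilde u=e_3u+u_0$, $\tilde d=\frac{e_2^2}{e_1}d$, $\tilde q=\frac{e_2e_3}{e_1}q$, $\tilde u_\infty=e_3u_\infty+u_0$, with $e_1,e_2,e_3,t_0,u_0\in\mathbb R$, $e_2>0$, $e_1e_3\ne0$; two problems of the class are equivalent if one of these transformations carries one to the other (in particular it carries the time half-line and the temperature interval of one to those of the other). *One-parameter groups.* $T_d$: $(te^{2\varepsilon},xe^{\varepsilon},u)$; $T_t$: $(t+\varepsilon,x,u)$; $T_k$: $(t,xe^{k\varepsilon},ue^{2\varepsilon})$; $T_{kp}$: $(te^{(k+2)\varepsilon},xe^{(k(p+1)+1)\varepsilon},ue^{(2p+1)\varepsilon})$; $T_{ke}^{\pm}$: $(t\pm(k+2)\varepsilon,xe^{k\varepsilon},ue^{2\varepsilon})$. *Table* (here $q_0\neq0$ is a constant, and $d=u^k$ is taken on an interval $I\subseteq(0,\infty)$): | Case | $d(u)$ | $q(t)$ | $u_\infty$ | MGI | Constraints | |---|---|---|---|---|---|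 | 1 | any | $q_0t^{-1/2}$ | any | $T_d$ | | | 2 | any | $q_0$ | any | $T_t$ | | | 3 | any | $0$ | any | $T_t,T_d$ | | | 4 | $u^k$ | $q_0t^p$ | $0$ | $T_{kp}$ | $k\ne-2$, $p\ne-\frac12$, $p\neq 0$ | | 5 | $u^k$ | $q_0e^{\pm t}$ | $0$ | $T_{ke}^{\pm}$ | $k\ne-2$ | | 6 | $u^k$ | $q_0$ | $0$ | $T_t,T_{kp}$ | $p=0$ | | 7 | $u^k$ | $0$ | $0$ | $T_t,T_d,T_k$ | | | 8 | $u^{-2}$ | any | $0$ | $T_k$ | $k=-2$ | | 9 | $u^{-2}$ | $q_0t^{-1/2}$ | $0$ | $T_d,T_k$ | $k=-2$ | A row with an arbitrary entry ("any") is understood to exclude the problems equivalent to a problem in a later row which is a special case of it and has a larger group (row 9 for row 1; row 6 for row 2; row 7 for row 3; rows 6, 7 and 9 with $k=-2$ for row 8). **Theorem.** (i) The MGI of every problem in a row of the table is the group generated by the one-parameter groups listed there. (ii) Every problem of the class either is equivalent to a problem in one of the rows or has only the trivial group as its MGI. (iii) Problems in different rows, or in the same row with different values of the parameters $k$, $p$,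 $\pm$, are not equivalent. In particular $d=e^u$ and $d=u^{-4/3}$ give no groups besides those in the table. -/

import Mathlib

open Set Filter
open scoped Topology ContDiff

namespace HeatBVP

/-! ## The class of boundary value problems -/

/-- A boundary value problem
`u_t = (d(u) u_x)_x` for `t > τ`, `x > 0`,
`d(u) u_x = q(t)` at `x = 0`, and `u = u_∞` at `x = +∞`.
The conductivity `d` is a smooth, strictly positive, non-constant function on an open interval `I`
of temperatures, the flux `q` is smooth on the half-line `t > τ`, and `u_∞` is a limit of
temperatures from `I` (so that `d` may degenerate or blow up at `u_∞`, as `u ^ k` does at `0`).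
The initial time `τ` is part of the data because shifts of time move it. -/
structure Problem where
  τ : ℝ
  I : Set ℝ
  d : ℝ → ℝ
  q : ℝ → ℝ
  uInf : ℝ
  isOpen_I : IsOpen I
  ordConnected_I : I.OrdConnected
  d_smooth : ContDiffOn ℝ ∞ d I
  d_pos : ∀ u ∈ I, 0 < d u
  d_nonconst : ¬ ∃ c : ℝ, ∀ u ∈ I, d u = c
  q_smooth : ContDiffOn ℝ ∞ q (Ioi τ)
  uInf_mem : uInf ∈ closure I

/-- The part of the space of the variables `(t, x, u)` on which the problem lives,
boundary `x = 0` included. -/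
def Problem.region (B : Problem) : Set (ℝ × ℝ × ℝ) :=
  {z | B.τ < z.1 ∧ 0 ≤ z.2.1 ∧ z.2.2 ∈ B.I}

/-! ## Local Lie groups of point transformations -/

/-- An `N`-parameter local Lie group, in coordinates centred at the identity `0 ∈ ℝ^N`. -/
structure LocalLieGroup (N : ℕ) where
  V : Set (Fin N → ℝ)
  V₀ : Set (Fin N → ℝ)
  isOpen_V : IsOpen V
  isOpen_V₀ : IsOpen V₀
  isConnected_V : IsConnected V
  isConnected_V₀ : IsConnected V₀
  V₀_subset : V₀ ⊆ V
  zero_mem : (0 : Fin N → ℝ) ∈ V₀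
  mul : (Fin N → ℝ) → (Fin N → ℝ) → (Fin N → ℝ)
  inv : (Fin N → ℝ) → (Fin N → ℝ)
  mul_smooth : ContDiffOn ℝ ∞ (fun p : (Fin N → ℝ) × (Fin N → ℝ) => mul p.1 p.2) (V ×ˢ V)
  inv_smooth : ContDiffOn ℝ ∞ inv V₀
  inv_mem : ∀ a ∈ V₀, inv a ∈ V
  mul_assoc : ∀ a ∈ V, ∀ b ∈ V, ∀ c ∈ V, mul a b ∈ V → mul b c ∈ V →
    mul a (mul b c) = mul (mul a b) c
  zero_mul : ∀ a ∈ V, mul 0 a = a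
  mul_zero : ∀ a ∈ V, mul a 0 = a
  mul_inv : ∀ a ∈ V₀, mul a (inv a) = 0
  inv_mul : ∀ a ∈ V₀, mul (inv a) a = 0

/-- An `N`-parameter local Lie group of point transformations
`t* = T(t, x, ε)`, `x* = X(t, x, ε)`, `u* = U(t, x, u, ε)` acting on an open set `M` of the space
of the variables `(t, x, u)`. The transformation with parameter `ε` is `act ε`; it is defined at
those `z` with `(ε, z) ∈ dom`. -/
structure PointGroup (N : ℕ) extends LocalLieGroup N where
  M : Set (ℝ × ℝ × ℝ)
  isOpen_M : IsOpen M
  dom : Set ((Fin N → ℝ) × (ℝ × ℝ × ℝ))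
  isOpen_dom : IsOpen dom
  dom_subset : dom ⊆ V ×ˢ M
  zero_mem_dom : ∀ z ∈ M, ((0 : Fin N → ℝ), z) ∈ dom
  act : (Fin N → ℝ) → ℝ × ℝ × ℝ → ℝ × ℝ × ℝ
  act_smooth : ContDiffOn ℝ ∞ (fun p : (Fin N → ℝ) × (ℝ × ℝ × ℝ) => act p.1 p.2) dom
  act_mem : ∀ ε z, (ε, z) ∈ dom → act ε z ∈ M
  act_zero : ∀ z ∈ M, act 0 z = z
  act_mul : ∀ δ ε z, (ε, z) ∈ dom → (δ, act ε z) ∈ dom → (mul δ ε, z) ∈ dom →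
    act δ (act ε z) = act (mul δ ε) z
  act_inv : ∀ ε z, ε ∈ V₀ → (ε, z) ∈ dom →
    (inv ε, act ε z) ∈ dom ∧ act (inv ε) (act ε z) = z
  /-- `T` and `X` do not depend on `u`. -/
  act_fibre : ∀ ε t x u u', (ε, (t, x, u)) ∈ dom → (ε, (t, x, u')) ∈ dom →
    (act ε (t, x, u)).1 = (act ε (t, x, u')).1 ∧ (act ε (t, x, u)).2.1 = (act ε (t, x, u')).2.1

/-! ## Invariance of a boundary value problem -/

/-- `∂f/∂t` for a function `f(t, x)`. -/
noncomputable def dt (f : ℝ × ℝ → ℝ) (t x : ℝ) : ℝ := deriv (fun s => f (s, x)) t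

/-- `∂f/∂x` for a function `f(t, x)`. -/
noncomputable def dx (f : ℝ × ℝ → ℝ) (t x : ℝ) : ℝ := deriv (fun y => f (t, y)) x

/-- The function `f` satisfies `u_t = (d(u) u_x)_x` at the point `(t, x)`. This is a condition on
the second order jet of `f` at that point. -/
def Problem.HeatEqAt (B : Problem) (f : ℝ × ℝ → ℝ) (t x : ℝ) : Prop :=
  dt f t x = deriv (fun y => B.d (f (t, y)) * dx f t y) x

/-- The function `f` satisfies `d(u) u_x = q(t)` at the point `(t, x)`. This is a condition on
the first order jet of `f` at that point. -/
def Problem.FluxAt (B : Problem) (f : ℝ × ℝ → ℝ) (t x : ℝ) : Prop :=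
  B.d (f (t, x)) * dx f t x = B.q t

/-- Near the point over `(t, x)`, the point transformation `g` maps the graph of `f` into the graph
of `f'`. If `g` is a local diffeomorphism of the form `(T(t, x), X(t, x), U(t, x, u))`, this
determines the jet of `f'` at the image point from the jet of `f` at `(t, x)`: it is the image of
the latter under the prolongation of `g`. -/
def CarriesGraph (g : ℝ × ℝ × ℝ → ℝ × ℝ × ℝ) (f f' : ℝ × ℝ → ℝ) (t x : ℝ) : Prop :=
  ∀ᶠ p in 𝓝 (t, x), f' ((g (p.1, p.2, f p)).1, (g (p.1, p.2, f p)).2.1) = (g (p.1, p.2, f p)).2.2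

/-- Invariance of the boundary value problem `B` with respect to the local Lie group `Φ`. -/
structure IsInvariant {N : ℕ} (B : Problem) (Φ : PointGroup N) : Prop where
  /-- The group acts on a neighbourhood of the whole region where the problem lives. -/
  region_subset : B.region ⊆ Φ.M
  subset_strip : ∀ z ∈ Φ.M, B.τ < z.1 ∧ z.2.2 ∈ B.I
  /-- The transformations preserve the domain `x > 0`. -/
  domain : ∀ ε t x u, (ε, (t, x, u)) ∈ Φ.dom → 0 < x → 0 < (Φ.act ε (t, x, u)).2.1
  /-- The manifold `u_t = (d(u) u_x)_x` of second order jets is invariant under the second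
  prolongation. -/
  equation : ∀ ε t x u, (ε, (t, x, u)) ∈ Φ.dom → 0 < x →
    ∀ f f' : ℝ × ℝ → ℝ, ContDiffAt ℝ ∞ f (t, x) → f (t, x) = u → B.HeatEqAt f t x →
      ContDiffAt ℝ ∞ f' ((Φ.act ε (t, x, u)).1, (Φ.act ε (t, x, u)).2.1) →
      CarriesGraph (Φ.act ε) f f' t x →
      B.HeatEqAt f' (Φ.act ε (t, x, u)).1 (Φ.act ε (t, x, u)).2.1
  /-- The boundary curve `x = 0` is invariant. -/
  boundary : ∀ ε t u, (ε, (t, 0, u)) ∈ Φ.dom → (Φ.act ε (t, 0, u)).2.1 = 0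
  /-- The manifold `x = 0`, `d(u) u_x = q(t)` of first order jets is invariant under the first
  prolongation. -/
  flux : ∀ ε t u, (ε, (t, 0, u)) ∈ Φ.dom →
    ∀ f f' : ℝ × ℝ → ℝ, ContDiffAt ℝ ∞ f (t, 0) → f (t, 0) = u → B.FluxAt f t 0 →
      ContDiffAt ℝ ∞ f' ((Φ.act ε (t, 0, u)).1, (Φ.act ε (t, 0, u)).2.1) →
      CarriesGraph (Φ.act ε) f f' t 0 →
      B.FluxAt f' (Φ.act ε (t, 0, u)).1 (Φ.act ε (t, 0, u)).2.1
  /-- The group acts near the points at infinity `x = +∞`, `u = u_∞`, … -/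
  near_infinity : ∀ t, B.τ < t →
    ∀ᶠ p in 𝓝 (0 : Fin N → ℝ) ×ˢ (atTop ×ˢ 𝓝[B.I] B.uInf), (p.1, (t, p.2.1, p.2.2)) ∈ Φ.dom
  /-- … and the manifold `x = +∞`, `u = u_∞` is invariant: `x* → +∞` and `u* → u_∞` as
  `x → +∞` and `u → u_∞`. -/
  at_infinity : ∀ t, B.τ < t → ∀ᶠ ε in 𝓝 (0 : Fin N → ℝ),
    Tendsto (fun p : ℝ × ℝ => (Φ.act ε (t, p.1, p.2)).2.1) (atTop ×ˢ 𝓝[B.I] B.uInf) atTop ∧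
    Tendsto (fun p : ℝ × ℝ => (Φ.act ε (t, p.1, p.2)).2.2) (atTop ×ˢ 𝓝[B.I] B.uInf) (𝓝 B.uInf)

/-- The local group `Φ` is contained in the local group `Ψ` as a subgroup: on the region of `B`,
the transformations of `Φ` near the identity are transformations of `Ψ`, through a smooth local
homomorphism `σ` of the parameter groups. -/
def IsContained (B : Problem) {N N' : ℕ} (Φ : PointGroup N) (Ψ : PointGroup N') : Prop :=
  ∃ σ : (Fin N → ℝ) → (Fin N' → ℝ),
    σ 0 = 0 ∧ ContDiffAt ℝ ∞ σ 0 ∧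
    (∀ᶠ p in 𝓝 ((0 : Fin N → ℝ), (0 : Fin N → ℝ)),
      σ (Φ.mul p.1 p.2) = Ψ.mul (σ p.1) (σ p.2)) ∧
    ∀ z ∈ B.region, ∀ᶠ p in 𝓝 ((0 : Fin N → ℝ), z),
      p.2 ∈ B.region → Φ.act p.1 p.2 = Ψ.act (σ p.1) p.2

/-- `Ψ` is the maximal group of invariance of `B`: it is a group of invariance and contains every
group of invariance. -/
def IsMaximal (B : Problem) {N : ℕ} (Ψ : PointGroup N) : Prop :=
  IsInvariant B Ψ ∧ ∀ (N' : ℕ) (Φ : PointGroup N'), IsInvariant B Φ → IsContained B Φ Ψ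

/-- The maximal group of invariance of `B` is the group generated by the one-parameter groups
`T₁, …, T_N` of the list: it is the `N`-parameter group of the compositions
`T₁(ε₁) ∘ ⋯ ∘ T_N(ε_N)`. The empty list stands for the trivial group. -/
def HasMGI (B : Problem) (l : List (ℝ → ℝ × ℝ × ℝ → ℝ × ℝ × ℝ)) : Prop :=
  ∃ Ψ : PointGroup l.length, IsMaximal B Ψ ∧
    ∀ ε z, (ε, z) ∈ Ψ.dom →
      Ψ.act ε z = (List.ofFn fun i => l.get i (ε i)).foldr (fun g w => g w) z

/-! ## The equivalence group -/

/-- `B'` is obtained from `B` by an equivalence transformation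
`t' = e₁ t + t₀`, `x' = e₂ x`, `u' = e₃ u + u₀`,
`d' = (e₂² / e₁) d`, `q' = (e₂ e₃ / e₁) q`, `u_∞' = e₃ u_∞ + u₀`. -/
def Equivalent (B B' : Problem) : Prop :=
  ∃ e₁ e₂ e₃ t₀ u₀ : ℝ, e₁ ≠ 0 ∧ 0 < e₂ ∧ e₃ ≠ 0 ∧
    (∀ t, B'.τ < e₁ * t + t₀ ↔ B.τ < t) ∧
    (∀ u, e₃ * u + u₀ ∈ B'.I ↔ u ∈ B.I) ∧
    (∀ u ∈ B.I, B'.d (e₃ * u + u₀) = e₂ ^ 2 / e₁ * B.d u) ∧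
    (∀ t, B.τ < t → B'.q (e₁ * t + t₀) = e₂ * e₃ / e₁ * B.q t) ∧
    B'.uInf = e₃ * B.uInf + u₀

/-! ## The table -/

/-- `T_d`: `t* = t e^{2ε}`, `x* = x e^ε`, `u* = u`. -/
noncomputable def Td (ε : ℝ) (z : ℝ × ℝ × ℝ) : ℝ × ℝ × ℝ :=
  (z.1 * Real.exp (2 * ε), z.2.1 * Real.exp ε, z.2.2)

/-- `T_t`: `t* = t + ε`, `x* = x`, `u* = u`. -/
def Tt (ε : ℝ) (z : ℝ × ℝ × ℝ) : ℝ × ℝ × ℝ := (z.1 + ε, z.2.1, z.2.2)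

/-- `T_k`: `t* = t`, `x* = x e^{kε}`, `u* = u e^{2ε}`. -/
noncomputable def Tk (k ε : ℝ) (z : ℝ × ℝ × ℝ) : ℝ × ℝ × ℝ :=
  (z.1, z.2.1 * Real.exp (k * ε), z.2.2 * Real.exp (2 * ε))

/-- `T_{kp}`: `t* = t e^{(k+2)ε}`, `x* = x e^{(k(p+1)+1)ε}`, `u* = u e^{(2p+1)ε}`. -/
noncomputable def Tkp (k p ε : ℝ) (z : ℝ × ℝ × ℝ) : ℝ × ℝ × ℝ :=
  (z.1 * Real.exp ((k + 2) * ε), z.2.1 * Real.exp ((k * (p + 1) + 1) * ε),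
    z.2.2 * Real.exp ((2 * p + 1) * ε))

/-- `T_{ke}` for the flux `q₀ e^{s t}`, `s = ±1`:
`t* = t + s (k+2) ε`, `x* = x e^{kε}`, `u* = u e^{2ε}`. -/
noncomputable def Tke (k s ε : ℝ) (z : ℝ × ℝ × ℝ) : ℝ × ℝ × ℝ :=
  (z.1 + s * (k + 2) * ε, z.2.1 * Real.exp (k * ε), z.2.2 * Real.exp (2 * ε))

/-- `d(u) = u ^ k` (on positive temperatures) and `u_∞ = 0`. -/
def Problem.IsPower (B : Problem) (k : ℝ) : Prop :=
  B.I ⊆ Ioi 0 ∧ (∀ u ∈ B.I, B.d u = u ^ k) ∧ B.uInf = 0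

/-- `q(t) = q₀ t ^ p` with a constant `q₀ ≠ 0`. -/
def Problem.HasPowerFlux (B : Problem) (p : ℝ) : Prop :=
  ∃ q₀ : ℝ, q₀ ≠ 0 ∧ ∀ t, B.τ < t → B.q t = q₀ * t ^ p

/-- `q(t) = q₀ e^{s t}` with a constant `q₀ ≠ 0`. -/
def Problem.HasExpFlux (B : Problem) (s : ℝ) : Prop :=
  ∃ q₀ : ℝ, q₀ ≠ 0 ∧ ∀ t, B.τ < t → B.q t = q₀ * Real.exp (s * t)

/-- `q(t) = q₀` with a constant `q₀ ≠ 0`. -/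
def Problem.HasConstFlux (B : Problem) : Prop :=
  ∃ q₀ : ℝ, q₀ ≠ 0 ∧ ∀ t, B.τ < t → B.q t = q₀

/-- `q(t) = 0`. -/
def Problem.HasZeroFlux (B : Problem) : Prop := ∀ t, B.τ < t → B.q t = 0

/-- The cases of the table, with their parameters. -/
inductive Row : Type
  | case1
  | case2
  | case3
  | case4 (k p : ℝ)
  | case5 (k s : ℝ)
  | case6 (k : ℝ)
  | case7 (k : ℝ)
  | case8
  | case9

/-- The problem `B` has the arbitrary elements `(d, q, u_∞)` given in the row. -/
def Row.Matches : Row → Problem → Prop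
  | case1, B => B.HasPowerFlux (-1 / 2)
  | case2, B => B.HasConstFlux
  | case3, B => B.HasZeroFlux
  | case4 k p, B => k ≠ -2 ∧ p ≠ -1 / 2 ∧ p ≠ 0 ∧ B.IsPower k ∧ B.HasPowerFlux p
  | case5 k s, B => k ≠ -2 ∧ (s = 1 ∨ s = -1) ∧ B.IsPower k ∧ B.HasExpFlux s
  | case6 k, B => B.IsPower k ∧ B.HasConstFlux
  | case7 k, B => B.IsPower k ∧ B.HasZeroFlux
  | case8, B => B.IsPower (-2)
  | case9, B => B.IsPower (-2) ∧ B.HasPowerFlux (-1 / 2)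

/-- `B` reduces to the given row by an equivalence transformation. -/
def Problem.ReducesTo (B : Problem) (r : Row) : Prop :=
  ∃ B' : Problem, Equivalent B B' ∧ r.Matches B'

/-- The problem `B` belongs to the row: it has the arbitrary elements given there, and where the
row leaves an element arbitrary (`∀` in the table), `B` is not equivalent to a problem of
those later rows that are special cases of this one with a larger group. -/
def Row.Mem : Row → Problem → Prop
  | case1, B => case1.Matches B ∧ ¬ B.ReducesTo case9
  | case2, B => case2.Matches B ∧ ¬ ∃ k, B.ReducesTo (case6 k)
  | case3, B => case3.Matches B ∧ ¬ ∃ k, B.ReducesTo (case7 k)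
  | case8, B => case8.Matches B ∧
      ¬ B.ReducesTo (case6 (-2)) ∧ ¬ B.ReducesTo (case7 (-2)) ∧ ¬ B.ReducesTo case9
  | r, B => r.Matches B

/-- The one-parameter groups generating the maximal group of invariance in each row. -/
noncomputable def Row.groups : Row → List (ℝ → ℝ × ℝ × ℝ → ℝ × ℝ × ℝ)
  | case1 => [Td]
  | case2 => [Tt]
  | case3 => [Tt, Td]
  | case4 k p => [Tkp k p]
  | case5 k s => [Tke k s]
  | case6 k => [Tt, Tkp k 0]
  | case7 k => [Tt, Td, Tk k]
  | case8 => [Tk (-2)]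
  | case9 => [Td, Tk (-2)]

end HeatBVP

/-! The method is Lie's: linearise at the identity, solve the resulting linear equations, impose the
two boundary conditions, and integrate back to the group.

Since the target time and place do not depend on `u`, invariance of the heat equation forces the
time component to be independent of `x`. Linearising the transformed equation in the parameter and
testing it on arbitrary second order jets gives the determining equations for the infinitesimal
transformation τ∂_t + ξ∂_x + η∂_u (`IsInvariant.determining`). Here d'η = d(2ξ_x - τ_t) and η is
affine in `u`. Hence either no nonzero affine ℓ satisfies ℓd' = Ad with a constant A, and then η =
0, or d = ℓd' for an affine ℓ, so that d is a power or an exponential. In every case τ = αt + β, and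
ξ = γx + κx² after using ξ = 0 at x = 0; the term κ can survive only for the power -4/3.

The condition at infinity removes the exceptional cases (`IsInvariant.stationary_at_infinity`). The
quantity 1/x obeys a linear equation along the group and its limit 0 is preserved, so κ = 0. The
quantity `u` preserves its limit u_∞, so η vanishes at u_∞ and is a multiple of u - u_∞. Thus e^u
and u^(-4/3) contribute nothing new: what remains is (αt + β)∂_t + γx∂_x + a(u - u_∞)∂_u.

These fields are affine, so Lie's equation and Grönwall's inequality show that the transformations
near the identity are t* = Et + F, x* = Gx, u* - u_∞ = H(u - u_∞) (`IsInvariant.affineForm`). The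
flux condition differentiates to (αt + β)q' = (a + γ - α)q (`AffineForm.isSymmetry`). Linear
relations among α, γ, a integrate to relations among the logarithms of E, G, H. Therefore an
explicit scaling group whose generators span all such fields contains every group of invariance
(`AffineAction.ofGenerators_isMaximal`).

The classification then concerns two ordinary differential equations: (u - u_∞)d' = kd for the
conductivity (`Problem.PowerAt`) and (αt + β)q' = μq for the flux (`Problem.FluxODE`). The exponents
k and μ/α, or the sign of μ/β when α = 0, are invariant under equivalence. So each row is described
by invariant properties (`Row.Characterises`) that exclude one another, and the failure of all of
them leaves only the zero field. -/

namespace HeatBVP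

/-! ### Calculus of partial derivatives of functions of two variables -/

section Calculus

variable {F : ℝ × ℝ → ℝ} {a b : ℝ}

theorem dt_eq_fderiv (h : DifferentiableAt ℝ F (a, b)) : dt F a b = fderiv ℝ F (a, b) (1, 0) := by
  have h1 : HasDerivAt (fun s : ℝ => (s, b)) ((1 : ℝ), (0 : ℝ)) a :=
    (hasDerivAt_id a).prodMk (hasDerivAt_const a b)
  exact (h.hasFDerivAt.comp_hasDerivAt a h1).deriv

theorem dx_eq_fderiv (h : DifferentiableAt ℝ F (a, b)) : dx F a b = fderiv ℝ F (a, b) (0, 1) := by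
  have h1 : HasDerivAt (fun s : ℝ => (a, s)) ((0 : ℝ), (1 : ℝ)) b :=
    (hasDerivAt_const b a).prodMk (hasDerivAt_id b)
  exact (h.hasFDerivAt.comp_hasDerivAt b h1).deriv

theorem eventually_differentiableAt {E G : Type*} [NormedAddCommGroup E]
    [NormedSpace ℝ E] [NormedAddCommGroup G] [NormedSpace ℝ G] {f : E → G} {x : E}
    (h : ContDiffAt ℝ ∞ f x) : ∀ᶠ y in 𝓝 x, DifferentiableAt ℝ f y := by
  have h1 : ContDiffAt ℝ 1 f x := h.of_le (by exact_mod_cast le_top)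
  filter_upwards [h1.eventually (by simp)] with y hy
  exact hy.differentiableAt one_ne_zero

theorem contDiffAt_dt (h : ContDiffAt ℝ ∞ F (a, b)) :
    ContDiffAt ℝ ∞ (fun p : ℝ × ℝ => dt F p.1 p.2) (a, b) := by
  have h1 : ContDiffAt ℝ ∞ (fun p : ℝ × ℝ => fderiv ℝ F p (1, 0)) (a, b) :=
    (h.fderiv_right (m := ∞) le_rfl).clm_apply contDiffAt_const
  refine h1.congr_of_eventuallyEq ?_
  filter_upwards [eventually_differentiableAt h] with p hp
  exact dt_eq_fderiv hp

theorem contDiffAt_dx (h : ContDiffAt ℝ ∞ F (a, b)) :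
    ContDiffAt ℝ ∞ (fun p : ℝ × ℝ => dx F p.1 p.2) (a, b) := by
  have h1 : ContDiffAt ℝ ∞ (fun p : ℝ × ℝ => fderiv ℝ F p (0, 1)) (a, b) :=
    (h.fderiv_right (m := ∞) le_rfl).clm_apply contDiffAt_const
  refine h1.congr_of_eventuallyEq ?_
  filter_upwards [eventually_differentiableAt h] with p hp
  exact dx_eq_fderiv hp

theorem diffAt {E G : Type*} [NormedAddCommGroup E]
    [NormedSpace ℝ E] [NormedAddCommGroup G] [NormedSpace ℝ G] {f : E → G} {x : E}
    (h : ContDiffAt ℝ ∞ f x) : DifferentiableAt ℝ f x :=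
  h.differentiableAt (by simp)

theorem contDiffAt_slice_fst (h : ContDiffAt ℝ ∞ F (a, b)) :
    ContDiffAt ℝ ∞ (fun s => F (s, b)) a :=
  ContDiffAt.comp (g := F) (f := fun s : ℝ => (s, b)) a h (contDiffAt_id.prodMk contDiffAt_const)

theorem contDiffAt_slice_snd (h : ContDiffAt ℝ ∞ F (a, b)) :
    ContDiffAt ℝ ∞ (fun y => F (a, y)) b :=
  ContDiffAt.comp (g := F) (f := fun y : ℝ => (a, y)) b h (contDiffAt_const.prodMk contDiffAt_id)

theorem hasDerivAt_dt (h : DifferentiableAt ℝ F (a, b)) :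
    HasDerivAt (fun s => F (s, b)) (dt F a b) a := by
  have h1 : DifferentiableAt ℝ (fun s : ℝ => (s, b)) a := by fun_prop
  exact (DifferentiableAt.comp (g := F) (f := fun s : ℝ => (s, b)) a h h1).hasDerivAt

theorem hasDerivAt_dx (h : DifferentiableAt ℝ F (a, b)) :
    HasDerivAt (fun y => F (a, y)) (dx F a b) b := by
  have h1 : DifferentiableAt ℝ (fun y : ℝ => (a, y)) b := by fun_prop
  exact (DifferentiableAt.comp (g := F) (f := fun y : ℝ => (a, y)) b h h1).hasDerivAt

/-- Both sides are values of the second Fréchet derivative, which is symmetric. -/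
theorem dt_dx_comm (h : ContDiffAt ℝ ∞ F (a, b)) :
    dt (fun p => dx F p.1 p.2) a b = dx (fun p => dt F p.1 p.2) a b := by
  have hd : DifferentiableAt ℝ (fderiv ℝ F) (a, b) :=
    diffAt (h.fderiv_right (m := ∞) le_rfl)
  have e1 : (fun p : ℝ × ℝ => dx F p.1 p.2) =ᶠ[𝓝 (a, b)] fun p => fderiv ℝ F p (0, 1) := by
    filter_upwards [eventually_differentiableAt h] with p hp
    exact dx_eq_fderiv hp
  have e2 : (fun p : ℝ × ℝ => dt F p.1 p.2) =ᶠ[𝓝 (a, b)] fun p => fderiv ℝ F p (1, 0) := by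
    filter_upwards [eventually_differentiableAt h] with p hp
    exact dt_eq_fderiv hp
  have hs : IsSymmSndFDerivAt ℝ F (a, b) :=
    h.isSymmSndFDerivAt (by
    rw [minSmoothness_of_isRCLikeNormedField]
    exact WithTop.coe_le_coe.2 (le_top : (2 : ℕ∞) ≤ ⊤))
  have k (v w : ℝ × ℝ) : fderiv ℝ (fun p => fderiv ℝ F p v) (a, b) w
      = fderiv ℝ (fderiv ℝ F) (a, b) w v := by
    rw [fderiv_clm_apply hd (differentiableAt_const _)]
    simp
  rw [dt_eq_fderiv (diffAt (contDiffAt_dx h)),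
    dx_eq_fderiv (diffAt (contDiffAt_dt h)), e1.fderiv_eq, e2.fderiv_eq, k, k]
  exact hs _ _

/-- The derivative in a parameter commutes with a partial derivative. -/
theorem hasDerivAt_dx_param (h : ContDiffAt ℝ ∞ F (a, b)) :
    HasDerivAt (fun s => dx F s b) (deriv (fun y => dt F a y) b) a := by
  have := hasDerivAt_dt (diffAt (contDiffAt_dx h))
  rwa [dt_dx_comm h] at this

theorem eventually_contDiffAt_snd (h : ∀ᶠ p in 𝓝 (a, b), ContDiffAt ℝ ∞ F p) :
    ∀ᶠ y in 𝓝 b, ContDiffAt ℝ ∞ F (a, y) :=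
  (Continuous.tendsto (by fun_prop : Continuous fun y : ℝ => (a, y)) b).eventually h

/-- The exchange of derivatives is used twice, the inner time at all points (a, y) with y near b;
hence the smoothness on a neighbourhood. It allows second order jets to be differentiated in the
group parameter. -/
theorem hasDerivAt_dx_dx_param (h : ∀ᶠ p in 𝓝 (a, b), ContDiffAt ℝ ∞ F p) :
    HasDerivAt (fun s => deriv (fun y => dx F s y) b)
      (deriv (fun y => deriv (fun y => dt F a y) y) b) a := by
  have h0 := h.self_of_nhds
  have := hasDerivAt_dx_param (F := fun p => dx F p.1 p.2) (contDiffAt_dx h0)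
  have e : (fun y => dt (fun p => dx F p.1 p.2) a y) =ᶠ[𝓝 b]
      fun y => deriv (fun y => dt F a y) y := by
    filter_upwards [eventually_contDiffAt_snd h] with y hy
    exact dt_dx_comm (F := F) hy
  rwa [e.deriv_eq] at this

/-- Here `dt` and `dx` are only the partial derivatives in the first and second slot. Later `F` is
often a function of (x, u), and then they mean ∂_x and ∂_u; the same reading applies to the
determining equations. -/
theorem hasDerivAt_comp_graph {φ : ℝ → ℝ} {φ' : ℝ} (hb : φ a = b)
    (h : DifferentiableAt ℝ F (a, b)) (hφ : HasDerivAt φ φ' a) :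
    HasDerivAt (fun x => F (x, φ x)) (dt F a b + φ' * dx F a b) a := by
  subst hb
  have h1 : HasDerivAt (fun x : ℝ => (x, φ x)) ((1 : ℝ), φ') a :=
    (hasDerivAt_id a).prodMk hφ
  have h2 := h.hasFDerivAt.comp_hasDerivAt a h1
  have h3 : dt F a (φ a) + φ' * dx F a (φ a) = fderiv ℝ F (a, φ a) (1, φ') := by
    rw [dt_eq_fderiv h, dx_eq_fderiv h]
    have : ((1 : ℝ), φ') = (1, 0) + φ' • ((0 : ℝ), (1 : ℝ)) := by simp
    rw [this, map_add, map_smul, smul_eq_mul]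
  rw [h3]
  exact h2

/-- Second derivative along a curve `x ↦ (x, φ x)`. -/
theorem deriv_deriv_comp_graph {φ ψ : ℝ → ℝ} {p r : ℝ} (hφa : φ a = b)
    (hφ : ∀ᶠ x in 𝓝 a, HasDerivAt φ (ψ x) x) (hψa : ψ a = p) (hψ : HasDerivAt ψ r a)
    (h : ∀ᶠ z in 𝓝 (a, b), ContDiffAt ℝ ∞ F z) :
    deriv (fun x => deriv (fun x => F (x, φ x)) x) a
      = deriv (fun x => dt F x b) a + 2 * p * deriv (fun x => dx F x b) a
        + p ^ 2 * deriv (fun v => dx F a v) b + r * dx F a b := by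
  have h0 : ContDiffAt ℝ ∞ F (a, b) := h.self_of_nhds
  have hφ0 := hφ.self_of_nhds
  have ht : Tendsto (fun x => (x, φ x)) (𝓝 a) (𝓝 (a, b)) := by
    have : ContinuousAt (fun x => (x, φ x)) a := continuousAt_id.prodMk hφ0.continuousAt
    simpa [ContinuousAt, hφa] using this
  have e1 : (fun x => deriv (fun x => F (x, φ x)) x) =ᶠ[𝓝 a]
      fun x => dt F x (φ x) + ψ x * dx F x (φ x) := by
    filter_upwards [ht.eventually h, hφ] with x hx hx'
    exact (hasDerivAt_comp_graph rfl (diffAt hx) hx').deriv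
  have d1 := hasDerivAt_comp_graph (F := fun z => dt F z.1 z.2) hφa
    (diffAt (contDiffAt_dt h0)) hφ0
  have d2 := hasDerivAt_comp_graph (F := fun z => dx F z.1 z.2) hφa
    (diffAt (contDiffAt_dx h0)) hφ0
  have d := d1.add (hψ.mul d2)
  have c := dt_dx_comm h0
  have e3 : deriv (fun x => dt F x b) a = dt (fun z => dt F z.1 z.2) a b := rfl
  have e4 : deriv (fun x => dx F x b) a = dt (fun z => dx F z.1 z.2) a b := rfl
  have e5 : deriv (fun x => dx F a x) b = dx (fun z => dx F z.1 z.2) a b := rfl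
  rw [e1.deriv_eq, e3, e4, e5]
  refine Eq.trans d.deriv ?_
  simp only [hφa, hψa]
  rw [← c]
  ring

end Calculus

end HeatBVP

/-! ### Local groups near the identity and the transport of graphs -/

namespace HeatBVP

theorem LocalLieGroup.inv_zero {N : ℕ} (Φ : LocalLieGroup N) : Φ.inv 0 = 0 := by
  rw [← Φ.zero_mul _ (Φ.inv_mem 0 Φ.zero_mem), Φ.mul_inv 0 Φ.zero_mem]

theorem LocalLieGroup.zero_mem_V {N : ℕ} (Φ : LocalLieGroup N) : (0 : Fin N → ℝ) ∈ Φ.V :=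
  Φ.V₀_subset Φ.zero_mem

theorem LocalLieGroup.inv_inv {N : ℕ} (Φ : LocalLieGroup N) {a : Fin N → ℝ} (ha : a ∈ Φ.V₀)
    (ha' : Φ.inv a ∈ Φ.V₀) : Φ.inv (Φ.inv a) = a := by
  have h := Φ.mul_assoc a (Φ.V₀_subset ha) (Φ.inv a) (Φ.inv_mem a ha) (Φ.inv (Φ.inv a))
    (Φ.inv_mem _ ha') (by rw [Φ.mul_inv a ha]; exact Φ.zero_mem_V)
    (by rw [Φ.mul_inv _ ha']; exact Φ.zero_mem_V)
  rw [Φ.mul_inv a ha, Φ.mul_inv _ ha', Φ.mul_zero a (Φ.V₀_subset ha),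
    Φ.zero_mul _ (Φ.inv_mem _ ha')] at h
  exact h.symm

theorem LocalLieGroup.continuousAt_inv {N : ℕ} (Φ : LocalLieGroup N) {a : Fin N → ℝ}
    (ha : a ∈ Φ.V₀) : ContinuousAt Φ.inv a :=
  (Φ.inv_smooth.continuousOn).continuousAt (Φ.isOpen_V₀.mem_nhds ha)

/-- For such parameters inversion may be performed twice, so that results about the inverse
transformation apply to the transformation itself. -/
theorem LocalLieGroup.eventually_mem {N : ℕ} (Φ : LocalLieGroup N) :
    ∀ᶠ a in 𝓝 (0 : Fin N → ℝ), a ∈ Φ.V₀ ∧ Φ.inv a ∈ Φ.V₀ := by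
  have h1 := Φ.isOpen_V₀.mem_nhds Φ.zero_mem
  have h2 := Φ.continuousAt_inv Φ.zero_mem
  rw [ContinuousAt, Φ.inv_zero] at h2
  filter_upwards [h1, h2 h1] with a ha ha'
  exact ⟨ha, ha'⟩

namespace PointGroup

variable {N : ℕ} (Φ : PointGroup N)

theorem contDiffAt_act {ε : Fin N → ℝ} {z : ℝ × ℝ × ℝ} (h : (ε, z) ∈ Φ.dom) :
    ContDiffAt ℝ ∞ (fun p : (Fin N → ℝ) × (ℝ × ℝ × ℝ) => Φ.act p.1 p.2) (ε, z) :=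
  Φ.act_smooth.contDiffAt (Φ.isOpen_dom.mem_nhds h)

theorem eventually_dom {ε : Fin N → ℝ} {z : ℝ × ℝ × ℝ} (h : (ε, z) ∈ Φ.dom) :
    ∀ᶠ p in 𝓝 (ε, z), p ∈ Φ.dom :=
  Φ.isOpen_dom.mem_nhds h

theorem contDiffAt_act_right {ε : Fin N → ℝ} {z : ℝ × ℝ × ℝ} (h : (ε, z) ∈ Φ.dom) :
    ContDiffAt ℝ ∞ (Φ.act ε) z :=
  ContDiffAt.comp (g := fun p : (Fin N → ℝ) × (ℝ × ℝ × ℝ) => Φ.act p.1 p.2)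
    (f := fun z => (ε, z)) z (Φ.contDiffAt_act h) (contDiffAt_const.prodMk contDiffAt_id)

theorem eventually_dom_right {ε : Fin N → ℝ} {z : ℝ × ℝ × ℝ} (h : (ε, z) ∈ Φ.dom) :
    ∀ᶠ w in 𝓝 z, (ε, w) ∈ Φ.dom :=
  (Continuous.tendsto (by fun_prop : Continuous fun w : ℝ × ℝ × ℝ => (ε, w)) z).eventually
    (Φ.eventually_dom h)

theorem contDiffAt_act_left {ε : Fin N → ℝ} {z : ℝ × ℝ × ℝ} (h : (ε, z) ∈ Φ.dom) :
    ContDiffAt ℝ ∞ (fun δ => Φ.act δ z) ε :=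
  ContDiffAt.comp (g := fun p : (Fin N → ℝ) × (ℝ × ℝ × ℝ) => Φ.act p.1 p.2)
    (f := fun δ => (δ, z)) ε (Φ.contDiffAt_act h) (contDiffAt_id.prodMk contDiffAt_const)

/-- The axioms give only a left inverse of `act ε`. That it is also a right inverse near the image
comes from the composition law, the product of ε and its inverse being 0. -/
theorem eventually_act_act_inv {ε : Fin N → ℝ} {z : ℝ × ℝ × ℝ} (hε : ε ∈ Φ.V₀)
    (h : (ε, z) ∈ Φ.dom) :
    ∀ᶠ w in 𝓝 (Φ.act ε z), (Φ.inv ε, w) ∈ Φ.dom ∧ (ε, Φ.act (Φ.inv ε) w) ∈ Φ.dom ∧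
      Φ.act ε (Φ.act (Φ.inv ε) w) = w := by
  obtain ⟨h1, h2⟩ := Φ.act_inv ε z hε h
  have hc : Tendsto (Φ.act (Φ.inv ε)) (𝓝 (Φ.act ε z)) (𝓝 z) := by
    have := (Φ.contDiffAt_act_right h1).continuousAt
    rwa [ContinuousAt, h2] at this
  filter_upwards [Φ.eventually_dom_right h1, hc.eventually (Φ.eventually_dom_right h)] with w hw hw'
  have hM : w ∈ Φ.M := (Φ.dom_subset hw).2
  have e := Φ.act_mul ε (Φ.inv ε) w hw hw'
    (by rw [Φ.mul_inv ε hε]; exact Φ.zero_mem_dom w hM)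
  rw [Φ.mul_inv ε hε, Φ.act_zero w hM] at e
  exact ⟨hw, hw', e⟩

theorem eventually_act_inv_act {ε : Fin N → ℝ} {z : ℝ × ℝ × ℝ} (hε : ε ∈ Φ.V₀)
    (h : (ε, z) ∈ Φ.dom) :
    ∀ᶠ w in 𝓝 z, (ε, w) ∈ Φ.dom ∧ Φ.act (Φ.inv ε) (Φ.act ε w) = w := by
  filter_upwards [Φ.eventually_dom_right h] with w hw
  exact ⟨hw, (Φ.act_inv ε w hε hw).2⟩

/-- The derivative of `u*` with respect to `u` does not vanish. -/
theorem dx_act_ne_zero {ε : Fin N → ℝ} {t x u : ℝ} (hε : ε ∈ Φ.V₀)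
    (h : (ε, (t, x, u)) ∈ Φ.dom) : deriv (fun v => (Φ.act ε (t, x, v)).2.2) u ≠ 0 := by
  intro h0
  obtain ⟨h1, h2⟩ := Φ.act_inv ε _ hε h
  have hc : Tendsto (fun v => (t, x, v)) (𝓝 u) (𝓝 (t, x, u)) :=
    Continuous.tendsto (by fun_prop) u
  have hU : HasDerivAt (fun v => (Φ.act ε (t, x, v)).2.2) 0 u := by
    rw [← h0]
    have : DifferentiableAt ℝ (fun v => Φ.act ε (t, x, v)) u :=
      DifferentiableAt.comp (g := Φ.act ε) (f := fun v => (t, x, v)) u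
        (diffAt (Φ.contDiffAt_act_right h)) (by fun_prop)
    exact this.snd.snd.hasDerivAt
  set T := (Φ.act ε (t, x, u)).1
  set X := (Φ.act ε (t, x, u)).2.1
  have hG : DifferentiableAt ℝ (fun v => (Φ.act (Φ.inv ε) (T, X, v)).2.2)
      (Φ.act ε (t, x, u)).2.2 := by
    have : DifferentiableAt ℝ (fun v => Φ.act (Φ.inv ε) (T, X, v)) (Φ.act ε (t, x, u)).2.2 :=
      DifferentiableAt.comp (g := Φ.act (Φ.inv ε)) (f := fun v => (T, X, v)) _
        (diffAt (Φ.contDiffAt_act_right h1)) (by fun_prop)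
    exact this.snd.snd
  have hcomp := hG.hasDerivAt.comp u hU
  -- As T and X are the same for all points of the fibre, freezing them in the inverse
  -- transformation still inverts the fibre map v ↦ u*. A zero derivative would contradict the chain
  -- rule.
  have hid : (fun v => (Φ.act (Φ.inv ε) (T, X, (Φ.act ε (t, x, v)).2.2)).2.2) =ᶠ[𝓝 u] id := by
    filter_upwards [hc.eventually (Φ.eventually_act_inv_act hε h)] with v hv
    obtain ⟨hv1, hv2⟩ := hv
    obtain ⟨e1, e2⟩ := Φ.act_fibre ε t x v u hv1 h
    have : (T, X, (Φ.act ε (t, x, v)).2.2) = Φ.act ε (t, x, v) := by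
      rw [show T = _ from e1.symm, show X = _ from e2.symm]
    rw [this, hv2]
    rfl
  have := (hcomp.congr_of_eventuallyEq hid.symm).unique (hasDerivAt_id u)
  simp at this

/-- The inverse image of the point `(t*, x*)` near the image of `(t, x, u)`. -/
noncomputable def pre (ε : Fin N → ℝ) (u' : ℝ) (q : ℝ × ℝ) : ℝ × ℝ :=
  ((Φ.act (Φ.inv ε) (q.1, q.2, u')).1, (Φ.act (Φ.inv ε) (q.1, q.2, u')).2.1)

variable {Φ} {ε : Fin N → ℝ} {t x u : ℝ}

theorem pre_image (hε : ε ∈ Φ.V₀) (h : (ε, (t, x, u)) ∈ Φ.dom) :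
    Φ.pre ε (Φ.act ε (t, x, u)).2.2 ((Φ.act ε (t, x, u)).1, (Φ.act ε (t, x, u)).2.1) = (t, x) := by
  have := (Φ.act_inv ε _ hε h).2
  simp [pre, this]

theorem contDiffAt_pre (hε : ε ∈ Φ.V₀) (h : (ε, (t, x, u)) ∈ Φ.dom) :
    ContDiffAt ℝ ∞ (Φ.pre ε (Φ.act ε (t, x, u)).2.2)
      ((Φ.act ε (t, x, u)).1, (Φ.act ε (t, x, u)).2.1) := by
  have h1 := (Φ.act_inv ε _ hε h).1
  have : ContDiffAt ℝ ∞ (fun q : ℝ × ℝ => Φ.act (Φ.inv ε) (q.1, q.2, (Φ.act ε (t, x, u)).2.2))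
      ((Φ.act ε (t, x, u)).1, (Φ.act ε (t, x, u)).2.1) :=
    ContDiffAt.comp (g := Φ.act (Φ.inv ε))
      (f := fun q : ℝ × ℝ => (q.1, q.2, (Φ.act ε (t, x, u)).2.2)) _
      (Φ.contDiffAt_act_right h1) (by fun_prop)
  exact this.fst.prodMk this.snd.fst

theorem contDiffAt_graph {f : ℝ × ℝ → ℝ} (h : (ε, (t, x, u)) ∈ Φ.dom)
    (hf : ContDiffAt ℝ ∞ f (t, x)) (hfu : f (t, x) = u) :
    ContDiffAt ℝ ∞ (fun p : ℝ × ℝ => Φ.act ε (p.1, p.2, f p)) (t, x) :=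
  ContDiffAt.comp (g := Φ.act ε) (f := fun p : ℝ × ℝ => (p.1, p.2, f p)) _
    (by simpa [hfu] using Φ.contDiffAt_act_right h) (by fun_prop)

/-- `(T, X)` maps `pre q` back to `q`. -/
theorem eventually_act_pre {f : ℝ × ℝ → ℝ} (hε : ε ∈ Φ.V₀) (h : (ε, (t, x, u)) ∈ Φ.dom)
    (hf : ContinuousAt f (t, x)) (hfu : f (t, x) = u) :
    ∀ᶠ q in 𝓝 ((Φ.act ε (t, x, u)).1, (Φ.act ε (t, x, u)).2.1),
      ((Φ.act ε ((Φ.pre ε (Φ.act ε (t, x, u)).2.2 q).1, (Φ.pre ε (Φ.act ε (t, x, u)).2.2 q).2,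
        f (Φ.pre ε (Φ.act ε (t, x, u)).2.2 q))).1,
      (Φ.act ε ((Φ.pre ε (Φ.act ε (t, x, u)).2.2 q).1, (Φ.pre ε (Φ.act ε (t, x, u)).2.2 q).2,
        f (Φ.pre ε (Φ.act ε (t, x, u)).2.2 q))).2.1) = q := by
  set u' := (Φ.act ε (t, x, u)).2.2 with hu'
  have hp : Tendsto (Φ.pre ε u') (𝓝 ((Φ.act ε (t, x, u)).1, (Φ.act ε (t, x, u)).2.1))
      (𝓝 (t, x)) := by
    have := (contDiffAt_pre hε h).continuousAt
    rwa [ContinuousAt, pre_image hε h] at this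
  have hg : Tendsto (fun p : ℝ × ℝ => (p.1, p.2, f p)) (𝓝 (t, x)) (𝓝 (t, x, u)) := by
    have : ContinuousAt (fun p : ℝ × ℝ => (p.1, p.2, f p)) (t, x) := by fun_prop
    simpa [ContinuousAt, hfu] using this
  have hq : Tendsto (fun q : ℝ × ℝ => (q.1, q.2, u'))
      (𝓝 ((Φ.act ε (t, x, u)).1, (Φ.act ε (t, x, u)).2.1)) (𝓝 (Φ.act ε (t, x, u))) :=
    Continuous.tendsto (by fun_prop : Continuous (fun q : ℝ × ℝ => (q.1, q.2, u'))) _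
  filter_upwards [hq.eventually (Φ.eventually_act_act_inv hε h),
    (hg.comp hp).eventually (Φ.eventually_dom_right h)] with q hq1 hq2
  obtain ⟨a1, a2, a3⟩ := hq1
  -- The inverse was computed at height u', not on the image of the graph; by fibre preservation
  -- this changes neither T nor X.
  have := Φ.act_fibre ε _ _ _ _ hq2 a2
  refine Prod.ext (this.1.trans ?_) (this.2.trans ?_)
  · exact congrArg (fun z => z.1) a3
  · exact congrArg (fun z => z.2.1) a3

/-- Carrying the graph fixes `f'` at the image points only. Since (T, X) has the local inverse
`pre`, these fill a neighbourhood, and `f'` is determined there. -/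
theorem eventually_carriesGraph_eq {f f' : ℝ × ℝ → ℝ} (hε : ε ∈ Φ.V₀)
    (h : (ε, (t, x, u)) ∈ Φ.dom)
    (hf : ContinuousAt f (t, x)) (hfu : f (t, x) = u) (hc : CarriesGraph (Φ.act ε) f f' t x) :
    ∀ᶠ q in 𝓝 ((Φ.act ε (t, x, u)).1, (Φ.act ε (t, x, u)).2.1),
      f' q = (Φ.act ε ((Φ.pre ε (Φ.act ε (t, x, u)).2.2 q).1,
        (Φ.pre ε (Φ.act ε (t, x, u)).2.2 q).2, f (Φ.pre ε (Φ.act ε (t, x, u)).2.2 q))).2.2 := by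
  have hp : Tendsto (Φ.pre ε (Φ.act ε (t, x, u)).2.2)
      (𝓝 ((Φ.act ε (t, x, u)).1, (Φ.act ε (t, x, u)).2.1)) (𝓝 (t, x)) := by
    have := (contDiffAt_pre hε h).continuousAt
    rwa [ContinuousAt, pre_image hε h] at this
  filter_upwards [hp.eventually hc, eventually_act_pre hε h hf hfu] with q h1 h2
  rw [← h1, h2]

/-- Every smooth function is carried to a smooth function by the transformations near the
identity. -/
theorem exists_carriesGraph {f : ℝ × ℝ → ℝ} (hε : ε ∈ Φ.V₀) (h : (ε, (t, x, u)) ∈ Φ.dom)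
    (hf : ContDiffAt ℝ ∞ f (t, x)) (hfu : f (t, x) = u) :
    ∃ f' : ℝ × ℝ → ℝ,
      ContDiffAt ℝ ∞ f' ((Φ.act ε (t, x, u)).1, (Φ.act ε (t, x, u)).2.1) ∧
      CarriesGraph (Φ.act ε) f f' t x := by
  set u' := (Φ.act ε (t, x, u)).2.2 with hu'
  -- The transported function: pull q back to the source, lift it to the graph of f, and apply the
  -- transformation.
  refine ⟨fun q => (Φ.act ε ((Φ.pre ε u' q).1, (Φ.pre ε u' q).2, f (Φ.pre ε u' q))).2.2, ?_, ?_⟩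
  · have h1 := contDiffAt_graph h hf hfu
    have h2 := contDiffAt_pre hε h
    rw [← hu', ← pre_image hε h, ← hu'] at *
    exact (ContDiffAt.comp (g := fun p : ℝ × ℝ => Φ.act ε (p.1, p.2, f p)) _ h1 h2).snd.snd
  · have hg : Tendsto (fun p : ℝ × ℝ => (p.1, p.2, f p)) (𝓝 (t, x)) (𝓝 (t, x, u)) := by
      have : ContinuousAt (fun p : ℝ × ℝ => (p.1, p.2, f p)) (t, x) := by
        have := hf.continuousAt
        fun_prop
      simpa [ContinuousAt, hfu] using this
    have hq : Tendsto (fun p : ℝ × ℝ => ((Φ.act ε (p.1, p.2, f p)).1,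
        (Φ.act ε (p.1, p.2, f p)).2.1, u')) (𝓝 (t, x)) (𝓝 (Φ.act ε (t, x, u))) := by
      have h1 : ContinuousAt (fun p : ℝ × ℝ => Φ.act ε (p.1, p.2, f p)) (t, x) :=
        (contDiffAt_graph h hf hfu).continuousAt
      have : ContinuousAt (fun p : ℝ × ℝ => ((Φ.act ε (p.1, p.2, f p)).1,
        (Φ.act ε (p.1, p.2, f p)).2.1, u')) (t, x) := by fun_prop
      simpa [ContinuousAt, hfu] using this
    have h1 := (Φ.act_inv ε _ hε h).1
    filter_upwards [hg.eventually (Φ.eventually_act_inv_act hε h),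
      hq.eventually (Φ.eventually_dom_right h1)] with p hp1 hp2
    have hp3 := (Φ.act_inv ε _ hε hp1.1).1
    have := Φ.act_fibre (Φ.inv ε) _ _ _ _ hp2 hp3
    have e : Φ.pre ε u' ((Φ.act ε (p.1, p.2, f p)).1, (Φ.act ε (p.1, p.2, f p)).2.1) = p := by
      refine Prod.ext (this.1.trans ?_) (this.2.trans ?_)
      · exact congrArg (fun z => z.1) hp1.2
      · exact congrArg (fun z => z.2.1) hp1.2
    simp only [e]

end PointGroup

end HeatBVP

/-! ### The new time does not depend on x -/

namespace HeatBVP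

theorem Problem.contDiffAt_d (B : Problem) {u : ℝ} (hu : u ∈ B.I) : ContDiffAt ℝ ∞ B.d u :=
  B.d_smooth.contDiffAt (B.isOpen_I.mem_nhds hu)

theorem Problem.differentiableAt_deriv_d (B : Problem) {u : ℝ} (hu : u ∈ B.I) :
    DifferentiableAt ℝ (deriv B.d) u := by
  have h := (contDiffOn_infty_iff_deriv_of_isOpen B.isOpen_I).1 B.d_smooth
  exact diffAt (h.2.contDiffAt (B.isOpen_I.mem_nhds hu))

theorem Problem.heatEqAt_iff (B : Problem) {f : ℝ × ℝ → ℝ} {t x : ℝ}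
    (hf : ContDiffAt ℝ ∞ f (t, x)) (hu : f (t, x) ∈ B.I) :
    B.HeatEqAt f t x ↔ dt f t x = deriv B.d (f (t, x)) * dx f t x ^ 2
      + B.d (f (t, x)) * deriv (fun y => dx f t y) x := by
  have h1 := hasDerivAt_dx (diffAt hf)
  have h2 : HasDerivAt (fun y => dx f t y) (deriv (fun y => dx f t y) x) x :=
    (diffAt (contDiffAt_slice_snd (contDiffAt_dx hf))).hasDerivAt
  have h3 : HasDerivAt (fun y => B.d (f (t, y))) (deriv B.d (f (t, x)) * dx f t x) x :=
    HasDerivAt.comp (h₂ := B.d) (h := fun y => f (t, y)) x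
      (diffAt (B.contDiffAt_d hu)).hasDerivAt h1
  unfold Problem.HeatEqAt
  rw [(h3.fun_mul h2).deriv]
  constructor <;> intro h <;> rw [h] <;> ring

variable {N : ℕ} {B : Problem} {Φ : PointGroup N} {ε : Fin N → ℝ} {t x u : ℝ}

theorem PointGroup.contDiffAt_pre' {u' : ℝ} {q : ℝ × ℝ}
    (h1 : (Φ.inv ε, (q.1, q.2, u')) ∈ Φ.dom) : ContDiffAt ℝ ∞ (Φ.pre ε u') q := by
  have : ContDiffAt ℝ ∞ (fun q : ℝ × ℝ => Φ.act (Φ.inv ε) (q.1, q.2, u')) q :=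
    ContDiffAt.comp (g := Φ.act (Φ.inv ε)) (f := fun q : ℝ × ℝ => (q.1, q.2, u')) _
      (Φ.contDiffAt_act_right h1) (by fun_prop)
  exact this.fst.prodMk this.snd.fst

theorem IsInvariant.heatEq_image (hB : IsInvariant B Φ) (hε : ε ∈ Φ.V₀)
    (h : (ε, (t, x, u)) ∈ Φ.dom) (hx : 0 < x) {f : ℝ × ℝ → ℝ} (hf : ContDiffAt ℝ ∞ f (t, x))
    (hfu : f (t, x) = u) (hH : B.HeatEqAt f t x) :
    ∃ f' : ℝ × ℝ → ℝ, ContDiffAt ℝ ∞ f' ((Φ.act ε (t, x, u)).1, (Φ.act ε (t, x, u)).2.1) ∧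
      CarriesGraph (Φ.act ε) f f' t x ∧
      B.HeatEqAt f' (Φ.act ε (t, x, u)).1 (Φ.act ε (t, x, u)).2.1 := by
  obtain ⟨f', h1, h2⟩ := PointGroup.exists_carriesGraph hε h hf hfu
  exact ⟨f', h1, h2, hB.equation ε t x u h hx f f' hf hfu hH h1 h2⟩

theorem IsInvariant.act_mem_I (hB : IsInvariant B Φ) {z : ℝ × ℝ × ℝ}
    (h : (ε, z) ∈ Φ.dom) : (Φ.act ε z).2.2 ∈ B.I :=
  (hB.subset_strip _ (Φ.act_mem _ _ h)).2

/-- `T` does not depend on `x`, in terms of the inverse transformation. -/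
theorem IsInvariant.dx_pre_fst (hB : IsInvariant B Φ) (hε : ε ∈ Φ.V₀)
    (h : (ε, (t, x, u)) ∈ Φ.dom) (hx : 0 < x) :
    dx (fun q => (Φ.pre ε (Φ.act ε (t, x, u)).2.2 q).1)
      (Φ.act ε (t, x, u)).1 (Φ.act ε (t, x, u)).2.1 = 0 := by
  have hpre := PointGroup.pre_image hε h
  have hsm := PointGroup.contDiffAt_pre hε h
  have hinv := (Φ.act_inv ε _ hε h).1
  have hq : Tendsto (fun q : ℝ × ℝ => (q.1, q.2, (Φ.act ε (t, x, u)).2.2))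
      (𝓝 ((Φ.act ε (t, x, u)).1, (Φ.act ε (t, x, u)).2.1)) (𝓝 (Φ.act ε (t, x, u))) :=
    Continuous.tendsto
      (by fun_prop : Continuous (fun q : ℝ × ℝ => (q.1, q.2, (Φ.act ε (t, x, u)).2.2))) _
  have hq1 := hq.eventually (Φ.eventually_dom_right hinv)
  -- Two test functions, u and u + (s - t)², that both satisfy the equation at (t, x) and differ
  -- only in the second time derivative, which the equation does not see. If the old time depended
  -- on x*, this difference would enter the second space derivative of the images.
  have hc1 : ContDiffAt ℝ ∞ (fun _ : ℝ × ℝ => u) (t, x) := contDiffAt_const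
  have hc2 : ContDiffAt ℝ ∞ (fun p : ℝ × ℝ => u + (p.1 - t) ^ 2) (t, x) := by fun_prop
  have hH1 : B.HeatEqAt (fun _ : ℝ × ℝ => u) t x := by
    simp [Problem.HeatEqAt, dt, dx]
  have hH2 : B.HeatEqAt (fun p : ℝ × ℝ => u + (p.1 - t) ^ 2) t x := by
    have h1 : HasDerivAt (fun s : ℝ => u + (s - t) ^ 2) (2 * (t - t)) t := by
      simpa using (((hasDerivAt_id t).sub_const t).pow 2).const_add u
    simp [Problem.HeatEqAt, dt, dx, h1.deriv]
  obtain ⟨f₁, s₁, g₁, e₁⟩ := hB.heatEq_image hε h hx hc1 rfl hH1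
  obtain ⟨f₂, s₂, g₂, e₂⟩ := hB.heatEq_image hε h hx hc2 (by simp) hH2
  have k₁ := PointGroup.eventually_carriesGraph_eq hε h hc1.continuousAt rfl g₁
  have k₂ := PointGroup.eventually_carriesGraph_eq hε h hc2.continuousAt (by simp) g₂
  have hUI := hB.act_mem_I h
  have hU0 := Φ.dx_act_ne_zero hε h
  set T := (Φ.act ε (t, x, u)).1
  set X := (Φ.act ε (t, x, u)).2.1
  set u' := (Φ.act ε (t, x, u)).2.2 with hu'
  have hptend : Tendsto (Φ.pre ε u') (𝓝 (T, X)) (𝓝 (t, x)) := by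
    have := hsm.continuousAt
    rwa [ContinuousAt, hpre] at this
  -- K(q, v) is the height over q of the image of the constant function u + v. The two images are
  -- then K(q, 0) and K(q, φ(q)²), with φ the old time minus t.
  set K : (ℝ × ℝ) × ℝ → ℝ := fun w =>
    (Φ.act ε ((Φ.pre ε u' w.1).1, (Φ.pre ε u' w.1).2, u + w.2)).2.2 with hK
  have hKs : ∀ᶠ w in 𝓝 ((T, X), (0 : ℝ)), ContDiffAt ℝ ∞ K w := by
    have a1 : Tendsto (fun w : (ℝ × ℝ) × ℝ => w.1) (𝓝 ((T, X), (0 : ℝ))) (𝓝 (T, X)) :=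
      continuous_fst.tendsto _
    have a2 : Tendsto (fun w : (ℝ × ℝ) × ℝ => ((Φ.pre ε u' w.1).1, (Φ.pre ε u' w.1).2, u + w.2))
        (𝓝 ((T, X), (0 : ℝ))) (𝓝 (t, x, u)) := by
      have := hptend.comp a1
      have b : Tendsto (fun w : (ℝ × ℝ) × ℝ => u + w.2) (𝓝 ((T, X), (0 : ℝ))) (𝓝 u) := by
        have : Continuous fun w : (ℝ × ℝ) × ℝ => u + w.2 := by fun_prop
        simpa using this.tendsto ((T, X), (0 : ℝ))
      exact (this.fst_nhds).prodMk_nhds (this.snd_nhds.prodMk_nhds b)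
    filter_upwards [a1.eventually hq1, a2.eventually (Φ.eventually_dom_right h)] with w hw1 hw2
    have c1 : ContDiffAt ℝ ∞ (fun w : (ℝ × ℝ) × ℝ => Φ.pre ε u' w.1) w :=
      ContDiffAt.comp (g := Φ.pre ε u') (f := fun w : (ℝ × ℝ) × ℝ => w.1) w
        (PointGroup.contDiffAt_pre' hw1) contDiffAt_fst
    have c2 : ContDiffAt ℝ ∞ (fun w : (ℝ × ℝ) × ℝ =>
        ((Φ.pre ε u' w.1).1, (Φ.pre ε u' w.1).2, u + w.2)) w := by
      exact c1.fst.prodMk (c1.snd.prodMk (by fun_prop))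
    exact (ContDiffAt.comp (g := Φ.act ε) (f := fun w : (ℝ × ℝ) × ℝ =>
        ((Φ.pre ε u' w.1).1, (Φ.pre ε u' w.1).2, u + w.2)) w
        (Φ.contDiffAt_act_right hw2) c2).snd.snd
  have hφs : ∀ᶠ q in 𝓝 (T, X), ContDiffAt ℝ ∞ (fun q => (Φ.pre ε u' q).1 - t) q := by
    filter_upwards [hq1] with q hq
    exact (PointGroup.contDiffAt_pre' hq).fst.sub contDiffAt_const
  set φ : ℝ × ℝ → ℝ := fun q => (Φ.pre ε u' q).1 - t with hφ
  have hφ0 : φ (T, X) = 0 := by simp [hφ, hpre]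
  have k₁' : f₁ =ᶠ[𝓝 (T, X)] fun q => K (q, 0) := by
    filter_upwards [k₁] with q hq
    simp [hK, hq]
  have k₂' : f₂ =ᶠ[𝓝 (T, X)] fun q => K (q, φ q ^ 2) := by
    filter_upwards [k₂] with q hq
    simp only [hK, hq, hφ]
  have v₁ : f₁ (T, X) = u' := by
    rw [k₁'.self_of_nhds]; simp only [hK, hpre, add_zero]; rfl
  have v₂ : f₂ (T, X) = u' := by
    rw [k₂'.self_of_nhds]; simp only [hφ0, hK, hpre, zero_pow two_ne_zero, add_zero]; rfl
  rw [B.heatEqAt_iff s₁ (by rw [v₁]; exact hUI), v₁] at e₁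
  rw [B.heatEqAt_iff s₂ (by rw [v₂]; exact hUI), v₂] at e₂
  have ct : Tendsto (fun s : ℝ => (s, X)) (𝓝 T) (𝓝 (T, X)) :=
    Continuous.tendsto (by fun_prop) T
  have cx : Tendsto (fun y : ℝ => (T, y)) (𝓝 X) (𝓝 (T, X)) :=
    Continuous.tendsto (by fun_prop) X
  -- the slices of `K`
  have st : ContDiffAt ℝ ∞ (fun w : ℝ × ℝ => K ((w.1, X), w.2)) (T, 0) :=
    ContDiffAt.comp (g := K) (f := fun w : ℝ × ℝ => ((w.1, X), w.2)) (T, (0 : ℝ))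
      hKs.self_of_nhds (by fun_prop)
  have sx : ∀ᶠ w in 𝓝 (X, (0 : ℝ)), ContDiffAt ℝ ∞ (fun w : ℝ × ℝ => K ((T, w.1), w.2)) w := by
    have : Tendsto (fun w : ℝ × ℝ => ((T, w.1), w.2)) (𝓝 (X, (0 : ℝ))) (𝓝 ((T, X), 0)) :=
      Continuous.tendsto (by fun_prop) _
    filter_upwards [this.eventually hKs] with w hw
    exact ContDiffAt.comp (g := K) (f := fun w : ℝ × ℝ => ((T, w.1), w.2)) w hw (by fun_prop)
  have φt : HasDerivAt (fun s => φ (s, X) ^ 2) 0 T := by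
    have := (hasDerivAt_dt (diffAt hφs.self_of_nhds)).fun_pow 2
    simpa [hφ0] using this
  have φx : ∀ᶠ y in 𝓝 X, HasDerivAt (fun y => φ (T, y) ^ 2) (2 * φ (T, y) * dx φ T y) y := by
    filter_upwards [cx.eventually hφs] with y hy
    have := (hasDerivAt_dx (diffAt hy)).fun_pow 2
    simpa using this
  have φxx : HasDerivAt (fun y => 2 * φ (T, y) * dx φ T y) (2 * dx φ T X ^ 2) X := by
    have h1 := hasDerivAt_dx (diffAt hφs.self_of_nhds)
    have h2 : HasDerivAt (fun y => dx φ T y) (deriv (fun y => dx φ T y) X) X :=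
      (diffAt (contDiffAt_slice_snd (contDiffAt_dx hφs.self_of_nhds))).hasDerivAt
    refine ((h1.const_mul 2).fun_mul h2).congr_deriv ?_
    rw [hφ0]; ring
  have D₁t : dt f₁ T X = dt (fun w : ℝ × ℝ => K ((w.1, X), w.2)) T 0 :=
    Filter.EventuallyEq.deriv_eq (ct.eventually k₁')
  have D₂t : dt f₂ T X = dt (fun w : ℝ × ℝ => K ((w.1, X), w.2)) T 0 := by
    have e : (fun s => f₂ (s, X)) =ᶠ[𝓝 T] fun s => K ((s, X), φ (s, X) ^ 2) := ct.eventually k₂'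
    have d := hasDerivAt_comp_graph (F := fun w : ℝ × ℝ => K ((w.1, X), w.2))
      (φ := fun s => φ (s, X) ^ 2) (b := 0) (by simp [hφ0]) (diffAt st) φt
    unfold dt
    rw [e.deriv_eq, d.deriv]
    simp [dt]
  have e₁x : (fun y => f₁ (T, y)) =ᶠ[𝓝 X] fun y => K ((T, y), 0) := cx.eventually k₁'
  have e₂x : (fun y => f₂ (T, y)) =ᶠ[𝓝 X] fun y => K ((T, y), φ (T, y) ^ 2) := cx.eventually k₂'
  have D₁x : dx f₁ T X = dt (fun w : ℝ × ℝ => K ((T, w.1), w.2)) X 0 := e₁x.deriv_eq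
  have D₂x : dx f₂ T X = dt (fun w : ℝ × ℝ => K ((T, w.1), w.2)) X 0 := by
    have d := hasDerivAt_comp_graph (F := fun w : ℝ × ℝ => K ((T, w.1), w.2))
      (φ := fun y => φ (T, y) ^ 2) (b := 0) (by simp [hφ0]) (diffAt sx.self_of_nhds)
      φx.self_of_nhds
    unfold dx
    rw [e₂x.deriv_eq, d.deriv]
    simp [hφ0]
  have D₁xx : deriv (fun y => dx f₁ T y) X
      = deriv (fun y => dt (fun w : ℝ × ℝ => K ((T, w.1), w.2)) y 0) X := by
    exact e₁x.deriv.deriv_eq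
  have D₂xx := deriv_deriv_comp_graph (F := fun w : ℝ × ℝ => K ((T, w.1), w.2))
      (φ := fun y => φ (T, y) ^ 2) (b := 0) (by simp [hφ0]) φx (p := 0) (by simp [hφ0]) φxx sx
  have D₂xx' : deriv (fun y => dx f₂ T y) X
      = deriv (fun y => deriv (fun y => K ((T, y), φ (T, y) ^ 2)) y) X := e₂x.deriv.deriv_eq
  -- The derivative of K in v is ∂u*/∂u, which is nonzero.
  have hv : dx (fun w : ℝ × ℝ => K ((T, w.1), w.2)) X 0 ≠ 0 := by
    have : dx (fun w : ℝ × ℝ => K ((T, w.1), w.2)) X 0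
        = deriv (fun v => (Φ.act ε (t, x, u + v)).2.2) 0 := by
      simp [dx, hK, hpre]
    rw [this, deriv_comp_const_add (f := fun v => (Φ.act ε (t, x, v)).2.2)]
    simpa using hU0
  rw [D₁t, D₁x, D₁xx] at e₁
  rw [D₂t, D₂x, D₂xx', D₂xx] at e₂
  have hd := B.d_pos _ hUI
  -- The images agree to first order at the point, since φ = 0 there, and their second space
  -- derivatives differ by 2φ_x²K_v. Subtracting the two heat equations leaves this term.
  have key : B.d u' * (2 * dx φ T X ^ 2 * dx (fun w : ℝ × ℝ => K ((T, w.1), w.2)) X 0) = 0 := by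
    linarith
  have hz : dx φ T X = 0 := by
    rcases mul_eq_zero.1 key with h | h
    · exact absurd h hd.ne'
    · rcases mul_eq_zero.1 h with h | h
      · simpa using h
      · exact absurd h hv
  have : dx φ T X = dx (fun q => (Φ.pre ε u' q).1) T X := by
    simp [dx, hφ]
  rw [← this, hz]

end HeatBVP

/-! ### The equation pulled back by a transformation, and its linearisation -/

namespace HeatBVP

variable {N : ℕ} {B : Problem} {Φ : PointGroup N} {ε : Fin N → ℝ} {t x u : ℝ}

/-- `act ε` is the inverse of the transformation with parameter `inv ε`, so the previous result is
applied to that parameter at the image point, which again has positive x. -/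
theorem IsInvariant.dx_act_fst (hB : IsInvariant B Φ) (hε : ε ∈ Φ.V₀) (hε' : Φ.inv ε ∈ Φ.V₀)
    (h : (ε, (t, x, u)) ∈ Φ.dom) (hx : 0 < x) :
    dx (fun q => (Φ.act ε (q.1, q.2, u)).1) t x = 0 := by
  obtain ⟨h1, h2⟩ := Φ.act_inv ε _ hε h
  have hX := hB.domain ε t x u h hx
  have := hB.dx_pre_fst hε' (t := (Φ.act ε (t, x, u)).1) (x := (Φ.act ε (t, x, u)).2.1)
    (u := (Φ.act ε (t, x, u)).2.2) h1 hX
  rw [show ((Φ.act ε (t, x, u)).1, (Φ.act ε (t, x, u)).2.1, (Φ.act ε (t, x, u)).2.2)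
    = Φ.act ε (t, x, u) from rfl, h2] at this
  simpa only [PointGroup.pre, Φ.inv_inv hε hε'] using this

/-- `T` does not depend on `x`. -/
theorem IsInvariant.eventually_act_fst_eq (hB : IsInvariant B Φ) (hε : ε ∈ Φ.V₀)
    (hε' : Φ.inv ε ∈ Φ.V₀) (h : (ε, (t, x, u)) ∈ Φ.dom) (hx : 0 < x) {f : ℝ → ℝ}
    (hf : ContinuousAt f x) (hfu : f x = u) :
    ∀ᶠ y in 𝓝 x, (Φ.act ε (t, y, f y)).1 = (Φ.act ε (t, x, u)).1 := by
  have c1 : Tendsto (fun y : ℝ => (t, y, u)) (𝓝 x) (𝓝 (t, x, u)) :=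
    Continuous.tendsto (by fun_prop) x
  have c2 : Tendsto (fun y : ℝ => (t, y, f y)) (𝓝 x) (𝓝 (t, x, u)) := by
    have : ContinuousAt (fun y : ℝ => (t, y, f y)) x := by fun_prop
    simpa [ContinuousAt, hfu] using this
  have e1 := (c1.eventually (Φ.eventually_dom_right h)).and (eventually_gt_nhds hx)
  obtain ⟨r, hr, hball⟩ := Metric.eventually_nhds_iff_ball.1 e1
  have hconst : ∀ y ∈ Metric.ball x r,
      (Φ.act ε (t, y, u)).1 = (Φ.act ε (t, x, u)).1 := by
    intro y hy
    have hderiv : ∀ y ∈ Metric.ball x r, HasDerivAt (fun y => (Φ.act ε (t, y, u)).1) 0 y := by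
      intro y hy
      have hd := hball y hy
      have h0 := hB.dx_act_fst hε hε' hd.1 hd.2
      have hdiff : DifferentiableAt ℝ (fun q : ℝ × ℝ => (Φ.act ε (q.1, q.2, u)).1) (t, y) := by
        have : DifferentiableAt ℝ (fun q : ℝ × ℝ => Φ.act ε (q.1, q.2, u)) (t, y) :=
          DifferentiableAt.comp (g := Φ.act ε) (f := fun q : ℝ × ℝ => (q.1, q.2, u)) (t, y)
            (diffAt (Φ.contDiffAt_act_right hd.1)) (by fun_prop)
        exact this.fst
      rw [← h0]
      exact hasDerivAt_dx hdiff
    exact Metric.isOpen_ball.is_const_of_deriv_eq_zero (convex_ball x r).isPreconnected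
      (fun y hy => (hderiv y hy).differentiableAt.differentiableWithinAt)
      (fun y hy => (hderiv y hy).deriv) hy (Metric.mem_ball_self hr)
  filter_upwards [Metric.ball_mem_nhds x hr, c2.eventually (Φ.eventually_dom_right h)] with y hy hy2
  rw [← hconst y hy]
  exact (Φ.act_fibre ε t y _ _ hy2 (hball y hy).1).1

/-- The heat equation for the image of the graph of `f`, pulled back to the point `(t, x)`. -/
theorem IsInvariant.heatEq_pullback (hB : IsInvariant B Φ) (hε : ε ∈ Φ.V₀)
    (hε' : Φ.inv ε ∈ Φ.V₀) (h : (ε, (t, x, u)) ∈ Φ.dom) (hx : 0 < x) {f : ℝ × ℝ → ℝ}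
    (hf : ContDiffAt ℝ ∞ f (t, x)) (hfu : f (t, x) = u) (hH : B.HeatEqAt f t x)
    {T X V : ℝ × ℝ → ℝ} (hT : T = fun p => (Φ.act ε (p.1, p.2, f p)).1)
    (hX : X = fun p => (Φ.act ε (p.1, p.2, f p)).2.1)
    (hV : V = fun p => (Φ.act ε (p.1, p.2, f p)).2.2) :
    (dt V t x * dx X t x - dx V t x * dt X t x) * dx X t x ^ 2 =
      dt T t x * (B.d (V (t, x)) * (deriv (fun y => dx V t y) x * dx X t x
          - dx V t x * deriv (fun y => dx X t y) x)
        + deriv B.d (V (t, x)) * dx V t x ^ 2 * dx X t x) := by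
  obtain ⟨f', s', g', e'⟩ := hB.heatEq_image hε h hx hf hfu hH
  have hsm := PointGroup.contDiffAt_graph h hf hfu
  have hTs : ContDiffAt ℝ ∞ T (t, x) := hT ▸ hsm.fst
  have hXs : ContDiffAt ℝ ∞ X (t, x) := hX ▸ hsm.snd.fst
  have hVs : ContDiffAt ℝ ∞ V (t, x) := hV ▸ hsm.snd.snd
  have hT0 : T (t, x) = (Φ.act ε (t, x, u)).1 := by simp [hT, hfu]
  have hX0 : X (t, x) = (Φ.act ε (t, x, u)).2.1 := by simp [hX, hfu]
  have hV0 : V (t, x) = (Φ.act ε (t, x, u)).2.2 := by simp [hV, hfu]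
  have hVI : V (t, x) ∈ B.I := by rw [hV0]; exact hB.act_mem_I h
  -- With T locally constant in y, the x-derivatives of V = f'(T, X) come from the one-variable
  -- chain rule in X alone.
  have hTc : ∀ᶠ y in 𝓝 x, T (t, y) = T (t, x) := by
    have := hB.eventually_act_fst_eq hε hε' h hx (f := fun y => f (t, y))
      (contDiffAt_slice_snd hf).continuousAt hfu
    simpa [hT, hfu] using this
  rw [← hT0, ← hX0] at s' e'
  have hcar : ∀ᶠ p in 𝓝 (t, x), f' (T p, X p) = V p := by
    rw [hT, hX, hV]; exact g'
  have cx : Tendsto (fun y : ℝ => (t, y)) (𝓝 x) (𝓝 (t, x)) :=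
    Continuous.tendsto (by fun_prop) x
  have ct : Tendsto (fun s : ℝ => (s, x)) (𝓝 t) (𝓝 (t, x)) :=
    Continuous.tendsto (by fun_prop) t
  have hVx : (fun y => V (t, y)) =ᶠ[𝓝 x] fun y => f' (T (t, x), X (t, y)) := by
    filter_upwards [cx.eventually hcar, hTc] with y h1 h2
    rw [← h1, h2]
  have hVval : f' (T (t, x), X (t, x)) = V (t, x) := hcar.self_of_nhds
  rw [B.heatEqAt_iff s' (by rw [hVval]; exact hVI), hVval] at e'
  have cX : Tendsto (fun y => (T (t, x), X (t, y))) (𝓝 x) (𝓝 (T (t, x), X (t, x))) := by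
    have : ContinuousAt (fun y => (T (t, x), X (t, y))) x := by
      have := (contDiffAt_slice_snd hXs).continuousAt
      fun_prop
    exact this
  have hXx : ∀ᶠ y in 𝓝 x, HasDerivAt (fun y => X (t, y)) (dx X t y) y := by
    filter_upwards [cx.eventually (eventually_differentiableAt hXs)] with y hy
    exact hasDerivAt_dx hy
  have hX2 : HasDerivAt (fun y => dx X t y) (deriv (fun y => dx X t y) x) x :=
    (diffAt (contDiffAt_slice_snd (contDiffAt_dx hXs))).hasDerivAt
  -- first and second derivatives in `x`
  have dV1 : (fun y => dx V t y) =ᶠ[𝓝 x]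
      fun y => dx f' (T (t, x)) (X (t, y)) * dx X t y := by
    filter_upwards [hVx.eventually_nhds, hXx,
      cX.eventually (eventually_differentiableAt s')] with y h1 h2 h3
    have := (HasDerivAt.comp (h₂ := fun v => f' (T (t, x), v)) (h := fun y => X (t, y)) y
      (hasDerivAt_dx h3) h2)
    exact (Filter.EventuallyEq.deriv_eq h1).trans this.deriv
  have dV2 : deriv (fun y => dx V t y) x =
      deriv (fun y => dx f' (T (t, x)) y) (X (t, x)) * dx X t x * dx X t x
        + dx f' (T (t, x)) (X (t, x)) * deriv (fun y => dx X t y) x := by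
    rw [dV1.deriv_eq]
    have h1 : HasDerivAt (fun v => dx f' (T (t, x)) v)
        (deriv (fun y => dx f' (T (t, x)) y) (X (t, x))) (X (t, x)) :=
      (diffAt (contDiffAt_slice_snd (contDiffAt_dx s'))).hasDerivAt
    have h2 := HasDerivAt.comp (h₂ := fun v => dx f' (T (t, x)) v) (h := fun y => X (t, y)) x
      h1 hXx.self_of_nhds
    exact (h2.fun_mul hX2).deriv
  have dVt : dt V t x = dt f' (T (t, x)) (X (t, x)) * dt T t x
      + dx f' (T (t, x)) (X (t, x)) * dt X t x := by
    have e1 : (fun s => V (s, x)) =ᶠ[𝓝 t] fun s => f' (T (s, x), X (s, x)) := by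
      filter_upwards [ct.eventually hcar] with s hs using hs.symm
    have h1 : HasDerivAt (fun s => (T (s, x), X (s, x))) (dt T t x, dt X t x) t :=
      (hasDerivAt_dt (diffAt hTs)).prodMk (hasDerivAt_dt (diffAt hXs))
    have h2 := (diffAt s').hasFDerivAt.comp_hasDerivAt_of_eq t h1 rfl
    refine (e1.deriv_eq).trans (h2.deriv.trans ?_)
    rw [dt_eq_fderiv (diffAt s'), dx_eq_fderiv (diffAt s')]
    have : (dt T t x, dt X t x) = dt T t x • ((1 : ℝ), (0 : ℝ)) + dt X t x • ((0 : ℝ), (1 : ℝ)) := by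
      simp
    rw [this, map_add, map_smul, map_smul, smul_eq_mul, smul_eq_mul]
    ring
  -- After substitution both sides are the two sides of the heat equation for `f'` times T_t X_x³.
  -- Keeping the identity free of denominators makes it easy to differentiate in the parameter.
  rw [dVt, show dx V t x = _ from dV1.self_of_nhds, dV2, e']
  ring

/-- The infinitesimal transformation of the group in the direction `e`. -/
noncomputable def PointGroup.gen (Φ : PointGroup N) (e : Fin N → ℝ) (z : ℝ × ℝ × ℝ) : ℝ × ℝ × ℝ :=
  (deriv (fun s : ℝ => (Φ.act (s • e) z).1) 0, deriv (fun s : ℝ => (Φ.act (s • e) z).2.1) 0,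
    deriv (fun s : ℝ => (Φ.act (s • e) z).2.2) 0)

/-- The linearized equation: `N - τ f_t - ξ f_x` solves the linearization of the heat equation. -/
theorem IsInvariant.linearized (hB : IsInvariant B Φ) (e : Fin N → ℝ) {f : ℝ × ℝ → ℝ}
    (hz : (t, x, u) ∈ Φ.M) (hx : 0 < x) (hf : ContDiff ℝ ∞ f) (hfu : f (t, x) = u)
    (hH : B.HeatEqAt f t x) {τ ξ η : ℝ × ℝ → ℝ}
    (hτ : τ = fun p => (Φ.gen e (p.1, p.2, f p)).1)
    (hξ : ξ = fun p => (Φ.gen e (p.1, p.2, f p)).2.1)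
    (hη : η = fun p => (Φ.gen e (p.1, p.2, f p)).2.2) :
    dt η t x + 3 * dt f t x * dx ξ t x - dx f t x * dt ξ t x =
      dt τ t x * dt f t x + deriv B.d u * η (t, x) * deriv (fun y => dx f t y) x
      + B.d u * (deriv (fun y => dx η t y) x + deriv (fun y => dx f t y) x * dx ξ t x
        - dx f t x * deriv (fun y => dx ξ t y) x)
      + deriv (deriv B.d) u * η (t, x) * dx f t x ^ 2
      + deriv B.d u * (2 * dx f t x * dx η t x + dx f t x ^ 2 * dx ξ t x) := by
  have hu : u ∈ B.I := (hB.subset_strip _ hz).2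
  have hdom : ((0 : Fin N → ℝ), (t, x, f (t, x))) ∈ Φ.dom := by
    rw [hfu]; exact Φ.zero_mem_dom _ hz
  have hfc := hf.continuous
  -- all the functions of `(s, t, x)` are smooth
  have sm : ∀ᶠ w in 𝓝 ((0 : ℝ), (t, x)),
      ContDiffAt ℝ ∞ (fun w : ℝ × (ℝ × ℝ) => Φ.act (w.1 • e) (w.2.1, w.2.2, f w.2)) w := by
    have c : Tendsto (fun w : ℝ × (ℝ × ℝ) => (w.1 • e, (w.2.1, w.2.2, f w.2)))
        (𝓝 ((0 : ℝ), (t, x))) (𝓝 (0, (t, x, f (t, x)))) := by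
      have : Continuous (fun w : ℝ × (ℝ × ℝ) => (w.1 • e, (w.2.1, w.2.2, f w.2))) := by fun_prop
      simpa using this.tendsto ((0 : ℝ), (t, x))
    filter_upwards [c.eventually (Φ.eventually_dom hdom)] with w hw
    exact ContDiffAt.comp (g := fun p : (Fin N → ℝ) × (ℝ × ℝ × ℝ) => Φ.act p.1 p.2)
      (f := fun w : ℝ × (ℝ × ℝ) => (w.1 • e, (w.2.1, w.2.2, f w.2))) w
      (Φ.contDiffAt_act hw) (by fun_prop)
  set T : ℝ → ℝ × ℝ → ℝ := fun s p => (Φ.act (s • e) (p.1, p.2, f p)).1 with hT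
  set X : ℝ → ℝ × ℝ → ℝ := fun s p => (Φ.act (s • e) (p.1, p.2, f p)).2.1 with hX
  set V : ℝ → ℝ × ℝ → ℝ := fun s p => (Φ.act (s • e) (p.1, p.2, f p)).2.2 with hV
  have sx {F : ℝ × (ℝ × ℝ) → ℝ} (hF : ∀ᶠ w in 𝓝 ((0 : ℝ), (t, x)), ContDiffAt ℝ ∞ F w) :
      ∀ᶠ w in 𝓝 ((0 : ℝ), x), ContDiffAt ℝ ∞ (fun w : ℝ × ℝ => F (w.1, (t, w.2))) w := by
    have : Tendsto (fun w : ℝ × ℝ => (w.1, (t, w.2))) (𝓝 ((0 : ℝ), x)) (𝓝 ((0 : ℝ), (t, x))) :=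
      Continuous.tendsto (by fun_prop) _
    filter_upwards [this.eventually hF] with w hw
    exact ContDiffAt.comp (g := F) (f := fun w : ℝ × ℝ => (w.1, (t, w.2))) w hw (by fun_prop)
  have st {F : ℝ × (ℝ × ℝ) → ℝ} (hF : ∀ᶠ w in 𝓝 ((0 : ℝ), (t, x)), ContDiffAt ℝ ∞ F w) :
      ContDiffAt ℝ ∞ (fun w : ℝ × ℝ => F (w.1, (w.2, x))) (0, t) :=
    ContDiffAt.comp (g := F) (f := fun w : ℝ × ℝ => (w.1, (w.2, x))) (0, t) hF.self_of_nhds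
      (by fun_prop)
  have smT : ∀ᶠ w in 𝓝 ((0 : ℝ), (t, x)), ContDiffAt ℝ ∞ (fun w : ℝ × (ℝ × ℝ) => T w.1 w.2) w :=
    sm.mono fun w hw => hw.fst
  have smX : ∀ᶠ w in 𝓝 ((0 : ℝ), (t, x)), ContDiffAt ℝ ∞ (fun w : ℝ × (ℝ × ℝ) => X w.1 w.2) w :=
    sm.mono fun w hw => hw.snd.fst
  have smV : ∀ᶠ w in 𝓝 ((0 : ℝ), (t, x)), ContDiffAt ℝ ∞ (fun w : ℝ × (ℝ × ℝ) => V w.1 w.2) w :=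
    sm.mono fun w hw => hw.snd.snd
  -- derivatives in `s`
  have dTt : HasDerivAt (fun s => dt (T s) t x) (dt τ t x) 0 := by
    rw [hτ]; exact hasDerivAt_dx_param (st smT)
  have dXt : HasDerivAt (fun s => dt (X s) t x) (dt ξ t x) 0 := by
    rw [hξ]; exact hasDerivAt_dx_param (st smX)
  have dVt : HasDerivAt (fun s => dt (V s) t x) (dt η t x) 0 := by
    rw [hη]; exact hasDerivAt_dx_param (st smV)
  have dXx : HasDerivAt (fun s => dx (X s) t x) (dx ξ t x) 0 := by
    rw [hξ]; exact hasDerivAt_dx_param (sx smX).self_of_nhds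
  have dVx : HasDerivAt (fun s => dx (V s) t x) (dx η t x) 0 := by
    rw [hη]; exact hasDerivAt_dx_param (sx smV).self_of_nhds
  have dXxx : HasDerivAt (fun s => deriv (fun y => dx (X s) t y) x)
      (deriv (fun y => dx ξ t y) x) 0 := by
    rw [hξ]; exact hasDerivAt_dx_dx_param (sx smX)
  have dVxx : HasDerivAt (fun s => deriv (fun y => dx (V s) t y) x)
      (deriv (fun y => dx η t y) x) 0 := by
    rw [hη]; exact hasDerivAt_dx_dx_param (sx smV)
  have dV : HasDerivAt (fun s => V s (t, x)) (η (t, x)) 0 := by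
    rw [hη]; exact hasDerivAt_dt (diffAt (sx smV).self_of_nhds)
  -- values at `s = 0`
  have id0 : ∀ᶠ p in 𝓝 (t, x), Φ.act ((0 : ℝ) • e) (p.1, p.2, f p) = (p.1, p.2, f p) := by
    have c : Tendsto (fun p : ℝ × ℝ => (p.1, p.2, f p)) (𝓝 (t, x)) (𝓝 (t, x, u)) := by
      have : Continuous (fun p : ℝ × ℝ => (p.1, p.2, f p)) := by fun_prop
      simpa [hfu] using this.tendsto (t, x)
    filter_upwards [c.eventually (Φ.isOpen_M.mem_nhds hz)] with p hp
    rw [zero_smul, Φ.act_zero _ hp]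
  have T0 : T 0 =ᶠ[𝓝 (t, x)] fun p => p.1 := id0.mono fun p hp => by simp only [hT, hp]
  have X0 : X 0 =ᶠ[𝓝 (t, x)] fun p => p.2 := id0.mono fun p hp => by simp only [hX, hp]
  have V0 : V 0 =ᶠ[𝓝 (t, x)] f := id0.mono fun p hp => by simp only [hV, hp]
  have cx : Tendsto (fun y : ℝ => (t, y)) (𝓝 x) (𝓝 (t, x)) :=
    Continuous.tendsto (by fun_prop) x
  have ct : Tendsto (fun s : ℝ => (s, x)) (𝓝 t) (𝓝 (t, x)) :=
    Continuous.tendsto (by fun_prop) t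
  have eqt {F G : ℝ × ℝ → ℝ} (h : F =ᶠ[𝓝 (t, x)] G) : dt F t x = dt G t x :=
    Filter.EventuallyEq.deriv_eq (ct.eventually h)
  have eqx {F G : ℝ × ℝ → ℝ} (h : F =ᶠ[𝓝 (t, x)] G) :
      (fun y => dx F t y) =ᶠ[𝓝 x] fun y => dx G t y :=
    Filter.EventuallyEq.deriv (cx.eventually h)
  have a1 : dt (T 0) t x = 1 := by rw [eqt T0]; simp [dt]
  have a2 : dt (X 0) t x = 0 := by rw [eqt X0]; simp [dt]
  have a3 : dt (V 0) t x = dt f t x := eqt V0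
  have a4 : dx (X 0) t x = 1 := (eqx X0).self_of_nhds.trans (by simp [dx])
  have a5 : dx (V 0) t x = dx f t x := (eqx V0).self_of_nhds
  have a6 : deriv (fun y => dx (X 0) t y) x = 0 := by rw [(eqx X0).deriv_eq]; simp [dx]
  have a7 : deriv (fun y => dx (V 0) t y) x = deriv (fun y => dx f t y) x := (eqx V0).deriv_eq
  have a8 : V 0 (t, x) = u := by rw [V0.self_of_nhds, hfu]
  have dd : HasDerivAt (fun s => B.d (V s (t, x))) (deriv B.d u * η (t, x)) 0 :=
    HasDerivAt.comp_of_eq (h₂ := B.d) (h := fun s => V s (t, x)) 0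
      (diffAt (B.contDiffAt_d hu)).hasDerivAt dV a8.symm
  have ddd : HasDerivAt (fun s => deriv B.d (V s (t, x))) (deriv (deriv B.d) u * η (t, x)) 0 :=
    HasDerivAt.comp_of_eq (h₂ := deriv B.d) (h := fun s => V s (t, x)) 0
      (B.differentiableAt_deriv_d hu).hasDerivAt dV a8.symm
  -- The pulled back equation holds at the same point for every small s. Its s-derivative at s = 0,
  -- where T = t, X = x, V = f, is the linearised equation.
  have heq : (fun s => (dt (V s) t x * dx (X s) t x - dx (V s) t x * dt (X s) t x)
        * dx (X s) t x ^ 2) =ᶠ[𝓝 0] fun s =>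
      dt (T s) t x * (B.d (V s (t, x)) * (deriv (fun y => dx (V s) t y) x * dx (X s) t x
          - dx (V s) t x * deriv (fun y => dx (X s) t y) x)
        + deriv B.d (V s (t, x)) * dx (V s) t x ^ 2 * dx (X s) t x) := by
    have c : Tendsto (fun s : ℝ => (s • e, (t, x, f (t, x)))) (𝓝 0) (𝓝 (0, (t, x, f (t, x)))) := by
      have : Continuous (fun s : ℝ => (s • e, (t, x, f (t, x)))) := by fun_prop
      simpa using this.tendsto (0 : ℝ)
    filter_upwards [c.fst_nhds.eventually Φ.eventually_mem,
      c.eventually (Φ.eventually_dom hdom)] with s h1 h2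
    rw [hfu] at h2
    exact hB.heatEq_pullback h1.1 h1.2 h2 hx hf.contDiffAt hfu hH rfl rfl rfl
  have L := ((dVt.fun_mul dXx).fun_sub (dVx.fun_mul dXt)).fun_mul (dXx.fun_pow 2)
  have R := dTt.fun_mul ((dd.fun_mul ((dVxx.fun_mul dXx).fun_sub (dVx.fun_mul dXxx))).fun_add
    ((ddd.fun_mul (dVx.fun_pow 2)).fun_mul dXx))
  have key := (L.congr_of_eventuallyEq heq.symm).unique R
  rw [B.heatEqAt_iff hf.contDiffAt (by rw [hfu]; exact hu), hfu] at hH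
  simp only [a1, a2, a3, a4, a5, a6, a7, a8] at key
  norm_num at key
  -- The equation for f itself replaces d f_xx + d' f_x² by f_t in the term containing τ_t.
  linear_combination key - dt τ t x * hH

end HeatBVP

/-! ### The determining equations -/

namespace HeatBVP

variable {N : ℕ} {B : Problem} {Φ : PointGroup N} {ε : Fin N → ℝ} {t x u : ℝ}

namespace PointGroup

theorem gen_eq_fderiv (e : Fin N → ℝ) {z : ℝ × ℝ × ℝ} (hz : z ∈ Φ.M) :
    Φ.gen e z = fderiv ℝ (fun p : (Fin N → ℝ) × (ℝ × ℝ × ℝ) => Φ.act p.1 p.2) (0, z) (e, 0) := by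
  have h1 : HasDerivAt (fun s : ℝ => (s • e, z)) ((e, 0) : (Fin N → ℝ) × (ℝ × ℝ × ℝ)) 0 := by
    have := ((hasDerivAt_id (0 : ℝ)).smul_const e).prodMk (hasDerivAt_const (0 : ℝ) z)
    simpa using this
  have h2 := (diffAt (Φ.contDiffAt_act (Φ.zero_mem_dom z hz))).hasFDerivAt.comp_hasDerivAt_of_eq
    (0 : ℝ) h1 (by simp)
  have h3 : HasDerivAt (fun s : ℝ => Φ.act (s • e) z) _ 0 := h2
  have h4 := (ContinuousLinearMap.snd ℝ ℝ (ℝ × ℝ)).hasFDerivAt.comp_hasDerivAt (0 : ℝ) h3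
  exact Prod.ext ((ContinuousLinearMap.fst ℝ ℝ (ℝ × ℝ)).hasFDerivAt.comp_hasDerivAt (0 : ℝ) h3).deriv
    (Prod.ext ((ContinuousLinearMap.fst ℝ ℝ ℝ).hasFDerivAt.comp_hasDerivAt (0 : ℝ) h4).deriv
      ((ContinuousLinearMap.snd ℝ ℝ ℝ).hasFDerivAt.comp_hasDerivAt (0 : ℝ) h4).deriv)

theorem contDiffAt_gen (e : Fin N → ℝ) {z : ℝ × ℝ × ℝ} (hz : z ∈ Φ.M) :
    ContDiffAt ℝ ∞ (Φ.gen e) z := by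
  have h : ContDiffAt ℝ ∞ (fun z : ℝ × ℝ × ℝ =>
      fderiv ℝ (fun p : (Fin N → ℝ) × (ℝ × ℝ × ℝ) => Φ.act p.1 p.2) (0, z) (e, 0)) z :=
    (ContDiffAt.comp (g := fderiv ℝ (fun p : (Fin N → ℝ) × (ℝ × ℝ × ℝ) => Φ.act p.1 p.2))
      (f := fun z => ((0 : Fin N → ℝ), z)) z
      ((Φ.contDiffAt_act (Φ.zero_mem_dom z hz)).fderiv_right (m := ∞) le_rfl)
      (contDiffAt_const.prodMk contDiffAt_id)).clm_apply contDiffAt_const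
  refine h.congr_of_eventuallyEq ?_
  filter_upwards [Φ.isOpen_M.mem_nhds hz] with w hw
  exact gen_eq_fderiv e hw

theorem gen_fibre (e : Fin N → ℝ) {u' : ℝ} (hz : (t, x, u) ∈ Φ.M) (hz' : (t, x, u') ∈ Φ.M) :
    (Φ.gen e (t, x, u)).1 = (Φ.gen e (t, x, u')).1 ∧
      (Φ.gen e (t, x, u)).2.1 = (Φ.gen e (t, x, u')).2.1 := by
  have c (v : ℝ) (hv : (t, x, v) ∈ Φ.M) : ∀ᶠ s : ℝ in 𝓝 0, (s • e, (t, x, v)) ∈ Φ.dom := by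
    have : Tendsto (fun s : ℝ => (s • e, (t, x, v))) (𝓝 0) (𝓝 (0, (t, x, v))) := by
      have : Continuous (fun s : ℝ => (s • e, (t, x, v))) := by fun_prop
      simpa using this.tendsto (0 : ℝ)
    exact this.eventually (Φ.eventually_dom (Φ.zero_mem_dom _ hv))
  have h := (c u hz).and (c u' hz')
  constructor
  · exact Filter.EventuallyEq.deriv_eq (h.mono fun s hs => (Φ.act_fibre _ _ _ _ _ hs.1 hs.2).1)
  · exact Filter.EventuallyEq.deriv_eq (h.mono fun s hs => (Φ.act_fibre _ _ _ _ _ hs.1 hs.2).2)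

end PointGroup

theorem IsInvariant.dx_gen_fst (hB : IsInvariant B Φ) (e : Fin N → ℝ) (hz : (t, x, u) ∈ Φ.M)
    (hx : 0 < x) : dx (fun p => (Φ.gen e (p.1, p.2, u)).1) t x = 0 := by
  have hdom := Φ.zero_mem_dom _ hz
  have c : Tendsto (fun s : ℝ => (s • e, (t, x, u))) (𝓝 0) (𝓝 (0, (t, x, u))) := by
    have : Continuous (fun s : ℝ => (s • e, (t, x, u))) := by fun_prop
    simpa using this.tendsto (0 : ℝ)
  have sm : ContDiffAt ℝ ∞ (fun w : ℝ × ℝ => (Φ.act (w.1 • e) (t, w.2, u)).1) (0, x) := by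
    have := ContDiffAt.comp (g := fun p : (Fin N → ℝ) × (ℝ × ℝ × ℝ) => Φ.act p.1 p.2)
      (f := fun w : ℝ × ℝ => (w.1 • e, (t, w.2, u))) ((0 : ℝ), x)
      (by simpa using Φ.contDiffAt_act hdom) (by fun_prop)
    exact this.fst
  have h1 := hasDerivAt_dx_param sm
  have h2 : (fun s => dx (fun w : ℝ × ℝ => (Φ.act (w.1 • e) (t, w.2, u)).1) s x)
      =ᶠ[𝓝 0] fun _ => 0 := by
    filter_upwards [c.fst_nhds.eventually Φ.eventually_mem,
      c.eventually (Φ.eventually_dom hdom)] with s h1 h2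
    exact hB.dx_act_fst h1.1 h1.2 h2 hx
  exact h1.unique ((hasDerivAt_const (0 : ℝ) (0 : ℝ)).congr_of_eventuallyEq h2)

/-- The determining equations for an infinitesimal symmetry `τ ∂_t + ξ ∂_x + η ∂_u`. -/
structure Determining (B : Problem) (τ ξ : ℝ × ℝ → ℝ) (η : ℝ × ℝ × ℝ → ℝ) : Prop where
  τ_smooth : ∀ t x, B.τ < t → 0 < x → ContDiffAt ℝ ∞ τ (t, x)
  ξ_smooth : ∀ t x, B.τ < t → 0 < x → ContDiffAt ℝ ∞ ξ (t, x)
  η_smooth : ∀ t x u, B.τ < t → 0 < x → u ∈ B.I → ContDiffAt ℝ ∞ η (t, x, u)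
  τ_x : ∀ t x, B.τ < t → 0 < x → dx τ t x = 0
  balance : ∀ t x u, B.τ < t → 0 < x → u ∈ B.I →
    deriv B.d u * η (t, x, u) = B.d u * (2 * dx ξ t x - dt τ t x)
  η_uu : ∀ t x u, B.τ < t → 0 < x → u ∈ B.I →
    deriv (fun v => dx (fun w => η (t, w.1, w.2)) x v) u = 0
  linear : ∀ t x u, B.τ < t → 0 < x → u ∈ B.I →
    -dt ξ t x = B.d u * (2 * deriv (fun y => dx (fun w => η (t, w.1, w.2)) y u) x
      - deriv (fun y => dx ξ t y) x) + 2 * deriv B.d u * dt (fun w => η (t, w.1, w.2)) x u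
  heat : ∀ t x u, B.τ < t → 0 < x → u ∈ B.I →
    dt (fun p => η (p.1, p.2, u)) t x
      = B.d u * deriv (fun y => dt (fun w => η (t, w.1, w.2)) y u) x

/-- The linearized equation on the jet `f = u`, `f_x = p`, `f_xx = r`. -/
theorem IsInvariant.linearized_jet (hB : IsInvariant B Φ) (e : Fin N → ℝ) {u₁ : ℝ}
    (ht : B.τ < t) (hx : 0 < x) (hu : u ∈ B.I) (hu₁ : u₁ ∈ B.I) (p r : ℝ)
    {τ ξ : ℝ × ℝ → ℝ} {η : ℝ × ℝ × ℝ → ℝ}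
    (hτ : τ = fun p => (Φ.gen e (p.1, p.2, u₁)).1)
    (hξ : ξ = fun p => (Φ.gen e (p.1, p.2, u₁)).2.1)
    (hη : η = fun z => (Φ.gen e z).2.2) :
    dt (fun p => η (p.1, p.2, u)) t x
      + (B.d u * r + deriv B.d u * p ^ 2) * dx (fun w => η (t, w.1, w.2)) x u
      + 3 * (B.d u * r + deriv B.d u * p ^ 2) * dx ξ t x - p * dt ξ t x
    = dt τ t x * (B.d u * r + deriv B.d u * p ^ 2) + deriv B.d u * η (t, x, u) * r
      + B.d u * (deriv (fun y => dt (fun w => η (t, w.1, w.2)) y u) x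
        + 2 * p * deriv (fun y => dx (fun w => η (t, w.1, w.2)) y u) x
        + p ^ 2 * deriv (fun v => dx (fun w => η (t, w.1, w.2)) x v) u
        + r * dx (fun w => η (t, w.1, w.2)) x u + r * dx ξ t x
        - p * deriv (fun y => dx ξ t y) x)
      + deriv (deriv B.d) u * η (t, x, u) * p ^ 2
      + deriv B.d u * (2 * p * (dt (fun w => η (t, w.1, w.2)) x u
        + p * dx (fun w => η (t, w.1, w.2)) x u) + p ^ 2 * dx ξ t x) := by
  have hM {t x u : ℝ} (ht : B.τ < t) (hx : 0 < x) (hu : u ∈ B.I) : (t, x, u) ∈ Φ.M :=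
    hB.region_subset ⟨ht, hx.le, hu⟩
  -- A polynomial realising the jet: u, p, r are free and the time derivative w is the value that
  -- the heat equation imposes.
  set w := B.d u * r + deriv B.d u * p ^ 2 with hw
  set f : ℝ × ℝ → ℝ := fun q => u + p * (q.2 - x) + r / 2 * (q.2 - x) ^ 2 + w * (q.1 - t) with hf
  have hfs : ContDiff ℝ ∞ f := by fun_prop
  have hfu : f (t, x) = u := by simp [hf]
  have fx (y : ℝ) : HasDerivAt (fun y => f (t, y)) (p + r * (y - x)) y := by
    have h1 : HasDerivAt (fun y : ℝ => y - x) 1 y := (hasDerivAt_id y).sub_const x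
    have := ((((h1.const_mul p).const_add u).fun_add ((h1.fun_pow 2).const_mul (r / 2))).add_const
      (w * (t - t)))
    refine this.congr_deriv ?_
    simp; ring
  have ft (s : ℝ) : HasDerivAt (fun s => f (s, x)) w s := by
    have h1 : HasDerivAt (fun s : ℝ => s - t) 1 s := (hasDerivAt_id s).sub_const t
    refine ((h1.const_mul w).const_add (u + p * (x - x) + r / 2 * (x - x) ^ 2)).congr_deriv ?_
    simp
  have fxx : HasDerivAt (fun y => p + r * (y - x)) r x := by
    simpa using (((hasDerivAt_id x).sub_const x).const_mul r).const_add p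
  have dfx (y : ℝ) : dx f t y = p + r * (y - x) := (fx y).deriv
  have dft : dt f t x = w := (ft t).deriv
  have dfxx : deriv (fun y => dx f t y) x = r := by simp only [dfx]; exact fxx.deriv
  have hH : B.HeatEqAt f t x := by
    rw [B.heatEqAt_iff hfs.contDiffAt (by rw [hfu]; exact hu), hfu, dfxx, dfx, dft, hw]
    ring
  have key := hB.linearized e (hM ht hx hu) hx hfs hfu hH rfl rfl rfl
  -- identify the functions along the graph
  have near : ∀ᶠ q in 𝓝 (t, x), (Φ.gen e (q.1, q.2, f q)).1 = τ q ∧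
      (Φ.gen e (q.1, q.2, f q)).2.1 = ξ q := by
    have c1 : ∀ᶠ q in 𝓝 (t, x), B.τ < q.1 := continuous_fst.continuousAt.eventually_const_lt ht
    have c2 : ∀ᶠ q in 𝓝 (t, x), 0 < q.2 := continuous_snd.continuousAt.eventually_const_lt hx
    have c3 : ∀ᶠ q in 𝓝 (t, x), f q ∈ B.I := by
      have := hfs.continuous.tendsto (t, x)
      rw [hfu] at this
      exact this (B.isOpen_I.mem_nhds hu)
    filter_upwards [c1, c2, c3] with q h1 h2 h3
    rw [hτ, hξ]
    exact PointGroup.gen_fibre e (hM h1 h2 h3) (hM h1 h2 hu₁)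
  have cx : Tendsto (fun y : ℝ => (t, y)) (𝓝 x) (𝓝 (t, x)) :=
    Continuous.tendsto (by fun_prop) x
  have ct : Tendsto (fun s : ℝ => (s, x)) (𝓝 t) (𝓝 (t, x)) :=
    Continuous.tendsto (by fun_prop) t
  have e1 : dt (fun q => (Φ.gen e (q.1, q.2, f q)).1) t x = dt τ t x :=
    Filter.EventuallyEq.deriv_eq (ct.eventually (near.mono fun q h => h.1))
  have e2 : dt (fun q => (Φ.gen e (q.1, q.2, f q)).2.1) t x = dt ξ t x :=
    Filter.EventuallyEq.deriv_eq (ct.eventually (near.mono fun q h => h.2))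
  have e3 : (fun y => dx (fun q => (Φ.gen e (q.1, q.2, f q)).2.1) t y) =ᶠ[𝓝 x]
      fun y => dx ξ t y :=
    Filter.EventuallyEq.deriv (cx.eventually (near.mono fun q h => h.2))
  have ηs : ∀ᶠ z in 𝓝 (t, x, u), ContDiffAt ℝ ∞ η z := by
    filter_upwards [Φ.isOpen_M.mem_nhds (hM ht hx hu)] with z hz
    rw [hη]
    exact (PointGroup.contDiffAt_gen e hz).snd.snd
  have ηxs : ∀ᶠ q in 𝓝 (x, u), ContDiffAt ℝ ∞ (fun w : ℝ × ℝ => η (t, w.1, w.2)) q := by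
    have c : Tendsto (fun w : ℝ × ℝ => (t, w.1, w.2)) (𝓝 (x, u)) (𝓝 (t, x, u)) :=
      Continuous.tendsto (by fun_prop) _
    filter_upwards [c.eventually ηs] with q hq
    exact ContDiffAt.comp (g := η) (f := fun w : ℝ × ℝ => (t, w.1, w.2)) q hq (by fun_prop)
  have ηts : ContDiffAt ℝ ∞ (fun w : ℝ × ℝ => η (w.1, x, w.2)) (t, u) :=
    ContDiffAt.comp (g := η) (f := fun w : ℝ × ℝ => (w.1, x, w.2)) (t, u) ηs.self_of_nhds
      (by fun_prop)
  have e4 : dt (fun q => (Φ.gen e (q.1, q.2, f q)).2.2) t x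
      = dt (fun p => η (p.1, p.2, u)) t x + w * dx (fun w => η (t, w.1, w.2)) x u := by
    have := hasDerivAt_comp_graph (F := fun w : ℝ × ℝ => η (w.1, x, w.2))
      (φ := fun s => f (s, x)) hfu (diffAt ηts) (ft t)
    rw [hη] at this ⊢
    exact this.deriv
  have e5 : dx (fun q => (Φ.gen e (q.1, q.2, f q)).2.2) t x
      = dt (fun w => η (t, w.1, w.2)) x u + p * dx (fun w => η (t, w.1, w.2)) x u := by
    have := hasDerivAt_comp_graph (F := fun w : ℝ × ℝ => η (t, w.1, w.2))
      (φ := fun y => f (t, y)) hfu (diffAt ηxs.self_of_nhds) (fx x)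
    rw [hη] at this ⊢
    refine this.deriv.trans ?_
    simp
  have e6 := deriv_deriv_comp_graph (F := fun w : ℝ × ℝ => η (t, w.1, w.2))
      (φ := fun y => f (t, y)) hfu (Eventually.of_forall fx) (p := p) (by simp) fxx ηxs
  have e7 : deriv (fun y => dx (fun q => (Φ.gen e (q.1, q.2, f q)).2.2) t y) x
      = deriv (fun y => deriv (fun y => η (t, y, f (t, y))) y) x := by
    rw [hη]; rfl
  have e8 : (Φ.gen e (t, x, f (t, x))).2.2 = η (t, x, u) := by rw [hη, hfu]
  have e9 : dx f t x = p := by rw [dfx]; simp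
  rw [e1, e2, show dx (fun q => (Φ.gen e (q.1, q.2, f q)).2.1) t x = _ from e3.self_of_nhds,
    e3.deriv_eq, e4, e5, e7, e6, dfxx, dft, e9, e8] at key
  exact key

/-- The linearised equation is polynomial in the free jet variables p = f_x and r = f_xx, so its
coefficients vanish separately. The coefficient of r is the balance; that of p², compared with the
u-derivative of the balance, gives η_uu = 0; that of p gives the linear equation; the constant term
is the heat equation for η. The components τ and ξ are read off at one temperature u₁, as they do
not depend on `u`. -/
theorem IsInvariant.determining (hB : IsInvariant B Φ) (e : Fin N → ℝ) {u₁ : ℝ}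
    (hu₁ : u₁ ∈ B.I) :
    Determining B (fun p => (Φ.gen e (p.1, p.2, u₁)).1) (fun p => (Φ.gen e (p.1, p.2, u₁)).2.1)
      (fun z => (Φ.gen e z).2.2) := by
  have hM {t x u : ℝ} (ht : B.τ < t) (hx : 0 < x) (hu : u ∈ B.I) : (t, x, u) ∈ Φ.M :=
    hB.region_subset ⟨ht, hx.le, hu⟩
  have sm {t x u : ℝ} (ht : B.τ < t) (hx : 0 < x) (hu : u ∈ B.I) :
      ContDiffAt ℝ ∞ (Φ.gen e) (t, x, u) := PointGroup.contDiffAt_gen e (hM ht hx hu)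
  have sm' {t x : ℝ} (ht : B.τ < t) (hx : 0 < x) :
      ContDiffAt ℝ ∞ (fun p : ℝ × ℝ => Φ.gen e (p.1, p.2, u₁)) (t, x) :=
    ContDiffAt.comp (g := Φ.gen e) (f := fun p : ℝ × ℝ => (p.1, p.2, u₁)) (t, x)
      (sm ht hx hu₁) (by fun_prop)
  have bal : ∀ t x u, B.τ < t → 0 < x → u ∈ B.I →
      deriv B.d u * (Φ.gen e (t, x, u)).2.2 = B.d u *
        (2 * dx (fun p => (Φ.gen e (p.1, p.2, u₁)).2.1) t x
          - dt (fun p => (Φ.gen e (p.1, p.2, u₁)).1) t x) := by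
    intro t x u ht hx hu
    have h0 := hB.linearized_jet e ht hx hu hu₁ 0 0 rfl rfl rfl
    have h1 := hB.linearized_jet e ht hx hu hu₁ 0 1 rfl rfl rfl
    norm_num at h0 h1
    linarith
  refine ⟨fun t x ht hx => (sm' ht hx).fst, fun t x ht hx => (sm' ht hx).snd.fst,
    fun t x u ht hx hu => (sm ht hx hu).snd.snd, fun t x ht hx => hB.dx_gen_fst e (hM ht hx hu₁) hx,
    bal, ?_, ?_, ?_⟩
  · intro t x u ht hx hu
    have h0 := hB.linearized_jet e ht hx hu hu₁ 0 0 rfl rfl rfl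
    have h1 := hB.linearized_jet e ht hx hu hu₁ 1 0 rfl rfl rfl
    have h2 := hB.linearized_jet e ht hx hu hu₁ (-1) 0 rfl rfl rfl
    norm_num at h0 h1 h2
    set η : ℝ × ℝ × ℝ → ℝ := fun z => (Φ.gen e z).2.2 with hη
    have hs : ContDiffAt ℝ ∞ (fun w : ℝ × ℝ => η (t, w.1, w.2)) (x, u) :=
      ContDiffAt.comp (g := η) (f := fun w : ℝ × ℝ => (t, w.1, w.2)) (x, u)
        (sm ht hx hu).snd.snd (by fun_prop)
    have d1 : HasDerivAt (fun v => η (t, x, v)) (dx (fun w => η (t, w.1, w.2)) x u) u :=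
      hasDerivAt_dx (diffAt hs)
    have d2 := (B.differentiableAt_deriv_d hu).hasDerivAt.fun_mul d1
    have d3 := (diffAt (B.contDiffAt_d hu)).hasDerivAt.mul_const
      (2 * dx (fun p => (Φ.gen e (p.1, p.2, u₁)).2.1) t x
          - dt (fun p => (Φ.gen e (p.1, p.2, u₁)).1) t x)
    have heq : (fun v => deriv B.d v * η (t, x, v)) =ᶠ[𝓝 u] fun v => B.d v *
        (2 * dx (fun p => (Φ.gen e (p.1, p.2, u₁)).2.1) t x
          - dt (fun p => (Φ.gen e (p.1, p.2, u₁)).1) t x) := by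
      filter_upwards [B.isOpen_I.mem_nhds hu] with v hv using bal t x v ht hx hv
    have d4 := (d3.congr_of_eventuallyEq heq).unique d2
    have hd := B.d_pos u hu
    have : B.d u * deriv (fun v => dx (fun w => η (t, w.1, w.2)) x v) u = 0 := by linarith
    rcases mul_eq_zero.1 this with h | h
    · exact absurd h hd.ne'
    · exact h
  · intro t x u ht hx hu
    have h1 := hB.linearized_jet e ht hx hu hu₁ 1 0 rfl rfl rfl
    have h2 := hB.linearized_jet e ht hx hu hu₁ (-1) 0 rfl rfl rfl
    norm_num at h1 h2
    linarith
  · intro t x u ht hx hu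
    have h0 := hB.linearized_jet e ht hx hu hu₁ 0 0 rfl rfl rfl
    norm_num at h0
    linarith

end HeatBVP

/-! ### Solving the determining equations -/

namespace HeatBVP

theorem exists_affine_of_hasDerivAt_const {S : Set ℝ} (hS : IsOpen S) (hS' : IsPreconnected S)
    {g : ℝ → ℝ} {c : ℝ} (h : ∀ v ∈ S, HasDerivAt g c v) : ∃ b, ∀ v ∈ S, g v = c * v + b := by
  rcases S.eq_empty_or_nonempty with rfl | ⟨v₀, hv₀⟩
  · exact ⟨0, by simp⟩
  · have h1 : ∀ v ∈ S, HasDerivAt (fun v => g v - c * v) 0 v := fun v hv => by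
      simpa using (h v hv).fun_sub ((hasDerivAt_id v).const_mul c)
    refine ⟨g v₀ - c * v₀, fun v hv => ?_⟩
    have : g v - c * v = g v₀ - c * v₀ := hS.is_const_of_deriv_eq_zero hS'
      (fun v hv => (h1 v hv).differentiableAt.differentiableWithinAt)
      (fun v hv => (h1 v hv).deriv) hv hv₀
    linarith

theorem eq_of_hasDerivAt_zero {S : Set ℝ} (hS : IsOpen S) (hS' : IsPreconnected S)
    {g : ℝ → ℝ} (h : ∀ v ∈ S, HasDerivAt g 0 v) {v w : ℝ} (hv : v ∈ S) (hw : w ∈ S) :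
    g v = g w := by
  obtain ⟨b, hb⟩ := exists_affine_of_hasDerivAt_const hS hS' h
  rw [hb v hv, hb w hw]; ring

theorem Problem.isPreconnected_I (B : Problem) : IsPreconnected B.I :=
  B.ordConnected_I.isPreconnected

theorem Problem.exists_d_ne (B : Problem) : ∃ u₁ ∈ B.I, ∃ u₂ ∈ B.I, B.d u₁ ≠ B.d u₂ := by
  by_contra! h
  rcases B.I.eq_empty_or_nonempty with h0 | ⟨u₀, hu₀⟩
  · exact B.d_nonconst ⟨0, by simp [h0]⟩
  · exact B.d_nonconst ⟨B.d u₀, fun u hu => h u hu u₀ hu₀⟩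

theorem Problem.nonempty_I (B : Problem) : B.I.Nonempty :=
  let ⟨u, hu, _⟩ := B.exists_d_ne
  ⟨u, hu⟩

theorem Problem.hasDerivAt_d (B : Problem) {u : ℝ} (hu : u ∈ B.I) :
    HasDerivAt B.d (deriv B.d u) u :=
  (diffAt (B.contDiffAt_d hu)).hasDerivAt

theorem Problem.exists_deriv_ne_zero (B : Problem) : ∃ u ∈ B.I, deriv B.d u ≠ 0 := by
  by_contra! h
  obtain ⟨u₁, h₁, u₂, h₂, hne⟩ := B.exists_d_ne
  exact hne (eq_of_hasDerivAt_zero B.isOpen_I B.isPreconnected_I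
    (fun v hv => by simpa [h v hv] using B.hasDerivAt_d hv) h₁ h₂)

variable {B : Problem} {τ ξ : ℝ × ℝ → ℝ} {η : ℝ × ℝ × ℝ → ℝ}

namespace Determining

theorem τ_eq (h : Determining B τ ξ η) {t x y : ℝ} (ht : B.τ < t) (hx : 0 < x) (hy : 0 < y) :
    τ (t, x) = τ (t, y) :=
  eq_of_hasDerivAt_zero (S := Ioi 0) isOpen_Ioi isPreconnected_Ioi (g := fun x => τ (t, x))
    (fun v hv => by
      rw [← h.τ_x t v ht hv]
      exact hasDerivAt_dx (diffAt (h.τ_smooth t v ht hv))) hx hy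

theorem dt_τ_eq (h : Determining B τ ξ η) {t x y : ℝ} (ht : B.τ < t) (hx : 0 < x) (hy : 0 < y) :
    dt τ t x = dt τ t y := by
  refine Filter.EventuallyEq.deriv_eq ?_
  filter_upwards [eventually_gt_nhds ht] with s hs using h.τ_eq hs hx hy

theorem hasDerivAt_τ (h : Determining B τ ξ η) {t x : ℝ} (ht : B.τ < t) (hx : 0 < x) :
    HasDerivAt (fun s => τ (s, x)) (dt τ t x) t :=
  hasDerivAt_dt (diffAt (h.τ_smooth t x ht hx))

theorem ξ_eq (h : Determining B τ ξ η) (h0 : ∀ t x, B.τ < t → 0 < x → dt ξ t x = 0)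
    {s t x : ℝ} (hs : B.τ < s) (ht : B.τ < t) (hx : 0 < x) : ξ (s, x) = ξ (t, x) :=
  eq_of_hasDerivAt_zero (S := Ioi B.τ) isOpen_Ioi isPreconnected_Ioi (g := fun s => ξ (s, x))
    (fun v hv => by
      rw [← h0 v x hv hx]
      exact hasDerivAt_dt (diffAt (h.ξ_smooth v x hv hx))) hs ht

theorem dx_ξ_eq (h : Determining B τ ξ η) (h0 : ∀ t x, B.τ < t → 0 < x → dt ξ t x = 0)
    {s t x : ℝ} (hs : B.τ < s) (ht : B.τ < t) (hx : 0 < x) : dx ξ s x = dx ξ t x := by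
  refine Filter.EventuallyEq.deriv_eq ?_
  filter_upwards [eventually_gt_nhds hx] with y hy using h.ξ_eq h0 hs ht hy

/-- If no infinitesimal affine transformation of `u` multiplies `d`, then `η = 0`. -/
theorem solve_generic (h : Determining B τ ξ η)
    (hN : ∀ a b A : ℝ, (∀ u ∈ B.I, (a * u + b) * deriv B.d u = A * B.d u) → a = 0 ∧ b = 0) :
    ∃ β γ c : ℝ, ∀ t x u, B.τ < t → 0 < x → u ∈ B.I →
      τ (t, x) = 2 * γ * t + β ∧ ξ (t, x) = γ * x + c ∧ η (t, x, u) = 0 := by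
  have hη : ∀ t x u, B.τ < t → 0 < x → u ∈ B.I → η (t, x, u) = 0 := by
    intro t x u ht hx hu
    have hs (v : ℝ) (hv : v ∈ B.I) : ContDiffAt ℝ ∞ (fun w : ℝ × ℝ => η (t, w.1, w.2)) (x, v) :=
      ContDiffAt.comp (g := η) (f := fun w : ℝ × ℝ => (t, w.1, w.2)) (x, v)
        (h.η_smooth t x v ht hx hv) (by fun_prop)
    have h2 (v : ℝ) (hv : v ∈ B.I) :
        HasDerivAt (fun v => dx (fun w : ℝ × ℝ => η (t, w.1, w.2)) x v) 0 v := by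
      rw [← h.η_uu t x v ht hx hv]
      exact (diffAt (contDiffAt_slice_snd (contDiffAt_dx (hs v hv)))).hasDerivAt
    obtain ⟨a, ha⟩ := exists_affine_of_hasDerivAt_const B.isOpen_I B.isPreconnected_I h2
    have h1 (v : ℝ) (hv : v ∈ B.I) : HasDerivAt (fun v => η (t, x, v)) a v := by
      have := hasDerivAt_dx (diffAt (hs v hv))
      rwa [ha v hv, zero_mul, zero_add] at this
    obtain ⟨b, hb⟩ := exists_affine_of_hasDerivAt_const B.isOpen_I B.isPreconnected_I h1
    -- At fixed (t, x) the component η is affine in `u`, and the balance is then a relation of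
    -- exactly the kind that the hypothesis on d forbids.
    obtain ⟨ha0, hb0⟩ := hN a b (2 * dx ξ t x - dt τ t x) fun v hv => by
      have := h.balance t x v ht hx hv
      rw [hb v hv] at this
      linarith
    rw [hb u hu, ha0, hb0]; ring
  obtain ⟨u₁, hu₁, u₂, hu₂, hne⟩ := B.exists_d_ne
  have hA : ∀ t x, B.τ < t → 0 < x → 2 * dx ξ t x - dt τ t x = 0 := by
    intro t x ht hx
    have := h.balance t x u₁ ht hx hu₁
    rw [hη t x u₁ ht hx hu₁, mul_zero] at this
    exact (mul_eq_zero.1 this.symm).resolve_left (B.d_pos _ hu₁).ne'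
  have hlin : ∀ t x u, B.τ < t → 0 < x → u ∈ B.I →
      dt ξ t x = B.d u * deriv (fun y => dx ξ t y) x := by
    intro t x u ht hx hu
    have e1 : deriv (fun y => dx (fun w => η (t, w.1, w.2)) y u) x = 0 := by
      have : (fun y => dx (fun w => η (t, w.1, w.2)) y u) =ᶠ[𝓝 x] fun _ => 0 := by
        filter_upwards [eventually_gt_nhds hx] with y hy
        have : (fun v => η (t, y, v)) =ᶠ[𝓝 u] fun _ => 0 := by
          filter_upwards [B.isOpen_I.mem_nhds hu] with v hv using hη t y v ht hy hv
        exact this.deriv_eq.trans (by simp)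
      rw [this.deriv_eq]; simp
    have e2 : dt (fun w => η (t, w.1, w.2)) x u = 0 := by
      have : (fun y => η (t, y, u)) =ᶠ[𝓝 x] fun _ => 0 := by
        filter_upwards [eventually_gt_nhds hx] with y hy using hη t y u ht hy hu
      exact this.deriv_eq.trans (by simp)
    have := h.linear t x u ht hx hu
    rw [e1, e2] at this
    linarith
  -- In ξ_t = d(u)ξ_xx only d depends on `u` and it takes two different values, so both sides
  -- vanish.
  have hxx : ∀ t x, B.τ < t → 0 < x → deriv (fun y => dx ξ t y) x = 0 := by
    intro t x ht hx
    have e1 := hlin t x u₁ ht hx hu₁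
    have e2 := hlin t x u₂ ht hx hu₂
    have : (B.d u₁ - B.d u₂) * deriv (fun y => dx ξ t y) x = 0 := by linarith
    exact (mul_eq_zero.1 this).resolve_left (sub_ne_zero.2 hne)
  have ht0 : ∀ t x, B.τ < t → 0 < x → dt ξ t x = 0 := by
    intro t x ht hx
    rw [hlin t x u₁ ht hx hu₁, hxx t x ht hx, mul_zero]
  have htt : B.τ < B.τ + 1 := by linarith
  set γ := dx ξ (B.τ + 1) 1 with hγ
  have dxξ : ∀ t x, B.τ < t → 0 < x → dx ξ t x = γ := by
    intro t x ht hx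
    rw [h.dx_ξ_eq ht0 ht htt hx, hγ]
    refine eq_of_hasDerivAt_zero (S := Ioi 0) isOpen_Ioi isPreconnected_Ioi
      (g := fun y => dx ξ (B.τ + 1) y) (fun v hv => ?_) hx (mem_Ioi.2 one_pos)
    rw [← hxx _ v htt hv]
    exact (diffAt (contDiffAt_slice_snd (contDiffAt_dx (h.ξ_smooth _ v htt hv)))).hasDerivAt
  obtain ⟨c, hc⟩ := exists_affine_of_hasDerivAt_const (S := Ioi 0) isOpen_Ioi isPreconnected_Ioi
    (g := fun y => ξ (B.τ + 1, y)) (c := γ) fun v hv => by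
      rw [← dxξ _ v htt hv]
      exact hasDerivAt_dx (diffAt (h.ξ_smooth _ v htt hv))
  obtain ⟨β, hβ⟩ := exists_affine_of_hasDerivAt_const (S := Ioi B.τ) isOpen_Ioi isPreconnected_Ioi
    (g := fun s => τ (s, 1)) (c := 2 * γ) fun v hv => by
      have := h.hasDerivAt_τ (t := v) (x := 1) hv one_pos
      have e := hA v 1 hv one_pos
      rw [dxξ v 1 hv one_pos] at e
      rwa [← sub_eq_zero.1 e] at this
  refine ⟨β, γ, c, fun t x u ht hx hu => ⟨?_, ?_, hη t x u ht hx hu⟩⟩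
  · rw [h.τ_eq ht hx one_pos, hβ t ht]
  · rw [h.ξ_eq ht0 ht htt hx, hc x hx]

/-- The case where `ℓ(u) d'(u) = d(u)` with an affine function `ℓ`. -/
theorem solve_affine (h : Determining B τ ξ η) {a₀ b₀ : ℝ}
    (hS : ∀ u ∈ B.I, (a₀ * u + b₀) * deriv B.d u = B.d u) :
    ∃ α β γ κ c : ℝ, ∀ t x u, B.τ < t → 0 < x → u ∈ B.I →
      τ (t, x) = α * t + β ∧ ξ (t, x) = γ * x + κ * x ^ 2 + c ∧
      η (t, x, u) = (2 * γ + 4 * κ * x - α) * (a₀ * u + b₀) := by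
  have hd' : ∀ u ∈ B.I, deriv B.d u ≠ 0 := fun u hu h0 => by
    have := hS u hu
    rw [h0, mul_zero] at this
    exact (B.d_pos u hu).ne this
  have hℓ : ∀ u ∈ B.I, a₀ * u + b₀ ≠ 0 := fun u hu h0 => by
    have := hS u hu
    rw [h0, zero_mul] at this
    exact (B.d_pos u hu).ne this
  -- Dividing the balance by d' ≠ 0 gives η = (2ξ_x - τ_t)ℓ with ℓ = a₀u + b₀. The remaining
  -- determining equations concern ξ and τ only.
  have hη : ∀ t x u, B.τ < t → 0 < x → u ∈ B.I →
      η (t, x, u) = (2 * dx ξ t x - dt τ t 1) * (a₀ * u + b₀) := by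
    intro t x u ht hx hu
    have := h.balance t x u ht hx hu
    rw [← hS u hu, h.dt_τ_eq ht hx one_pos] at this
    refine mul_left_cancel₀ (hd' u hu) ?_
    rw [this]; ring
  obtain ⟨u₁, hu₁, u₂, hu₂, hne⟩ := B.exists_d_ne
  have dξx : ∀ t x, B.τ < t → 0 < x →
      HasDerivAt (fun y => dx ξ t y) (deriv (fun y => dx ξ t y) x) x := fun t x ht hx =>
    (diffAt (contDiffAt_slice_snd (contDiffAt_dx (h.ξ_smooth t x ht hx)))).hasDerivAt
  have dA : ∀ t x, B.τ < t → 0 < x →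
      HasDerivAt (fun y => 2 * dx ξ t y - dt τ t 1) (2 * deriv (fun y => dx ξ t y) x) x :=
    fun t x ht hx => ((dξx t x ht hx).const_mul 2).sub_const _
  have ηx : ∀ t x u, B.τ < t → 0 < x → u ∈ B.I → dt (fun w => η (t, w.1, w.2)) x u
      = 2 * deriv (fun y => dx ξ t y) x * (a₀ * u + b₀) := by
    intro t x u ht hx hu
    have : (fun y => η (t, y, u)) =ᶠ[𝓝 x]
        fun y => (2 * dx ξ t y - dt τ t 1) * (a₀ * u + b₀) := by
      filter_upwards [eventually_gt_nhds hx] with y hy using hη t y u ht hy hu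
    exact this.deriv_eq.trans ((dA t x ht hx).mul_const _).deriv
  have hlin : ∀ t x u, B.τ < t → 0 < x → u ∈ B.I →
      -dt ξ t x = B.d u * ((4 * a₀ + 3) * deriv (fun y => dx ξ t y) x) := by
    intro t x u ht hx hu
    have e1 : deriv (fun y => dx (fun w => η (t, w.1, w.2)) y u) x
        = 2 * deriv (fun y => dx ξ t y) x * a₀ := by
      have : (fun y => dx (fun w => η (t, w.1, w.2)) y u) =ᶠ[𝓝 x]
          fun y => (2 * dx ξ t y - dt τ t 1) * a₀ := by
        filter_upwards [eventually_gt_nhds hx] with y hy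
        have : (fun v => η (t, y, v)) =ᶠ[𝓝 u]
            fun v => (2 * dx ξ t y - dt τ t 1) * (a₀ * v + b₀) := by
          filter_upwards [B.isOpen_I.mem_nhds hu] with v hv using hη t y v ht hy hv
        refine this.deriv_eq.trans ?_
        simp
      rw [this.deriv_eq]
      exact ((dA t x ht hx).mul_const _).deriv
    have := h.linear t x u ht hx hu
    rw [e1, ηx t x u ht hx hu] at this
    rw [this]
    linear_combination (4 * deriv (fun y => dx ξ t y) x) * hS u hu
  -- The factor 4a₀ + 3 is zero exactly when d is a power with exponent 1/a₀ = -4/3. It is not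
  -- cancelled here: a quadratic term in ξ is allowed throughout and is excluded later by the
  -- condition at infinity.
  have hxx : ∀ t x, B.τ < t → 0 < x → (4 * a₀ + 3) * deriv (fun y => dx ξ t y) x = 0 := by
    intro t x ht hx
    have e1 := hlin t x u₁ ht hx hu₁
    have e2 := hlin t x u₂ ht hx hu₂
    have : (B.d u₁ - B.d u₂) * ((4 * a₀ + 3) * deriv (fun y => dx ξ t y) x) = 0 := by linarith
    exact (mul_eq_zero.1 this).resolve_left (sub_ne_zero.2 hne)
  have ht0 : ∀ t x, B.τ < t → 0 < x → dt ξ t x = 0 := by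
    intro t x ht hx
    have := hlin t x u₁ ht hx hu₁
    rw [hxx t x ht hx, mul_zero] at this
    linarith
  have htt : B.τ < B.τ + 1 := by linarith
  have hξxx : ∀ t x, B.τ < t → 0 < x → deriv (fun y => dx ξ t y) x
      = deriv (fun y => dx ξ (B.τ + 1) y) x := by
    intro t x ht hx
    refine Filter.EventuallyEq.deriv_eq ?_
    filter_upwards [eventually_gt_nhds hx] with y hy using h.dx_ξ_eq ht0 ht htt hy
  have τs : ∀ t, B.τ < t →
      HasDerivAt (fun s => dt τ s 1) (deriv (fun s => dt τ s 1) t) t := fun t ht =>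
    (diffAt (contDiffAt_slice_fst (contDiffAt_dt (h.τ_smooth t 1 ht one_pos)))).hasDerivAt
  have ξs : ∀ x, 0 < x → HasDerivAt (fun y => deriv (fun y => dx ξ (B.τ + 1) y) y)
      (deriv (fun y => deriv (fun y => dx ξ (B.τ + 1) y) y) x) x := by
    intro x hx
    have := h.ξ_smooth (B.τ + 1) x htt hx
    exact (diffAt (contDiffAt_slice_snd (F := fun q => dx (fun p => dx ξ p.1 p.2) q.1 q.2)
      (contDiffAt_dx (contDiffAt_dx this)))).hasDerivAt
  -- The equation η_t = dη_xx becomes -τ_tt = 2dξ_xxx after division by ℓ ≠ 0; since d is not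
  -- constant, both sides vanish.
  have hheat : ∀ t x u, B.τ < t → 0 < x → u ∈ B.I →
      -deriv (fun s => dt τ s 1) t
        = B.d u * (2 * deriv (fun y => deriv (fun y => dx ξ (B.τ + 1) y) y) x) := by
    intro t x u ht hx hu
    have e1 : dt (fun p => η (p.1, p.2, u)) t x
        = -deriv (fun s => dt τ s 1) t * (a₀ * u + b₀) := by
      have : (fun s => η (s, x, u)) =ᶠ[𝓝 t]
          fun s => (2 * dx ξ (B.τ + 1) x - dt τ s 1) * (a₀ * u + b₀) := by
        filter_upwards [eventually_gt_nhds ht] with s hs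
        rw [hη s x u hs hx hu, h.dx_ξ_eq ht0 hs htt hx]
      refine this.deriv_eq.trans ?_
      have d := ((τs t ht).const_sub (2 * dx ξ (B.τ + 1) x)).mul_const (a₀ * u + b₀)
      exact d.deriv
    have e2 : deriv (fun y => dt (fun w => η (t, w.1, w.2)) y u) x
        = 2 * deriv (fun y => deriv (fun y => dx ξ (B.τ + 1) y) y) x * (a₀ * u + b₀) := by
      have : (fun y => dt (fun w => η (t, w.1, w.2)) y u) =ᶠ[𝓝 x]
          fun y => 2 * deriv (fun y => dx ξ (B.τ + 1) y) y * (a₀ * u + b₀) := by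
        filter_upwards [eventually_gt_nhds hx] with y hy
        rw [ηx t y u ht hy hu, hξxx t y ht hy]
      rw [this.deriv_eq]
      exact (((ξs x hx).const_mul 2).mul_const _).deriv
    have := h.heat t x u ht hx hu
    rw [e1, e2] at this
    refine mul_right_cancel₀ (hℓ u hu) ?_
    rw [this]; ring
  have h3 : ∀ x, 0 < x → deriv (fun y => deriv (fun y => dx ξ (B.τ + 1) y) y) x = 0 := by
    intro x hx
    have e1 := hheat (B.τ + 1) x u₁ htt hx hu₁
    have e2 := hheat (B.τ + 1) x u₂ htt hx hu₂
    have : (B.d u₁ - B.d u₂) * deriv (fun y => deriv (fun y => dx ξ (B.τ + 1) y) y) x = 0 := by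
      linarith
    exact (mul_eq_zero.1 this).resolve_left (sub_ne_zero.2 hne)
  have h4 : ∀ t, B.τ < t → HasDerivAt (fun s => dt τ s 1) 0 t := by
    intro t ht
    have := hheat t 1 u₁ ht one_pos hu₁
    rw [h3 1 one_pos, mul_zero, mul_zero, neg_eq_zero] at this
    rw [← this]
    exact τs t ht
  obtain ⟨α, hα⟩ := exists_affine_of_hasDerivAt_const (S := Ioi B.τ) isOpen_Ioi isPreconnected_Ioi h4
  obtain ⟨β, hβ⟩ := exists_affine_of_hasDerivAt_const (S := Ioi B.τ) isOpen_Ioi isPreconnected_Ioi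
    (g := fun s => τ (s, 1)) (c := α) fun v hv => by
      have := h.hasDerivAt_τ (t := v) (x := 1) hv one_pos
      rwa [hα v hv, zero_mul, zero_add] at this
  obtain ⟨κ, hκ⟩ := exists_affine_of_hasDerivAt_const (S := Ioi 0) isOpen_Ioi isPreconnected_Ioi
    (g := fun y => deriv (fun y => dx ξ (B.τ + 1) y) y) (c := 0) fun v hv => by
      rw [← h3 v hv]; exact ξs v hv
  obtain ⟨γ, hγ⟩ := exists_affine_of_hasDerivAt_const (S := Ioi 0) isOpen_Ioi isPreconnected_Ioi
    (g := fun y => dx ξ (B.τ + 1) y) (c := κ) fun v hv => by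
      have := dξx _ v htt hv
      rwa [hκ v hv, zero_mul, zero_add] at this
  obtain ⟨c, hc⟩ := exists_affine_of_hasDerivAt_const (S := Ioi 0) isOpen_Ioi isPreconnected_Ioi
    (g := fun y => ξ (B.τ + 1, y) - κ / 2 * y ^ 2) (c := γ) fun v hv => by
      have := (hasDerivAt_dx (diffAt (h.ξ_smooth _ v htt hv))).fun_sub
        (((hasDerivAt_id v).fun_pow 2).const_mul (κ / 2))
      rw [hγ v hv] at this
      refine this.congr_deriv ?_
      simp
      ring
  -- Up to now κ was the constant value of ξ_xx; the coefficient of x² in ξ is half of it.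
  refine ⟨α, β, γ, κ / 2, c, fun t x u ht hx hu => ⟨?_, ?_, ?_⟩⟩
  · rw [h.τ_eq ht hx one_pos, hβ t ht]
  · have := hc x hx
    rw [h.ξ_eq ht0 ht htt hx]
    linarith
  · rw [hη t x u ht hx hu, h.dx_ξ_eq ht0 ht htt hx, hγ x hx, hα t ht]
    ring

end Determining

end HeatBVP

namespace HeatBVP

variable {N : ℕ} {B : Problem} {Φ : PointGroup N} {ε : Fin N → ℝ} {t x u : ℝ}

/-! ### The infinitesimal transformations on the region -/

/-- The determining equations are known for x > 0 only, but the group acts on a neighbourhood of the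
boundary, so formulas pass to the limit x → 0+. -/
theorem eq_at_boundary {F G : ℝ × ℝ × ℝ → ℝ} {t u : ℝ} (hF : ContinuousAt F (t, 0, u))
    (hG : ContinuousAt G (t, 0, u)) (h : ∀ x, 0 < x → F (t, x, u) = G (t, x, u)) :
    F (t, 0, u) = G (t, 0, u) := by
  have c : Tendsto (fun x : ℝ => (t, x, u)) (𝓝[>] 0) (𝓝 (t, 0, u)) :=
    (Continuous.tendsto (by fun_prop : Continuous fun x : ℝ => (t, x, u)) 0).mono_left
      nhdsWithin_le_nhds
  refine tendsto_nhds_unique (hF.tendsto.comp c) ((hG.tendsto.comp c).congr' ?_)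
  filter_upwards [self_mem_nhdsWithin] with x hx using (h x hx).symm

theorem IsInvariant.gen_boundary (hB : IsInvariant B Φ) (e : Fin N → ℝ)
    (hz : (t, 0, u) ∈ Φ.M) : (Φ.gen e (t, 0, u)).2.1 = 0 := by
  have c : Tendsto (fun s : ℝ => (s • e, (t, (0 : ℝ), u))) (𝓝 0) (𝓝 (0, (t, 0, u))) := by
    have : Continuous (fun s : ℝ => (s • e, (t, (0 : ℝ), u))) := by fun_prop
    simpa using this.tendsto (0 : ℝ)
  have : (fun s : ℝ => (Φ.act (s • e) (t, 0, u)).2.1) =ᶠ[𝓝 0] fun _ => 0 := by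
    filter_upwards [c.eventually (Φ.eventually_dom (Φ.zero_mem_dom _ hz))] with s hs
    exact hB.boundary _ _ _ hs
  exact this.deriv_eq.trans (by simp)

/-- A formula for the infinitesimal transformation that holds for `x > 0` holds on the region. -/
theorem IsInvariant.gen_eq_of_pos (hB : IsInvariant B Φ) (e : Fin N → ℝ)
    {G : ℝ × ℝ × ℝ → ℝ × ℝ × ℝ} (hG : Continuous G)
    (h : ∀ t x u, B.τ < t → 0 < x → u ∈ B.I → Φ.gen e (t, x, u) = G (t, x, u)) :
    ∀ z ∈ B.region, Φ.gen e z = G z := by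
  rintro ⟨t, x, u⟩ ⟨ht, hx, hu⟩
  rcases hx.lt_or_eq with hx | hx
  · exact h t x u ht hx hu
  · simp only at hx
    subst hx
    have hc := (PointGroup.contDiffAt_gen e
      (hB.region_subset (show (t, (0 : ℝ), u) ∈ B.region from ⟨ht, le_rfl, hu⟩))).continuousAt
    refine Prod.ext ?_ (Prod.ext ?_ ?_)
    · exact eq_at_boundary (F := fun z => (Φ.gen e z).1) (G := fun z => (G z).1) hc.fst
        hG.continuousAt.fst fun x hx => congrArg _ (h t x u ht hx hu)
    · exact eq_at_boundary (F := fun z => (Φ.gen e z).2.1) (G := fun z => (G z).2.1) hc.snd.fst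
        hG.continuousAt.snd.fst fun x hx => congrArg (fun z => z.2.1) (h t x u ht hx hu)
    · exact eq_at_boundary (F := fun z => (Φ.gen e z).2.2) (G := fun z => (G z).2.2) hc.snd.snd
        hG.continuousAt.snd.snd fun x hx => congrArg (fun z => z.2.2) (h t x u ht hx hu)

/-- For A ≠ 0, division by A would produce the excluded affine function. For A = 0, the affine
function vanishes on an open set where d' ≠ 0, hence identically. -/
theorem Problem.generic_of_not_affine
    (h : ¬ ∃ a₀ b₀ : ℝ, ∀ u ∈ B.I, (a₀ * u + b₀) * deriv B.d u = B.d u) (a b A : ℝ)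
    (hab : ∀ u ∈ B.I, (a * u + b) * deriv B.d u = A * B.d u) : a = 0 ∧ b = 0 := by
  by_cases hA : A = 0
  · subst hA
    obtain ⟨u₁, hu₁, hne⟩ := B.exists_deriv_ne_zero
    have hc := (B.differentiableAt_deriv_d hu₁).continuousAt
    have h0 : ∀ᶠ u in 𝓝 u₁, a * u + b = 0 := by
      filter_upwards [hc.eventually_ne hne, B.isOpen_I.mem_nhds hu₁] with u h1 h2
      have := hab u h2
      rw [zero_mul] at this
      exact (mul_eq_zero.1 this).resolve_right h1
    have h1 : a = 0 := by
      have e : (fun u => a * u + b) =ᶠ[𝓝 u₁] fun _ => 0 := h0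
      have := e.deriv_eq
      have d := ((hasDerivAt_id u₁).const_mul a).add_const b
      simpa using this
    have h2 := h0.self_of_nhds
    rw [h1] at h2
    exact ⟨h1, by linarith⟩
  · refine absurd ⟨a / A, b / A, fun u hu => ?_⟩ h
    have := hab u hu
    field_simp
    linarith

/-- The infinitesimal transformation, as a linear function of the direction. -/
noncomputable def PointGroup.genL (Φ : PointGroup N) (z : ℝ × ℝ × ℝ) :
    (Fin N → ℝ) →L[ℝ] ℝ × ℝ × ℝ :=
  (fderiv ℝ (fun p : (Fin N → ℝ) × (ℝ × ℝ × ℝ) => Φ.act p.1 p.2) (0, z)).comp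
    (ContinuousLinearMap.inl ℝ _ _)

theorem PointGroup.genL_apply (e : Fin N → ℝ) {z : ℝ × ℝ × ℝ} (hz : z ∈ Φ.M) :
    Φ.genL z e = Φ.gen e z := by
  rw [PointGroup.gen_eq_fderiv e hz]; rfl

/-- The alternative is decided by d alone, so a₀ and b₀ are chosen before the direction e. The
predicate P carries the constraint on each direction's coefficients in the generic case, which lets
both cases share one statement. -/
theorem IsInvariant.gen_form_aux (hB : IsInvariant B Φ) : ∃ a₀ b₀ : ℝ, ∃ P : ℝ → ℝ → ℝ → Prop,
    (∀ e, ∃ α β γ κ : ℝ, P α γ κ ∧ ∀ z ∈ B.region, Φ.gen e z = (α * z.1 + β,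
      γ * z.2.1 + κ * z.2.1 ^ 2, (2 * γ + 4 * κ * z.2.1 - α) * (a₀ * z.2.2 + b₀))) ∧
    ((∀ u ∈ B.I, (a₀ * u + b₀) * deriv B.d u = B.d u) ∨
      ∀ α γ κ, P α γ κ → 2 * γ = α ∧ κ = 0) := by
  obtain ⟨u₁, hu₁⟩ := B.nonempty_I
  have hM {t x u : ℝ} (ht : B.τ < t) (hx : 0 ≤ x) (hu : u ∈ B.I) : (t, x, u) ∈ Φ.M :=
    hB.region_subset ⟨ht, hx, hu⟩
  have htt : B.τ < B.τ + 1 := by linarith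
  have fib (e : Fin N → ℝ) {t x u : ℝ} (ht : B.τ < t) (hx : 0 < x) (hu : u ∈ B.I) :=
    PointGroup.gen_fibre e (hM ht hx.le hu) (hM ht hx.le hu₁)
  have hc0 (e : Fin N → ℝ) {γ κ c : ℝ} (h : ∀ x, 0 < x →
      (Φ.gen e (B.τ + 1, x, u₁)).2.1 = γ * x + κ * x ^ 2 + c) : c = 0 := by
    have := eq_at_boundary (t := B.τ + 1) (u := u₁) (F := fun z => (Φ.gen e z).2.1)
      (G := fun z => γ * z.2.1 + κ * z.2.1 ^ 2 + c)
      (PointGroup.contDiffAt_gen e (hM htt le_rfl hu₁)).continuousAt.snd.fst (by fun_prop) h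
    simp only at this
    rw [hB.gen_boundary e (hM htt le_rfl hu₁)] at this
    linarith
  by_cases hS : ∃ a₀ b₀ : ℝ, ∀ u ∈ B.I, (a₀ * u + b₀) * deriv B.d u = B.d u
  · obtain ⟨a₀, b₀, hS⟩ := hS
    refine ⟨a₀, b₀, fun _ _ _ => True, fun e => ?_, Or.inl hS⟩
    obtain ⟨α, β, γ, κ, c, h⟩ := (hB.determining e hu₁).solve_affine hS
    have hc := hc0 e fun x hx => (h _ x u₁ htt hx hu₁).2.1
    subst hc
    refine ⟨α, β, γ, κ, trivial, hB.gen_eq_of_pos e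
      (G := fun z => (α * z.1 + β, γ * z.2.1 + κ * z.2.1 ^ 2,
        (2 * γ + 4 * κ * z.2.1 - α) * (a₀ * z.2.2 + b₀))) (by fun_prop) ?_⟩
    intro t x u ht hx hu
    obtain ⟨h1, h2, h3⟩ := h t x u ht hx hu
    obtain ⟨f1, f2⟩ := fib e ht hx hu
    refine Prod.ext (f1.trans h1) (Prod.ext (f2.trans (h2.trans ?_)) h3)
    simp
  · refine ⟨0, 0, fun α γ κ => 2 * γ = α ∧ κ = 0, fun e => ?_, Or.inr fun α γ κ h => h⟩
    obtain ⟨β, γ, c, h⟩ := (hB.determining e hu₁).solve_generic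
      (Problem.generic_of_not_affine hS)
    have hc := hc0 e (γ := γ) (κ := 0) (c := c) fun x hx => by
      have := (h _ x u₁ htt hx hu₁).2.1
      simp only at this
      rw [this]; ring
    subst hc
    refine ⟨2 * γ, β, γ, 0, ⟨rfl, rfl⟩, hB.gen_eq_of_pos e
      (G := fun z => (2 * γ * z.1 + β, γ * z.2.1 + 0 * z.2.1 ^ 2,
        (2 * γ + 4 * 0 * z.2.1 - 2 * γ) * (0 * z.2.2 + 0))) (by fun_prop) ?_⟩
    intro t x u ht hx hu
    obtain ⟨h1, h2, h3⟩ := h t x u ht hx hu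
    obtain ⟨f1, f2⟩ := fib e ht hx hu
    refine Prod.ext (f1.trans h1) (Prod.ext (f2.trans (h2.trans ?_)) (h3.trans ?_))
    · simp
    · simp

/-- The infinitesimal transformations of a group of invariance. -/
theorem IsInvariant.gen_form (hB : IsInvariant B Φ) :
    ∃ (α β γ κ : (Fin N → ℝ) →L[ℝ] ℝ) (a₀ b₀ : ℝ),
    (∀ e, ∀ z ∈ B.region, Φ.gen e z = (α e * z.1 + β e,
      γ e * z.2.1 + κ e * z.2.1 ^ 2, (2 * γ e + 4 * κ e * z.2.1 - α e) * (a₀ * z.2.2 + b₀))) ∧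
    ((∀ u ∈ B.I, (a₀ * u + b₀) * deriv B.d u = B.d u) ∨ ∀ e, 2 * γ e = α e ∧ κ e = 0) := by
  obtain ⟨a₀, b₀, P, h, hP⟩ := hB.gen_form_aux
  -- The chosen coefficients are so far arbitrary functions of e. They are linear because values of
  -- the generator, which is linear in e, recover them: α and β from the times τ + 1 and τ + 2, γ
  -- and κ from x = 1 and x = 2.
  choose α β γ κ hPe h using h
  obtain ⟨u₁, hu₁⟩ := B.nonempty_I
  have r (k x : ℝ) (hk : 0 < k) (hx : 0 ≤ x) : (B.τ + k, x, u₁) ∈ B.region :=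
    ⟨by simpa using hk, hx, hu₁⟩
  have hL (e : Fin N → ℝ) (k x : ℝ) (hk : 0 < k) (hx : 0 ≤ x) :
      Φ.genL (B.τ + k, x, u₁) e = Φ.gen e (B.τ + k, x, u₁) :=
    PointGroup.genL_apply e (hB.region_subset (r k x hk hx))
  let F := ContinuousLinearMap.fst ℝ ℝ (ℝ × ℝ)
  let S := (ContinuousLinearMap.fst ℝ ℝ ℝ).comp (ContinuousLinearMap.snd ℝ ℝ (ℝ × ℝ))
  obtain ⟨α', hα⟩ : ∃ L : (Fin N → ℝ) →L[ℝ] ℝ, ∀ e, L e = α e := by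
    refine ⟨F.comp (Φ.genL (B.τ + 2, 0, u₁)) - F.comp (Φ.genL (B.τ + 1, 0, u₁)), fun e => ?_⟩
    simp only [F, sub_apply, ContinuousLinearMap.comp_apply,
      ContinuousLinearMap.coe_fst', hL e 2 0 two_pos le_rfl, hL e 1 0 one_pos le_rfl,
      h e _ (r 2 0 two_pos le_rfl), h e _ (r 1 0 one_pos le_rfl)]
    ring
  obtain ⟨β', hβ⟩ : ∃ L : (Fin N → ℝ) →L[ℝ] ℝ, ∀ e, L e = β e := by
    refine ⟨F.comp (Φ.genL (B.τ + 1, 0, u₁)) - (B.τ + 1) • α', fun e => ?_⟩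
    simp only [F, sub_apply, smul_apply, hα, ContinuousLinearMap.comp_apply,
      ContinuousLinearMap.coe_fst', hL e 1 0 one_pos le_rfl, h e _ (r 1 0 one_pos le_rfl),
      smul_eq_mul]
    ring
  obtain ⟨κ', hκ⟩ : ∃ L : (Fin N → ℝ) →L[ℝ] ℝ, ∀ e, L e = κ e := by
    refine ⟨(1 / 2 : ℝ) • (S.comp (Φ.genL (B.τ + 1, 2, u₁)) -
      (2 : ℝ) • S.comp (Φ.genL (B.τ + 1, 1, u₁))), fun e => ?_⟩
    simp only [S, sub_apply, smul_apply, ContinuousLinearMap.comp_apply,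
      ContinuousLinearMap.coe_fst', ContinuousLinearMap.coe_snd', hL e 1 2 one_pos two_pos.le,
      hL e 1 1 one_pos one_pos.le,
      h e _ (r 1 2 one_pos two_pos.le), h e _ (r 1 1 one_pos one_pos.le), smul_eq_mul]
    ring
  obtain ⟨γ', hγ⟩ : ∃ L : (Fin N → ℝ) →L[ℝ] ℝ, ∀ e, L e = γ e := by
    refine ⟨S.comp (Φ.genL (B.τ + 1, 1, u₁)) - κ', fun e => ?_⟩
    simp only [S, sub_apply, hκ, ContinuousLinearMap.comp_apply,
      ContinuousLinearMap.coe_fst', ContinuousLinearMap.coe_snd',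
      hL e 1 1 one_pos one_pos.le, h e _ (r 1 1 one_pos one_pos.le)]
    ring
  refine ⟨α', β', γ', κ', a₀, b₀, fun e z hz => ?_, hP.imp id fun hP e => ?_⟩
  · rw [hα, hβ, hγ, hκ]
    exact h e z hz
  · rw [hα, hγ, hκ]
    exact hP _ _ _ (hPe e)

/-! ### Integration along rays in the parameter space -/

/-- The derivative of right translation by the inverse. -/
noncomputable def PointGroup.rightLog (Φ : PointGroup N) (ε : Fin N → ℝ) :
    (Fin N → ℝ) →L[ℝ] (Fin N → ℝ) :=
  fderiv ℝ (fun δ => Φ.mul δ (Φ.inv ε)) ε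

namespace PointGroup

theorem contDiffAt_mul {a b : Fin N → ℝ} (ha : a ∈ Φ.V) (hb : b ∈ Φ.V) :
    ContDiffAt ℝ ∞ (fun p : (Fin N → ℝ) × (Fin N → ℝ) => Φ.mul p.1 p.2) (a, b) :=
  Φ.mul_smooth.contDiffAt ((Φ.isOpen_V.prod Φ.isOpen_V).mem_nhds ⟨ha, hb⟩)

theorem hasFDerivAt_mul_inv (hε : ε ∈ Φ.V₀) :
    HasFDerivAt (fun δ => Φ.mul δ (Φ.inv ε)) (Φ.rightLog ε) ε := by
  have : DifferentiableAt ℝ (fun δ => Φ.mul δ (Φ.inv ε)) ε :=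
    DifferentiableAt.comp (g := fun p : (Fin N → ℝ) × (Fin N → ℝ) => Φ.mul p.1 p.2)
      (f := fun δ => (δ, Φ.inv ε)) ε
      (diffAt (Φ.contDiffAt_mul (Φ.V₀_subset hε) (Φ.inv_mem _ hε))) (by fun_prop)
  exact this.hasFDerivAt

/-- By continuity of the derivative of the multiplication at the identity. The bound supplies the
constant in Grönwall's inequality along rays. -/
theorem exists_bound_rightLog : ∃ K : ℝ, ∀ᶠ ε in 𝓝 (0 : Fin N → ℝ), ‖Φ.rightLog ε‖ ≤ K := by
  set m := fun p : (Fin N → ℝ) × (Fin N → ℝ) => Φ.mul p.1 p.2 with hm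
  have h0 : ContinuousAt (fderiv ℝ m) (0, 0) :=
    ((Φ.contDiffAt_mul Φ.zero_mem_V Φ.zero_mem_V).fderiv_right (m := ∞) le_rfl).continuousAt
  have h1 : Tendsto (fun ε => (ε, Φ.inv ε)) (𝓝 (0 : Fin N → ℝ)) (𝓝 (0, 0)) := by
    have := Φ.continuousAt_inv Φ.zero_mem
    rw [ContinuousAt, Φ.inv_zero] at this
    exact (tendsto_id).prodMk_nhds this
  have h2 : Tendsto (fun ε => ‖(fderiv ℝ m (ε, Φ.inv ε)).comp
      (ContinuousLinearMap.inl ℝ (Fin N → ℝ) (Fin N → ℝ))‖) (𝓝 (0 : Fin N → ℝ))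
      (𝓝 ‖(fderiv ℝ m (0, 0)).comp (ContinuousLinearMap.inl ℝ (Fin N → ℝ) (Fin N → ℝ))‖) := by
    have hc : Continuous fun L : ((Fin N → ℝ) × (Fin N → ℝ)) →L[ℝ] (Fin N → ℝ) =>
        ‖L.comp (ContinuousLinearMap.inl ℝ (Fin N → ℝ) (Fin N → ℝ))‖ := by fun_prop
    exact (hc.tendsto _).comp (h0.tendsto.comp h1)
  refine ⟨‖(fderiv ℝ m (0, 0)).comp
    (ContinuousLinearMap.inl ℝ (Fin N → ℝ) (Fin N → ℝ))‖ + 1, ?_⟩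
  filter_upwards [h2.eventually_lt_const (lt_add_one _), Φ.eventually_mem] with ε h3 h4
  have : Φ.rightLog ε = (fderiv ℝ m (ε, Φ.inv ε)).comp
      (ContinuousLinearMap.inl ℝ (Fin N → ℝ) (Fin N → ℝ)) := by
    have d1 : HasFDerivAt (fun δ : Fin N → ℝ => (δ, Φ.inv ε))
        (ContinuousLinearMap.inl ℝ (Fin N → ℝ) (Fin N → ℝ)) ε := by
      exact (hasFDerivAt_id ε).prodMk (hasFDerivAt_const _ ε)
    have d2 := (diffAt (Φ.contDiffAt_mul (Φ.V₀_subset h4.1) (Φ.inv_mem _ h4.1))).hasFDerivAt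
    exact (d2.comp (f := fun δ : Fin N → ℝ => (δ, Φ.inv ε)) ε d1).fderiv
  rw [this]
  exact h3.le

/-- Lie's equation. -/
theorem hasFDerivAt_act (hε : ε ∈ Φ.V₀) {z : ℝ × ℝ × ℝ} (h : (ε, z) ∈ Φ.dom) :
    HasFDerivAt (fun δ => Φ.act δ z) ((Φ.genL (Φ.act ε z)).comp (Φ.rightLog ε)) ε := by
  have hM := Φ.act_mem ε z h
  have hm := hasFDerivAt_mul_inv (Φ := Φ) hε
  have h0 : Φ.mul ε (Φ.inv ε) = 0 := Φ.mul_inv ε hε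
  have d2 : HasFDerivAt (fun δ => Φ.act δ (Φ.act ε z)) (Φ.genL (Φ.act ε z))
      (Φ.mul ε (Φ.inv ε)) := by
    rw [h0]
    have d1 : HasFDerivAt (fun δ : Fin N → ℝ => (δ, Φ.act ε z))
        (ContinuousLinearMap.inl ℝ (Fin N → ℝ) (ℝ × ℝ × ℝ)) 0 :=
      (hasFDerivAt_id _).prodMk (hasFDerivAt_const _ _)
    exact ((diffAt (Φ.contDiffAt_act (Φ.zero_mem_dom _ hM))).hasFDerivAt).comp
      (f := fun δ : Fin N → ℝ => (δ, Φ.act ε z)) 0 d1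
  have d3 := d2.comp (f := fun δ => Φ.mul δ (Φ.inv ε)) ε hm
  refine d3.congr_of_eventuallyEq ?_
  have c1 : Tendsto (fun δ => Φ.mul δ (Φ.inv ε)) (𝓝 ε) (𝓝 0) := by
    have := hm.continuousAt
    rwa [ContinuousAt, h0] at this
  have c2 : Tendsto (fun δ => (Φ.mul δ (Φ.inv ε), Φ.act ε z)) (𝓝 ε) (𝓝 (0, Φ.act ε z)) :=
    c1.prodMk_nhds tendsto_const_nhds
  have c3 : Tendsto (fun δ : Fin N → ℝ => (δ, z)) (𝓝 ε) (𝓝 (ε, z)) :=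
    Continuous.tendsto (by fun_prop) ε
  filter_upwards [c1.eventually (Φ.isOpen_V.mem_nhds Φ.zero_mem_V),
    c2.eventually (Φ.eventually_dom (Φ.zero_mem_dom _ hM)), c3.eventually (Φ.eventually_dom h),
    Φ.isOpen_V.mem_nhds (Φ.V₀_subset hε)] with δ h1 h2 h3 h4
  -- Near ε one writes δ = (δε⁻¹)ε. Acting with δ on z is then acting with δε⁻¹, which passes
  -- through the identity at δ = ε, on the image of z.
  have e : Φ.mul (Φ.mul δ (Φ.inv ε)) ε = δ := by
    rw [← Φ.mul_assoc δ h4 (Φ.inv ε) (Φ.inv_mem _ hε) ε (Φ.V₀_subset hε) h1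
      (by rw [Φ.inv_mul _ hε]; exact Φ.zero_mem_V), Φ.inv_mul _ hε, Φ.mul_zero _ h4]
  have := Φ.act_mul (Φ.mul δ (Φ.inv ε)) ε z h h2 (by rw [e]; exact h3)
  rw [e] at this
  exact this.symm

end PointGroup

/-- Grönwall's inequality, from |D'| ≤ C|D| and D(0) = 0. -/
theorem eq_zero_of_linear_ode {D c : ℝ → ℝ} {C : ℝ}
    (hD : ∀ s ∈ Icc (0 : ℝ) 1, HasDerivAt D (c s * D s) s)
    (hc : ∀ s ∈ Icc (0 : ℝ) 1, |c s| ≤ C) (h0 : D 0 = 0) : D 1 = 0 := by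
  refine eq_zero_of_abs_deriv_le_mul_abs_self_of_eq_zero_right (K := C) (a := 0) (b := 1)
    (f' := fun s => c s * D s)
    (fun s hs => (hD s hs).continuousAt.continuousWithinAt)
    (fun s hs => (hD s (Ico_subset_Icc_self hs)).hasDerivWithinAt) h0 (fun s hs => ?_) 1
    (right_mem_Icc.2 zero_le_one)
  rw [Real.norm_eq_abs, Real.norm_eq_abs, abs_mul]
  exact mul_le_mul_of_nonneg_right (hc s (Ico_subset_Icc_self hs)) (abs_nonneg _)

theorem IsInvariant.act_mem_region (hB : IsInvariant B Φ) {z : ℝ × ℝ × ℝ} (hz : z ∈ B.region)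
    (h : (ε, z) ∈ Φ.dom) : Φ.act ε z ∈ B.region := by
  obtain ⟨t, x, u⟩ := z
  have h1 := hB.subset_strip _ (Φ.act_mem _ _ h)
  refine ⟨h1.1, ?_, h1.2⟩
  rcases (show (0 : ℝ) ≤ x from hz.2.1).lt_or_eq with hx | hx
  · exact (hB.domain _ _ _ _ h hx).le
  · subst hx
    exact (hB.boundary _ _ _ h).ge

/-- A function of the point that satisfies a linear equation along the group depends
affinely on its initial value. -/
theorem PointGroup.ray_affine {S : Set (ℝ × ℝ × ℝ)} {g : ℝ × ℝ × ℝ → ℝ}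
    {c b : (Fin N → ℝ) →L[ℝ] ℝ} (hS : S ⊆ Φ.M)
    (hSε : ∀ ε z, z ∈ S → (ε, z) ∈ Φ.dom → Φ.act ε z ∈ S)
    (hg : ∀ z ∈ S, DifferentiableAt ℝ g z)
    (hgen : ∀ e, ∀ z ∈ S, fderiv ℝ g z (Φ.gen e z) = c e * g z + b e)
    {K : ℝ} {z₁ z₂ z₃ : ℝ × ℝ × ℝ} (h₁ : z₁ ∈ S) (h₂ : z₂ ∈ S) (h₃ : z₃ ∈ S)
    (hε : ∀ s ∈ Icc (0 : ℝ) 1, s • ε ∈ Φ.V₀ ∧ ‖Φ.rightLog (s • ε)‖ ≤ K ∧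
      (s • ε, z₁) ∈ Φ.dom ∧ (s • ε, z₂) ∈ Φ.dom ∧ (s • ε, z₃) ∈ Φ.dom)
    {p q r : ℝ} (hpqr : ∀ e, (p + q + r) * b e = 0) (h0 : p * g z₁ + q * g z₂ + r * g z₃ = 0) :
    p * g (Φ.act ε z₁) + q * g (Φ.act ε z₂) + r * g (Φ.act ε z₃) = 0 := by
  have key {z : ℝ × ℝ × ℝ} (hz : z ∈ S) {s : ℝ} (hs : s • ε ∈ Φ.V₀) (hd : (s • ε, z) ∈ Φ.dom) :
      HasDerivAt (fun s : ℝ => g (Φ.act (s • ε) z))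
        (c (Φ.rightLog (s • ε) ε) * g (Φ.act (s • ε) z) + b (Φ.rightLog (s • ε) ε)) s := by
    have hz' := hSε _ _ hz hd
    have d1 : HasDerivAt (fun s : ℝ => s • ε) ε s := by
      simpa using (hasDerivAt_id s).smul_const ε
    have d2 := (PointGroup.hasFDerivAt_act hs hd).comp_hasDerivAt s d1
    have d3 := (hg _ hz').hasFDerivAt.comp_hasDerivAt (f := fun s : ℝ => Φ.act (s • ε) z) s d2
    rw [← hgen _ _ hz', ← PointGroup.genL_apply _ (hS hz')]
    exact d3
  -- The weighted sum of the three values satisfies a homogeneous equation, because the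
  -- inhomogeneous term appears with the factor (p + q + r)b = 0: either the weights sum to zero or
  -- b = 0.
  have h1 := eq_zero_of_linear_ode (D := fun s => p * g (Φ.act (s • ε) z₁)
      + q * g (Φ.act (s • ε) z₂) + r * g (Φ.act (s • ε) z₃))
    (c := fun s => c (Φ.rightLog (s • ε) ε)) (C := ‖c‖ * (K * ‖ε‖)) (fun s hs => ?_)
    (fun s hs => ?_) ?_
  · simpa using h1
  · obtain ⟨a1, -, a3, a4, a5⟩ := hε s hs
    refine ((((key h₁ a1 a3).const_mul p).fun_add ((key h₂ a1 a4).const_mul q)).fun_add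
      ((key h₃ a1 a5).const_mul r)).congr_deriv ?_
    linear_combination hpqr (Φ.rightLog (s • ε) ε)
  · obtain ⟨-, a2, -⟩ := hε s hs
    calc |c (Φ.rightLog (s • ε) ε)| ≤ ‖c‖ * ‖Φ.rightLog (s • ε) ε‖ := c.le_opNorm _
      _ ≤ ‖c‖ * (K * ‖ε‖) := by
        gcongr
        exact (Φ.rightLog (s • ε)).le_of_opNorm_le a2 ε
  · simpa only [zero_smul, Φ.act_zero _ (hS h₁), Φ.act_zero _ (hS h₂), Φ.act_zero _ (hS h₃)]
      using h0

end HeatBVP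

/-! ### The conditions at infinity -/

namespace HeatBVP

variable {N : ℕ} {B : Problem} {Φ : PointGroup N} {ε : Fin N → ℝ} {t x u : ℝ}

theorem PointGroup.hasDerivAt_act_zero (e : Fin N → ℝ) {z : ℝ × ℝ × ℝ} (hz : z ∈ Φ.M) :
    HasDerivAt (fun s : ℝ => Φ.act (s • e) z) (Φ.gen e z) 0 := by
  have h1 : HasDerivAt (fun s : ℝ => (s • e, z)) ((e, 0) : (Fin N → ℝ) × (ℝ × ℝ × ℝ)) 0 := by
    have := ((hasDerivAt_id (0 : ℝ)).smul_const e).prodMk (hasDerivAt_const (0 : ℝ) z)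
    simpa using this
  rw [PointGroup.gen_eq_fderiv e hz]
  exact (diffAt (Φ.contDiffAt_act (Φ.zero_mem_dom z hz))).hasFDerivAt.comp_hasDerivAt_of_eq
    (0 : ℝ) h1 (by simp)

theorem PointGroup.hasDerivAt_comp_act_zero (e : Fin N → ℝ) {z : ℝ × ℝ × ℝ} (hz : z ∈ Φ.M)
    {g : ℝ × ℝ × ℝ → ℝ} (hg : DifferentiableAt ℝ g z) :
    HasDerivAt (fun s : ℝ => g (Φ.act (s • e) z)) (fderiv ℝ g z (Φ.gen e z)) 0 :=
  hg.hasFDerivAt.comp_hasDerivAt_of_eq (0 : ℝ) (PointGroup.hasDerivAt_act_zero e hz)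
    (by simp [Φ.act_zero z hz])

/-- Balls about 0 are star-shaped, so a local property holds along the whole segment from the
identity. -/
theorem eventually_ray {E Z : Type*} [NormedAddCommGroup E] [NormedSpace ℝ E]
    [PseudoMetricSpace Z] {P : E × Z → Prop} {z : Z} (h : ∀ᶠ p in 𝓝 ((0 : E), z), P p) :
    ∀ᶠ p in 𝓝 ((0 : E), z), ∀ s ∈ Icc (0 : ℝ) 1, P (s • p.1, p.2) := by
  obtain ⟨r, hr, hP⟩ := Metric.eventually_nhds_iff_ball.1 h
  filter_upwards [Metric.ball_mem_nhds _ hr] with p hp s hs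
  refine hP _ ?_
  rw [Metric.mem_ball, Prod.dist_eq, max_lt_iff, dist_zero_right] at hp ⊢
  refine ⟨?_, hp.2⟩
  calc ‖s • p.1‖ = |s| * ‖p.1‖ := norm_smul _ _
    _ ≤ 1 * ‖p.1‖ := by
      gcongr
      rw [abs_of_nonneg hs.1]; exact hs.2
    _ < r := by simpa using hp.1

/-- A quantity which satisfies a linear equation along the group and whose limit at infinity is
fixed by the group is stationary at infinity. -/
theorem IsInvariant.stationary_at_infinity (hB : IsInvariant B Φ) {S : Set (ℝ × ℝ × ℝ)}
    {g : ℝ × ℝ × ℝ → ℝ} {c b : (Fin N → ℝ) →L[ℝ] ℝ} (hS : S ⊆ Φ.M)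
    (hSε : ∀ ε z, z ∈ S → (ε, z) ∈ Φ.dom → Φ.act ε z ∈ S)
    (hg : ∀ z ∈ S, DifferentiableAt ℝ g z)
    (hgen : ∀ e, ∀ z ∈ S, fderiv ℝ g z (Φ.gen e z) = c e * g z + b e)
    (hS' : ∀ x u, 0 < x → u ∈ B.I → (B.τ + 1, x, u) ∈ S)
    (hinj : ∀ x x' u u', 0 < x → 0 < x' → x ≠ x' → u ≠ u' →
      g (B.τ + 1, x, u) ≠ g (B.τ + 1, x', u')) {l : ℝ}
    (hl : Tendsto (fun p : ℝ × ℝ => g (B.τ + 1, p.1, p.2)) (atTop ×ˢ 𝓝[B.I] B.uInf) (𝓝 l))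
    (hlim : ∀ᶠ ε in 𝓝 (0 : Fin N → ℝ), Tendsto (fun p : ℝ × ℝ => g (Φ.act ε (B.τ + 1, p.1, p.2)))
      (atTop ×ˢ 𝓝[B.I] B.uInf) (𝓝 l)) (e : Fin N → ℝ) : c e * l + b e = 0 := by
  have : (𝓝[B.I] B.uInf).NeBot := mem_closure_iff_nhdsWithin_neBot.1 B.uInf_mem
  have htt : B.τ < B.τ + 1 := by linarith
  obtain ⟨K, hK⟩ := Φ.exists_bound_rightLog
  obtain ⟨pa, hpa, pb, hpb, hdom⟩ := eventually_prod_iff.1 (hB.near_infinity (B.τ + 1) htt)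
  obtain ⟨px, hpx, pu, hpu, hpxu⟩ := eventually_prod_iff.1 hpb
  obtain ⟨x₀, hx₀⟩ := eventually_atTop.1 hpx
  obtain ⟨O, hO, hO', hOI⟩ := mem_nhdsWithin.1 hpu
  obtain ⟨u₂, hu₂O, hu₂I⟩ := mem_closure_iff.1 B.uInf_mem O hO hO'
  -- The reference points differ in both x and `u`, so that g separates them whether it depends on x
  -- alone or on `u` alone. Both lie where the group acts near infinity.
  obtain ⟨u₃, ⟨hu₃O, hu₃I⟩, hu₃⟩ : ∃ u₃ ∈ O ∩ B.I, u₃ ≠ u₂ := by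
    have h1 : O ∩ B.I ∈ 𝓝[≠] u₂ :=
      nhdsWithin_le_nhds ((hO.inter B.isOpen_I).mem_nhds ⟨hu₂O, hu₂I⟩)
    obtain ⟨v, hv⟩ := (inter_mem h1 (self_mem_nhdsWithin (a := u₂) (s := {u₂}ᶜ))) |>
      (Filter.NeBot.nonempty_of_mem inferInstance)
    exact ⟨v, hv.1, hv.2⟩
  set x₂ := max x₀ 0 + 1 with hx₂
  set x₃ := max x₀ 0 + 2 with hx₃
  have p₂ : 0 < x₂ := by positivity
  have p₃ : 0 < x₃ := by positivity
  have q₂ : x₀ ≤ x₂ := by have := le_max_left x₀ 0; linarith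
  have q₃ : x₀ ≤ x₃ := by have := le_max_left x₀ 0; linarith
  have x₂₃ : x₂ ≠ x₃ := by rw [hx₂, hx₃]; intro h; linarith
  set z₂ : ℝ × ℝ × ℝ := (B.τ + 1, x₂, u₂) with hz₂
  set z₃ : ℝ × ℝ × ℝ := (B.τ + 1, x₃, u₃) with hz₃
  have m₂ : z₂ ∈ S := hS' _ _ p₂ hu₂I
  have m₃ : z₃ ∈ S := hS' _ _ p₃ hu₃I
  have hne : g z₂ ≠ g z₃ := hinj _ _ _ _ p₂ p₃ x₂₃ hu₃.symm
  have ev : ∀ᶠ ε in 𝓝 (0 : Fin N → ℝ), ∀ s ∈ Icc (0 : ℝ) 1,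
      s • ε ∈ Φ.V₀ ∧ ‖Φ.rightLog (s • ε)‖ ≤ K ∧ pa (s • ε) := by
    have h1 : ∀ᶠ p in 𝓝 ((0 : Fin N → ℝ), (0 : ℝ)),
        p.1 ∈ Φ.V₀ ∧ ‖Φ.rightLog p.1‖ ≤ K ∧ pa p.1 := by
      have c : Tendsto (fun p : (Fin N → ℝ) × ℝ => p.1) (𝓝 (0, 0)) (𝓝 0) :=
        continuous_fst.tendsto _
      filter_upwards [c.eventually Φ.eventually_mem, c.eventually hK, c.eventually hpa]
        with p h1 h2 h3 using ⟨h1.1, h2, h3⟩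
    have h2 := eventually_ray h1
    have c : Tendsto (fun ε : Fin N → ℝ => (ε, (0 : ℝ))) (𝓝 0) (𝓝 (0, 0)) :=
      Continuous.tendsto (by fun_prop) _
    exact c.eventually h2
  -- For a third point z, the weights g(z₃) - g(z₂), g(z) - g(z₃), g(z₂) - g(z) sum to zero and
  -- annihilate the initial values, hence also the transported ones. As z tends to infinity, g(z)
  -- and its transported value both tend to l.
  have rel : ∀ᶠ ε in 𝓝 (0 : Fin N → ℝ),
      (g z₃ - g z₂) * l + (l - g z₃) * g (Φ.act ε z₂) + (g z₂ - l) * g (Φ.act ε z₃) = 0 := by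
    filter_upwards [ev, hlim] with ε h1 h2
    have h3 : ∀ᶠ p : ℝ × ℝ in atTop ×ˢ 𝓝[B.I] B.uInf,
        (g z₃ - g z₂) * g (Φ.act ε (B.τ + 1, p.1, p.2))
          + (g (B.τ + 1, p.1, p.2) - g z₃) * g (Φ.act ε z₂)
          + (g z₂ - g (B.τ + 1, p.1, p.2)) * g (Φ.act ε z₃) = 0 := by
      have c1 : ∀ᶠ x : ℝ in atTop, x₀ ≤ x ∧ 0 < x :=
        (eventually_ge_atTop x₀).and (eventually_gt_atTop 0)
      have c2 : ∀ᶠ u in 𝓝[B.I] B.uInf, pu u ∧ u ∈ B.I := hpu.and self_mem_nhdsWithin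
      filter_upwards [c1.prod_mk c2] with p hp
      obtain ⟨⟨hp1, hp2⟩, hp3, hp4⟩ := hp
      refine PointGroup.ray_affine hS hSε hg hgen (hS' _ _ hp2 hp4) m₂ m₃ (K := K)
        (fun s hs => ?_) (fun e => ?_) ?_
      · obtain ⟨a1, a2, a3⟩ := h1 s hs
        exact ⟨a1, a2, hdom a3 (hpxu (hx₀ _ hp1) hp3),
          hdom (y := (x₂, u₂)) a3 (hpxu (hx₀ _ q₂) (hOI ⟨hu₂O, hu₂I⟩)),
          hdom (y := (x₃, u₃)) a3 (hpxu (hx₀ _ q₃) (hOI ⟨hu₃O, hu₃I⟩))⟩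
      · ring
      · ring
    have h4 : Tendsto (fun p : ℝ × ℝ => (g z₃ - g z₂) * g (Φ.act ε (B.τ + 1, p.1, p.2))
          + (g (B.τ + 1, p.1, p.2) - g z₃) * g (Φ.act ε z₂)
          + (g z₂ - g (B.τ + 1, p.1, p.2)) * g (Φ.act ε z₃)) (atTop ×ˢ 𝓝[B.I] B.uInf)
        (𝓝 ((g z₃ - g z₂) * l + (l - g z₃) * g (Φ.act ε z₂) + (g z₂ - l) * g (Φ.act ε z₃))) :=
      ((h2.const_mul _).add ((hl.sub_const _).mul_const _)).add ((hl.const_sub _).mul_const _)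
    exact tendsto_nhds_unique (h4.congr' h3) tendsto_const_nhds
  have cs : Tendsto (fun s : ℝ => s • e) (𝓝 0) (𝓝 0) := by
    have : Continuous (fun s : ℝ => s • e) := by fun_prop
    simpa using this.tendsto (0 : ℝ)
  have d := (((PointGroup.hasDerivAt_comp_act_zero e (hS m₂) (hg _ m₂)).const_mul
    (l - g z₃)).const_add ((g z₃ - g z₂) * l)).fun_add
    ((PointGroup.hasDerivAt_comp_act_zero e (hS m₃) (hg _ m₃)).const_mul (g z₂ - l))
  rw [hgen e _ m₂, hgen e _ m₃] at d
  have d0 := d.unique ((hasDerivAt_const (0 : ℝ) (0 : ℝ)).congr_of_eventuallyEq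
    (cs.eventually rel))
  -- The derivative of the relation at the identity is (l - g(z₃))(c g(z₂) + b) + (g(z₂) - l)(c
  -- g(z₃) + b), which factors in this way.
  have : (g z₂ - g z₃) * (c e * l + b e) = 0 := by linarith
  exact (mul_eq_zero.1 this).resolve_left (sub_ne_zero.2 hne)

/-- The infinitesimal transformations of a group of invariance: the conditions at infinity
exclude projective transformations of `x` and shifts of `u`. -/
theorem IsInvariant.gen_affine (hB : IsInvariant B Φ) :
    ∃ α β γ a : (Fin N → ℝ) →L[ℝ] ℝ,
      (∀ e, ∀ z ∈ B.region,
        Φ.gen e z = (α e * z.1 + β e, γ e * z.2.1, a e * (z.2.2 - B.uInf))) ∧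
      ∀ e, ∀ u ∈ B.I, a e * (u - B.uInf) * deriv B.d u = (2 * γ e - α e) * B.d u := by
  obtain ⟨α, β, γ, κ, a₀, b₀, hgen, hcase⟩ := hB.gen_form
  have htt : B.τ < B.τ + 1 := by linarith
  -- For ξ = γx + κx² the quantity 1/x changes at the rate -γ(1/x) - κ. Its limit 0 at infinity is
  -- preserved, so κ = 0.
  have hκ : ∀ e, κ e = 0 := by
    intro e
    have := hB.stationary_at_infinity (S := B.region ∩ {z | 0 < z.2.1}) (g := fun z => z.2.1⁻¹)
      (c := -γ) (b := -κ) (l := 0) (fun z hz => hB.region_subset hz.1) ?_ ?_ ?_ ?_ ?_ ?_ ?_ e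
    · simpa using this
    · rintro ε ⟨t, x, u⟩ hz h
      exact ⟨hB.act_mem_region hz.1 h, hB.domain _ _ _ _ h hz.2⟩
    · rintro z hz
      have : z.2.1 ≠ 0 := ne_of_gt hz.2
      fun_prop (disch := assumption)
    · intro e z hz
      have h0 : z.2.1 ≠ 0 := ne_of_gt hz.2
      have h1 : HasFDerivAt (fun z : ℝ × ℝ × ℝ => z.2.1)
          ((ContinuousLinearMap.fst ℝ ℝ ℝ).comp (ContinuousLinearMap.snd ℝ ℝ (ℝ × ℝ))) z :=
        ((ContinuousLinearMap.fst ℝ ℝ ℝ).comp (ContinuousLinearMap.snd ℝ ℝ (ℝ × ℝ))).hasFDerivAt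
      have h2 : HasFDerivAt (fun z : ℝ × ℝ × ℝ => z.2.1⁻¹) _ z :=
        (hasDerivAt_inv h0).comp_hasFDerivAt z h1
      rw [h2.fderiv, hgen e z hz.1]
      simp
      field_simp
      ring
    · exact fun x u hx hu => ⟨⟨htt, hx.le, hu⟩, hx⟩
    · intro x x' u u' _ _ h _
      simpa using h
    · exact (tendsto_inv_atTop_zero).comp tendsto_fst
    · filter_upwards [hB.at_infinity _ htt] with ε h
      exact tendsto_inv_atTop_zero.comp h.1
  -- With κ = 0 the temperature itself obeys a linear equation, and preservation of its limit u_∞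
  -- makes η vanish there.
  have hu : ∀ e, (2 * γ e - α e) * (a₀ * B.uInf + b₀) = 0 := by
    intro e
    have := hB.stationary_at_infinity (S := B.region) (g := fun z => z.2.2)
      (c := a₀ • ((2 : ℝ) • γ - α)) (b := b₀ • ((2 : ℝ) • γ - α)) (l := B.uInf) hB.region_subset
      (fun ε z hz h => hB.act_mem_region hz h) (fun z _ => by fun_prop) ?_ ?_ ?_ ?_ ?_ e
    · simp only [smul_apply, sub_apply, smul_eq_mul] at this
      linarith
    · intro e z hz
      have h1 : HasFDerivAt (fun z : ℝ × ℝ × ℝ => z.2.2)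
          ((ContinuousLinearMap.snd ℝ ℝ ℝ).comp (ContinuousLinearMap.snd ℝ ℝ (ℝ × ℝ))) z :=
        ((ContinuousLinearMap.snd ℝ ℝ ℝ).comp (ContinuousLinearMap.snd ℝ ℝ (ℝ × ℝ))).hasFDerivAt
      rw [h1.fderiv, hgen e z hz, hκ e]
      simp
      ring
    · exact fun x u hx hu => ⟨htt, hx.le, hu⟩
    · exact fun x x' u u' _ _ _ h => h
    · exact (tendsto_nhdsWithin_iff.1 tendsto_id).1.comp tendsto_snd
    · filter_upwards [hB.at_infinity _ htt] with ε h using h.2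
  -- Either ℓ vanishes at u_∞ and is a₀(u - u_∞), or every direction has 2γ = α and η = 0. An
  -- exponential conductivity, with constant ℓ ≠ 0, falls in the second case.
  by_cases h0 : (∀ u ∈ B.I, (a₀ * u + b₀) * deriv B.d u = B.d u) ∧ a₀ * B.uInf + b₀ = 0
  · refine ⟨α, β, γ, a₀ • ((2 : ℝ) • γ - α), fun e z hz => ?_, fun e u hu => ?_⟩
    · rw [hgen e z hz, hκ e]
      simp only [smul_apply, sub_apply, smul_eq_mul]
      refine Prod.ext rfl (Prod.ext (by simp) ?_)
      simp only
      linear_combination (2 * γ e - α e) * h0.2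
    · rw [← h0.1 u hu]
      simp only [smul_apply, sub_apply, smul_eq_mul]
      linear_combination -(2 * γ e - α e) * deriv B.d u * h0.2
  · have hA : ∀ e, 2 * γ e - α e = 0 := by
      intro e
      rcases hcase with hS | hN
      · exact (mul_eq_zero.1 (hu e)).resolve_right fun h => h0 ⟨hS, h⟩
      · rw [(hN e).1, sub_self]
    refine ⟨α, β, γ, 0, fun e z hz => ?_, fun e u hu => ?_⟩
    · rw [hgen e z hz, hκ e]
      refine Prod.ext rfl (Prod.ext (by simp) ?_)
      simp [hA e]
    · rw [hA e]; simp

end HeatBVP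

/-! ### From infinitesimal to finite transformations -/

namespace HeatBVP

/-- The vector field `(α t + β) ∂_t + γ x ∂_x + a (u - u_∞) ∂_u` is an infinitesimal symmetry
of the equation and of the boundary condition. -/
def IsSymmetry (B : Problem) (α β γ a : ℝ) : Prop :=
  (∀ u ∈ B.I, a * (u - B.uInf) * deriv B.d u = (2 * γ - α) * B.d u) ∧
    ∀ t, B.τ < t → (α * t + β) * deriv B.q t = (a + γ - α) * B.q t

/-- A local group whose transformations near the identity have the form
`t* = E t + F`, `x* = G x`, `u* = u_∞ + H (u - u_∞)`. -/
structure AffineForm (B : Problem) {N : ℕ} (Φ : PointGroup N) where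
  (α β γ a : (Fin N → ℝ) →L[ℝ] ℝ)
  (E F G H : (Fin N → ℝ) → ℝ)
  E_smooth : ContDiffAt ℝ ∞ E 0
  F_smooth : ContDiffAt ℝ ∞ F 0
  G_smooth : ContDiffAt ℝ ∞ G 0
  H_smooth : ContDiffAt ℝ ∞ H 0
  E_zero : E 0 = 1
  F_zero : F 0 = 0
  G_zero : G 0 = 1
  H_zero : H 0 = 1
  act_eq : ∀ z ∈ B.region, ∀ᶠ p in 𝓝 ((0 : Fin N → ℝ), z), p.2 ∈ B.region →
    Φ.act p.1 p.2 = (E p.1 * p.2.1 + F p.1, G p.1 * p.2.2.1,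
      B.uInf + H p.1 * (p.2.2.2 - B.uInf))
  hasFDerivAt_E : ∀ᶠ ε in 𝓝 0, HasFDerivAt E (E ε • α.comp (Φ.rightLog ε)) ε
  hasFDerivAt_F : ∀ᶠ ε in 𝓝 0,
    HasFDerivAt F (F ε • α.comp (Φ.rightLog ε) + β.comp (Φ.rightLog ε)) ε
  hasFDerivAt_G : ∀ᶠ ε in 𝓝 0, HasFDerivAt G (G ε • γ.comp (Φ.rightLog ε)) ε
  hasFDerivAt_H : ∀ᶠ ε in 𝓝 0, HasFDerivAt H (H ε • a.comp (Φ.rightLog ε)) ε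
  balance : ∀ e, ∀ u ∈ B.I, a e * (u - B.uInf) * deriv B.d u = (2 * γ e - α e) * B.d u

variable {N : ℕ} {B : Problem} {Φ : PointGroup N} {ε : Fin N → ℝ} {t x u : ℝ}

theorem Problem.exists_ne_uInf (B : Problem) : ∃ u ∈ B.I, u ≠ B.uInf := by
  obtain ⟨v, hv⟩ := B.nonempty_I
  have h1 : B.I ∈ 𝓝[≠] v := nhdsWithin_le_nhds (B.isOpen_I.mem_nhds hv)
  by_cases h : v = B.uInf
  · obtain ⟨w, hw⟩ := (inter_mem h1 (self_mem_nhdsWithin (a := v) (s := {v}ᶜ))) |>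
      (Filter.NeBot.nonempty_of_mem inferInstance)
    exact ⟨w, hw.1, h ▸ hw.2⟩
  · exact ⟨v, hv, h⟩

/-- Every component of the generator is affine in its own variable, so the motion of any point is an
affine combination of the motions of reference points. Two reference times give E and F; a single
reference point gives G and another ratio H. Lie's equation at the reference points yields the
differentials of these coefficients. -/
theorem IsInvariant.affineForm (hB : IsInvariant B Φ) : Nonempty (AffineForm B Φ) := by
  obtain ⟨α, β, γ, a, hgen, hbal⟩ := hB.gen_affine
  obtain ⟨u₁, hu₁, hne⟩ := B.exists_ne_uInf
  set t₁ := B.τ + 1 with ht₁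
  set t₂ := B.τ + 2 with ht₂
  set z₁ : ℝ × ℝ × ℝ := (t₁, 1, u₁) with hz₁
  set z₂ : ℝ × ℝ × ℝ := (t₂, 1, u₁) with hz₂
  have r₁ : z₁ ∈ B.region := ⟨by simp [hz₁, ht₁], zero_le_one, hu₁⟩
  have r₂ : z₂ ∈ B.region := ⟨by simp [hz₂, ht₂], zero_le_one, hu₁⟩
  have d₁ := Φ.zero_mem_dom z₁ (hB.region_subset r₁)
  have d₂ := Φ.zero_mem_dom z₂ (hB.region_subset r₂)
  have s₁ := Φ.contDiffAt_act_left d₁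
  have s₂ := Φ.contDiffAt_act_left d₂
  have i₁ : Φ.act 0 z₁ = z₁ := Φ.act_zero z₁ (hB.region_subset r₁)
  have i₂ : Φ.act 0 z₂ = z₂ := Φ.act_zero z₂ (hB.region_subset r₂)
  have hne' : u₁ - B.uInf ≠ 0 := sub_ne_zero.2 hne
  obtain ⟨K, hK⟩ := Φ.exists_bound_rightLog
  have c₁ : Tendsto (fun ε : Fin N → ℝ => (ε, z₁)) (𝓝 0) (𝓝 (0, z₁)) :=
    Continuous.tendsto (by fun_prop) _
  have c₂ : Tendsto (fun ε : Fin N → ℝ => (ε, z₂)) (𝓝 0) (𝓝 (0, z₂)) :=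
    Continuous.tendsto (by fun_prop) _
  have ev : ∀ᶠ ε in 𝓝 (0 : Fin N → ℝ), ε ∈ Φ.V₀ ∧ ‖Φ.rightLog ε‖ ≤ K ∧
      (ε, z₁) ∈ Φ.dom ∧ (ε, z₂) ∈ Φ.dom := by
    filter_upwards [Φ.eventually_mem, hK, c₁.eventually (Φ.eventually_dom d₁),
      c₂.eventually (Φ.eventually_dom d₂)] with ε h1 h2 h3 h4 using ⟨h1.1, h2, h3, h4⟩
  have lie {z : ℝ × ℝ × ℝ} (hz : z ∈ B.region) {ε : Fin N → ℝ} (h1 : ε ∈ Φ.V₀)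
      (h2 : (ε, z) ∈ Φ.dom) :
      HasFDerivAt (fun δ => (Φ.act δ z).1)
        ((Φ.act ε z).1 • α.comp (Φ.rightLog ε) + β.comp (Φ.rightLog ε)) ε ∧
      HasFDerivAt (fun δ => (Φ.act δ z).2.1) ((Φ.act ε z).2.1 • γ.comp (Φ.rightLog ε)) ε ∧
      HasFDerivAt (fun δ => (Φ.act δ z).2.2)
        (((Φ.act ε z).2.2 - B.uInf) • a.comp (Φ.rightLog ε)) ε := by
    have h3 := PointGroup.hasFDerivAt_act h1 h2
    have h4 := hB.act_mem_region hz h2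
    have h5 (e : Fin N → ℝ) := (PointGroup.genL_apply e (hB.region_subset h4)).trans (hgen e _ h4)
    refine ⟨h3.fst.congr_fderiv ?_, h3.snd.fst.congr_fderiv ?_, h3.snd.snd.congr_fderiv ?_⟩ <;>
    · ext e
      simp [h5]
      try ring
  refine ⟨⟨α, β, γ, a, fun ε => (Φ.act ε z₂).1 - (Φ.act ε z₁).1,
    fun ε => (Φ.act ε z₁).1 - ((Φ.act ε z₂).1 - (Φ.act ε z₁).1) * t₁,
    fun ε => (Φ.act ε z₁).2.1, fun ε => ((Φ.act ε z₁).2.2 - B.uInf) / (u₁ - B.uInf),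
    s₂.fst.sub s₁.fst, s₁.fst.sub ((s₂.fst.sub s₁.fst).mul contDiffAt_const),
    s₁.snd.fst, (s₁.snd.snd.sub contDiffAt_const).div_const _, ?_, ?_, ?_, ?_, ?_, ?_, ?_, ?_, ?_,
    hbal⟩⟩
  · rw [i₁, i₂]; simp only [hz₁, hz₂, ht₁, ht₂]; ring
  · rw [i₁, i₂]; simp only [hz₁, hz₂, ht₁, ht₂]; ring
  · rw [i₁]
  · rw [i₁]; exact div_self hne'
  · intro z hz
    have e1 : ∀ᶠ p in 𝓝 ((0 : Fin N → ℝ), z), p.1 ∈ Φ.V₀ ∧ ‖Φ.rightLog p.1‖ ≤ K ∧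
        p ∈ Φ.dom ∧ (p.1, z₁) ∈ Φ.dom ∧ (p.1, z₂) ∈ Φ.dom := by
      have c : Tendsto (fun p : (Fin N → ℝ) × (ℝ × ℝ × ℝ) => p.1) (𝓝 (0, z)) (𝓝 0) :=
        continuous_fst.tendsto _
      filter_upwards [c.eventually ev,
        Φ.eventually_dom (Φ.zero_mem_dom z (hB.region_subset hz))] with p h1 h2
      exact ⟨h1.1, h1.2.1, h2, h1.2.2⟩
    filter_upwards [eventually_ray e1] with p hp hpr
    obtain ⟨ε, z'⟩ := p
    simp only at hp hpr ⊢
    have closed : ∀ ε z, z ∈ B.region → (ε, z) ∈ Φ.dom → Φ.act ε z ∈ B.region :=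
      fun ε z hz h => hB.act_mem_region hz h
    -- The weights express the time of z' affinely through t₁ and t₂ = t₁ + 1. They sum to zero
    -- because β need not vanish; in the x and u - u_∞ components there is no inhomogeneous term.
    have R₁ := PointGroup.ray_affine (Φ := Φ) (g := fun z => z.1) (c := α) (b := β)
      hB.region_subset closed (fun _ _ => by fun_prop) (fun e z hz => by
        have h1 : HasFDerivAt (fun z : ℝ × ℝ × ℝ => z.1) (ContinuousLinearMap.fst ℝ ℝ (ℝ × ℝ)) z :=
          (ContinuousLinearMap.fst ℝ ℝ (ℝ × ℝ)).hasFDerivAt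
        rw [h1.fderiv, hgen e z hz]; rfl) hpr r₁ r₂ hp (p := 1) (q := z'.1 - t₁ - 1)
        (r := -(z'.1 - t₁)) (fun e => by ring) (by simp only [hz₁, hz₂, ht₁, ht₂]; ring)
    have R₂ := PointGroup.ray_affine (Φ := Φ) (g := fun z => z.2.1) (c := γ) (b := 0)
      hB.region_subset closed (fun _ _ => by fun_prop) (fun e z hz => by
        have h1 : HasFDerivAt (fun z : ℝ × ℝ × ℝ => z.2.1)
          ((ContinuousLinearMap.fst ℝ ℝ ℝ).comp (ContinuousLinearMap.snd ℝ ℝ (ℝ × ℝ))) z :=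
          ((ContinuousLinearMap.fst ℝ ℝ ℝ).comp (ContinuousLinearMap.snd ℝ ℝ (ℝ × ℝ))).hasFDerivAt
        rw [h1.fderiv, hgen e z hz]; simp) hpr r₁ r₂ hp (p := 1) (q := -z'.2.1)
        (r := 0) (fun e => by simp) (by simp only [hz₁]; ring)
    have R₃ := PointGroup.ray_affine (Φ := Φ) (g := fun z => z.2.2 - B.uInf) (c := a) (b := 0)
      hB.region_subset closed (fun _ _ => by fun_prop) (fun e z hz => by
        have h1 : HasFDerivAt (fun z : ℝ × ℝ × ℝ => z.2.2 - B.uInf)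
          ((ContinuousLinearMap.snd ℝ ℝ ℝ).comp (ContinuousLinearMap.snd ℝ ℝ (ℝ × ℝ))) z :=
          ((ContinuousLinearMap.snd ℝ ℝ ℝ).comp
            (ContinuousLinearMap.snd ℝ ℝ (ℝ × ℝ))).hasFDerivAt.sub_const _
        rw [h1.fderiv, hgen e z hz]; simp) hpr r₁ r₂ hp (p := 1)
        (q := -((z'.2.2 - B.uInf) / (u₁ - B.uInf)))
        (r := 0) (fun e => by simp) (by simp only [hz₁]; field_simp; ring)
    refine Prod.ext ?_ (Prod.ext ?_ ?_)
    · simp only; linarith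
    · simp only; linarith
    · simp only at R₃ ⊢
      rw [← sub_eq_zero, ← R₃]
      ring
  · filter_upwards [ev] with ε h
    refine ((lie r₂ h.1 h.2.2.2).1.fun_sub (lie r₁ h.1 h.2.2.1).1).congr_fderiv ?_
    ext e; simp; ring
  · filter_upwards [ev] with ε h
    refine ((lie r₁ h.1 h.2.2.1).1.fun_sub
      (((lie r₂ h.1 h.2.2.2).1.fun_sub (lie r₁ h.1 h.2.2.1).1).mul_const t₁)).congr_fderiv ?_
    ext e; simp; ring
  · filter_upwards [ev] with ε h using (lie r₁ h.1 h.2.2.1).2.1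
  · filter_upwards [ev] with ε h
    have := ((lie r₁ h.1 h.2.2.1).2.2.sub_const B.uInf).mul_const (u₁ - B.uInf)⁻¹
    simp only [← div_eq_mul_inv] at this
    refine this.congr_fderiv ?_
    ext e; simp; ring

theorem PointGroup.rightLog_zero : Φ.rightLog 0 = ContinuousLinearMap.id ℝ _ := by
  have : (fun δ => Φ.mul δ (Φ.inv 0)) =ᶠ[𝓝 0] id := by
    filter_upwards [Φ.isOpen_V.mem_nhds Φ.zero_mem_V] with δ hδ
    rw [Φ.inv_zero, Φ.mul_zero δ hδ]; rfl
  rw [PointGroup.rightLog, this.fderiv_eq, fderiv_id]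

namespace AffineForm

theorem hasDerivAt_ray {f : (Fin N → ℝ) → ℝ} {f' : (Fin N → ℝ) →L[ℝ] ℝ} (h : HasFDerivAt f f' 0)
    (e : Fin N → ℝ) : HasDerivAt (fun s : ℝ => f (s • e)) (f' e) 0 := by
  have d1 : HasDerivAt (fun s : ℝ => s • e) e 0 := by
    simpa using (hasDerivAt_id (0 : ℝ)).smul_const e
  exact h.comp_hasDerivAt_of_eq (0 : ℝ) d1 (by simp)

theorem hasFDerivAt_E_zero (A : AffineForm B Φ) : HasFDerivAt A.E A.α 0 := by
  simpa [A.E_zero, PointGroup.rightLog_zero] using A.hasFDerivAt_E.self_of_nhds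

theorem hasFDerivAt_F_zero (A : AffineForm B Φ) : HasFDerivAt A.F A.β 0 := by
  simpa [A.F_zero, PointGroup.rightLog_zero] using A.hasFDerivAt_F.self_of_nhds

theorem hasFDerivAt_G_zero (A : AffineForm B Φ) : HasFDerivAt A.G A.γ 0 := by
  simpa [A.G_zero, PointGroup.rightLog_zero] using A.hasFDerivAt_G.self_of_nhds

theorem hasFDerivAt_H_zero (A : AffineForm B Φ) : HasFDerivAt A.H A.a 0 := by
  simpa [A.H_zero, PointGroup.rightLog_zero] using A.hasFDerivAt_H.self_of_nhds

/-- The condition of invariance of the boundary condition at a point. -/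
theorem flux_eq (A : AffineForm B Φ) (hB : IsInvariant B Φ) (ht : B.τ < t) (hu : u ∈ B.I) :
    ∀ᶠ ε in 𝓝 (0 : Fin N → ℝ), B.d (B.uInf + A.H ε * (u - B.uInf)) * (A.H ε * (B.q t / B.d u))
      = A.G ε * B.q (A.E ε * t + A.F ε) := by
  have hz : (t, (0 : ℝ), u) ∈ B.region := ⟨ht, le_rfl, hu⟩
  have hdom := Φ.zero_mem_dom _ (hB.region_subset hz)
  have h1 := A.act_eq _ hz
  rw [nhds_prod_eq] at h1
  have c : Tendsto (fun ε : Fin N → ℝ => (ε, (t, (0 : ℝ), u))) (𝓝 0) (𝓝 (0, (t, 0, u))) :=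
    Continuous.tendsto (by fun_prop) _
  filter_upwards [h1.curry, Φ.eventually_mem, c.eventually (Φ.eventually_dom hdom)]
    with ε h2 h3 h4
  -- The slope that makes the affine test function satisfy the flux condition at the boundary.
  set p := B.q t / B.d u with hp
  set f : ℝ × ℝ → ℝ := fun y => u + p * y.2 with hf
  have hfs : ContDiffAt ℝ ∞ f (t, 0) := by fun_prop
  have hfu : f (t, 0) = u := by simp [hf]
  have hflux : B.FluxAt f t 0 := by
    have : dx f t 0 = p := by
      have : HasDerivAt (fun y => f (t, y)) p 0 := by
        exact (((hasDerivAt_id (0 : ℝ)).const_mul p).const_add u).congr_deriv (by simp)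
      exact this.deriv
    rw [Problem.FluxAt, this, hfu, hp, mul_div_cancel₀ _ (B.d_pos u hu).ne']
  obtain ⟨f', s', g'⟩ := PointGroup.exists_carriesGraph h3.1 h4 hfs hfu
  have e' := hB.flux ε t u h4 f f' hfs hfu hflux s' g'
  have e0 := h2.self_of_nhds hz
  simp only [mul_zero] at e0
  rw [e0] at s' e'
  simp only at s' e'
  have cy : Tendsto (fun y : ℝ => (t, y)) (𝓝 0) (𝓝 (t, 0)) := Continuous.tendsto (by fun_prop) _
  have cf : Tendsto (fun y : ℝ => (t, y, f (t, y))) (𝓝 0) (𝓝 (t, 0, u)) := by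
    have : Continuous (fun y : ℝ => (t, y, f (t, y))) := by fun_prop
    simpa [hfu] using this.tendsto (0 : ℝ)
  -- The affine form of the action is known only on the region, hence for y ≥ 0. The derivatives are
  -- therefore compared from one side, which suffices.
  have near : (fun y => f' (A.E ε * t + A.F ε, A.G ε * y)) =ᶠ[𝓝[≥] 0]
      fun y => B.uInf + A.H ε * (u + p * y - B.uInf) := by
    have m1 := (cy.eventually g').filter_mono (nhdsWithin_le_nhds (s := Ici 0))
    have m2 := (cf.eventually h2).filter_mono (nhdsWithin_le_nhds (s := Ici 0))
    have m3 : ∀ᶠ y in 𝓝[≥] (0 : ℝ), f (t, y) ∈ B.I := by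
      refine Filter.Eventually.filter_mono (nhdsWithin_le_nhds (s := Ici 0)) ?_
      exact cf.snd_nhds.snd_nhds.eventually (B.isOpen_I.mem_nhds hu)
    filter_upwards [m1, m2, m3, self_mem_nhdsWithin] with y n1 n2 n3 n4
    have n5 := n2 ⟨ht, n4, n3⟩
    rw [n5] at n1
    exact n1
  have v0 : f' (A.E ε * t + A.F ε, 0) = B.uInf + A.H ε * (u - B.uInf) := by
    have := near.self_of_nhdsWithin (mem_Ici.2 le_rfl)
    simpa using this
  have D1 : HasDerivAt (fun y => f' (A.E ε * t + A.F ε, A.G ε * y))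
      (dx f' (A.E ε * t + A.F ε) 0 * A.G ε) 0 := by
    have d1 := hasDerivAt_dx (diffAt s')
    have d2 : HasDerivAt (fun y : ℝ => A.G ε * y) (A.G ε) 0 := by
      simpa using (hasDerivAt_id (0 : ℝ)).const_mul (A.G ε)
    exact HasDerivAt.comp_of_eq (h₂ := fun y => f' (A.E ε * t + A.F ε, y))
      (h := fun y => A.G ε * y) 0 d1 d2 (by simp)
  have D2 : HasDerivAt (fun y => B.uInf + A.H ε * (u + p * y - B.uInf)) (A.H ε * p) 0 := by
    have := (((((hasDerivAt_id (0 : ℝ)).const_mul p).const_add u).sub_const B.uInf).const_mul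
      (A.H ε)).const_add B.uInf
    simpa using this
  have key : dx f' (A.E ε * t + A.F ε) 0 * A.G ε = A.H ε * p :=
    (uniqueDiffWithinAt_Ici (0 : ℝ)).eq_deriv _ D1.hasDerivWithinAt
      (D2.hasDerivWithinAt.congr_of_eventuallyEq near (near.self_of_nhdsWithin (mem_Ici.2 le_rfl)))
  rw [Problem.FluxAt, v0] at e'
  rw [← key, ← e']
  ring

/-- The flux relation is differentiated at the identity; the term with d' is removed by the balance
a(u - u_∞)d' = (2γ - α)d, leaving an equation for q alone. -/
theorem isSymmetry (A : AffineForm B Φ) (hB : IsInvariant B Φ) (e : Fin N → ℝ) :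
    IsSymmetry B (A.α e) (A.β e) (A.γ e) (A.a e) := by
  refine ⟨A.balance e, fun t ht => ?_⟩
  obtain ⟨u, hu⟩ := B.nonempty_I
  have cs : Tendsto (fun s : ℝ => s • e) (𝓝 0) (𝓝 0) := by
    have : Continuous (fun s : ℝ => s • e) := by fun_prop
    simpa using this.tendsto (0 : ℝ)
  have dE := hasDerivAt_ray A.hasFDerivAt_E_zero e
  have dF := hasDerivAt_ray A.hasFDerivAt_F_zero e
  have dG := hasDerivAt_ray A.hasFDerivAt_G_zero e
  have dH := hasDerivAt_ray A.hasFDerivAt_H_zero e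
  have dU := (dH.mul_const (u - B.uInf)).const_add B.uInf
  have dT := (dE.mul_const t).fun_add dF
  have hq : HasDerivAt B.q (deriv B.q t) t :=
    (diffAt (B.q_smooth.contDiffAt (Ioi_mem_nhds ht))).hasDerivAt
  have dd : HasDerivAt (fun s : ℝ => B.d (B.uInf + A.H (s • e) * (u - B.uInf))) _ 0 :=
    HasDerivAt.comp_of_eq (h₂ := B.d) 0 (B.hasDerivAt_d hu) dU (by simp [A.H_zero])
  have dq : HasDerivAt (fun s : ℝ => B.q (A.E (s • e) * t + A.F (s • e))) _ 0 :=
    HasDerivAt.comp_of_eq (h₂ := B.q) 0 hq dT (by simp [A.E_zero, A.F_zero])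
  have L := dd.fun_mul (dH.mul_const (B.q t / B.d u))
  have R := dG.fun_mul dq
  have hfl : (fun s : ℝ => B.d (B.uInf + A.H (s • e) * (u - B.uInf)) *
      (A.H (s • e) * (B.q t / B.d u))) =ᶠ[𝓝 0]
      fun s => A.G (s • e) * B.q (A.E (s • e) * t + A.F (s • e)) :=
    cs.eventually (A.flux_eq hB ht hu)
  have key := (L.congr_of_eventuallyEq hfl.symm).unique R
  have hd := (B.d_pos u hu).ne'
  have hbal := A.balance e u hu
  simp only [zero_smul, A.E_zero, A.F_zero, A.G_zero, A.H_zero, one_mul, add_zero,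
    add_sub_cancel] at key
  field_simp at key
  refine mul_right_cancel₀ hd ?_
  linear_combination -key + B.q t * hbal

/-- The group law in terms of the coefficients. -/
theorem mul_eq (A : AffineForm B Φ) (hB : IsInvariant B Φ) :
    ∀ᶠ p in 𝓝 ((0 : Fin N → ℝ), (0 : Fin N → ℝ)),
      A.E (Φ.mul p.1 p.2) = A.E p.1 * A.E p.2 ∧
      A.F (Φ.mul p.1 p.2) = A.E p.1 * A.F p.2 + A.F p.1 ∧
      A.G (Φ.mul p.1 p.2) = A.G p.1 * A.G p.2 ∧
      A.H (Φ.mul p.1 p.2) = A.H p.1 * A.H p.2 := by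
  obtain ⟨u₁, hu₁, hne⟩ := B.exists_ne_uInf
  have key : ∀ t, B.τ < t → ∀ᶠ p in 𝓝 ((0 : Fin N → ℝ), (0 : Fin N → ℝ)),
      A.E (Φ.mul p.1 p.2) * t + A.F (Φ.mul p.1 p.2)
        = A.E p.1 * (A.E p.2 * t + A.F p.2) + A.F p.1 ∧
      A.G (Φ.mul p.1 p.2) = A.G p.1 * A.G p.2 ∧
      A.H (Φ.mul p.1 p.2) = A.H p.1 * A.H p.2 := by
    intro t ht
    set z : ℝ × ℝ × ℝ := (t, 1, u₁) with hz
    have hr : z ∈ B.region := ⟨ht, zero_le_one, hu₁⟩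
    have hdom := Φ.zero_mem_dom z (hB.region_subset hr)
    have hact : Tendsto (fun p : (Fin N → ℝ) × (Fin N → ℝ) => Φ.act p.2 z) (𝓝 (0, 0)) (𝓝 z) := by
      have h1 := (Φ.contDiffAt_act_left hdom).continuousAt
      rw [ContinuousAt, Φ.act_zero z (hB.region_subset hr)] at h1
      exact h1.comp (continuous_snd.tendsto _)
    have hmul : Tendsto (fun p : (Fin N → ℝ) × (Fin N → ℝ) => Φ.mul p.1 p.2) (𝓝 (0, 0)) (𝓝 0) := by
      have h1 := (Φ.contDiffAt_mul Φ.zero_mem_V Φ.zero_mem_V).continuousAt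
      rw [ContinuousAt] at h1
      simpa [Φ.zero_mul 0 Φ.zero_mem_V] using h1
    have c1 : Tendsto (fun p : (Fin N → ℝ) × (Fin N → ℝ) => (p.1, Φ.act p.2 z)) (𝓝 (0, 0))
        (𝓝 (0, z)) := (continuous_fst.tendsto _).prodMk_nhds hact
    have c2 : Tendsto (fun p : (Fin N → ℝ) × (Fin N → ℝ) => (Φ.mul p.1 p.2, z)) (𝓝 (0, 0))
        (𝓝 (0, z)) := hmul.prodMk_nhds tendsto_const_nhds
    have c3 : Tendsto (fun p : (Fin N → ℝ) × (Fin N → ℝ) => (p.2, z)) (𝓝 (0, 0))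
        (𝓝 (0, z)) := (continuous_snd.tendsto _).prodMk_nhds tendsto_const_nhds
    have f0 := A.act_eq z hr
    have g0 := Φ.eventually_dom hdom
    filter_upwards [c1.eventually f0, c2.eventually f0, c3.eventually f0, c1.eventually g0,
      c2.eventually g0, c3.eventually g0] with p f1 f2 f3 g1 g2 g3
    have m := hB.act_mem_region hr g3
    have e1 := f1 m
    have e2 := f2 hr
    have e3 := f3 hr
    rw [Φ.act_mul p.1 p.2 z g3 g1 g2, e2, e3] at e1
    simp only [hz, Prod.mk.injEq] at e1
    obtain ⟨k1, k2, k3⟩ := e1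
    refine ⟨k1, by linarith, ?_⟩
    refine mul_right_cancel₀ (sub_ne_zero.2 hne) ?_
    linarith
  filter_upwards [key (B.τ + 1) (by linarith), key (B.τ + 2) (by linarith)] with p h1 h2
  obtain ⟨a1, a2, a3⟩ := h1
  obtain ⟨b1, -, -⟩ := h2
  have hE : A.E (Φ.mul p.1 p.2) = A.E p.1 * A.E p.2 := by linarith
  refine ⟨hE, ?_, a2, a3⟩
  rw [hE] at a1
  linarith

theorem eventually_pos (A : AffineForm B Φ) :
    ∀ᶠ ε in 𝓝 (0 : Fin N → ℝ), 0 < A.E ε ∧ 0 < A.G ε ∧ 0 < A.H ε := by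
  have hE := A.E_smooth.continuousAt.eventually_const_lt (u := 0) (by rw [A.E_zero]; exact one_pos)
  have hG := A.G_smooth.continuousAt.eventually_const_lt (u := 0) (by rw [A.G_zero]; exact one_pos)
  have hH := A.H_smooth.continuousAt.eventually_const_lt (u := 0) (by rw [A.H_zero]; exact one_pos)
  filter_upwards [hE, hG, hH] with ε h1 h2 h3 using ⟨h1, h2, h3⟩

theorem eventually_eq_zero_of_fderiv {f : (Fin N → ℝ) → ℝ} (h0 : f 0 = 0)
    (h : ∀ᶠ ε in 𝓝 0, HasFDerivAt f (0 : (Fin N → ℝ) →L[ℝ] ℝ) ε) : ∀ᶠ ε in 𝓝 0, f ε = 0 := by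
  obtain ⟨r, hr, hb⟩ := Metric.eventually_nhds_iff_ball.1 h
  filter_upwards [Metric.ball_mem_nhds 0 hr] with ε hε
  rw [← h0]
  exact Metric.isOpen_ball.is_const_of_fderiv_eq_zero (convex_ball 0 r).isPreconnected
    (fun δ hδ => (hb δ hδ).differentiableAt.differentiableWithinAt)
    (fun δ hδ => (hb δ hδ).fderiv) hε (Metric.mem_ball_self hr)

/-- A linear relation between the infinitesimal coefficients integrates to a relation between
the coefficients of the group. -/
theorem log_relation (A : AffineForm B Φ) {p q r : ℝ}
    (h : ∀ e, p * A.α e + q * A.γ e + r * A.a e = 0) : ∀ᶠ ε in 𝓝 0,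
      p * Real.log (A.E ε) + q * Real.log (A.G ε) + r * Real.log (A.H ε) = 0 := by
  -- The differentials of log E, log G, log H at ε are α, γ, a composed with the same map `rightLog
  -- ε`, so a linear relation among the forms makes the differential of the combination zero.
  refine eventually_eq_zero_of_fderiv (by simp [A.E_zero, A.G_zero, A.H_zero]) ?_
  filter_upwards [A.eventually_pos, A.hasFDerivAt_E, A.hasFDerivAt_G, A.hasFDerivAt_H]
    with ε h0 h1 h2 h3
  obtain ⟨p1, p2, p3⟩ := h0
  refine ((((h1.log p1.ne').const_mul p).fun_add ((h2.log p2.ne').const_mul q)).fun_add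
    ((h3.log p3.ne').const_mul r)).congr_fderiv ?_
  ext e
  have := h (Φ.rightLog ε e)
  simp
  field_simp
  linarith

/-- When β = 0, F and E have the same logarithmic rate, so F/E has zero differential and starts at
0. -/
theorem F_eq_zero (A : AffineForm B Φ) (h : ∀ e, A.β e = 0) : ∀ᶠ ε in 𝓝 0, A.F ε = 0 := by
  have hFE : ∀ᶠ ε in 𝓝 0, A.F ε * Real.exp (-Real.log (A.E ε)) = 0 := by
    refine eventually_eq_zero_of_fderiv (f := fun ε => A.F ε * Real.exp (-Real.log (A.E ε)))
      (by simp [A.F_zero]) ?_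
    filter_upwards [A.eventually_pos, A.hasFDerivAt_E, A.hasFDerivAt_F] with ε h0 h1 h2
    refine (h2.fun_mul (h1.log h0.1.ne').fun_neg.exp).congr_fderiv ?_
    ext e
    have := h0.1.ne'
    simp [h]
    field_simp
    ring
  filter_upwards [hFE] with ε h1
  exact (mul_eq_zero.1 h1).resolve_right (Real.exp_pos _).ne'

/-- This serves the exponential flux, where a time shift is tied to a temperature scaling: with α =
0 the differential of F is m times that of log H. -/
theorem F_eq_log (A : AffineForm B Φ) {m : ℝ} (hα : ∀ e, A.α e = 0) (h : ∀ e, A.β e = m * A.a e) :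
    ∀ᶠ ε in 𝓝 0, A.F ε = m * Real.log (A.H ε) := by
  have h : ∀ᶠ ε in 𝓝 0, A.F ε - m * Real.log (A.H ε) = 0 := by
    refine eventually_eq_zero_of_fderiv (f := fun ε => A.F ε - m * Real.log (A.H ε))
      (by simp [A.F_zero, A.H_zero]) ?_
    filter_upwards [A.eventually_pos, A.hasFDerivAt_H, A.hasFDerivAt_F] with ε h0 h1 h2
    refine (h2.fun_sub ((h1.log h0.2.2.ne').const_mul m)).congr_fderiv ?_
    ext e
    have := h0.2.2.ne'
    simp [h, hα]
    field_simp
    ring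
  filter_upwards [h] with ε hε
  linarith

end AffineForm

end HeatBVP

/-! ### Explicit scaling groups and their invariance -/

namespace HeatBVP

/-- Rescaling of the derivatives under `f' (E t + F, G x) = H f (t, x)`. -/
theorem jet_of_scaling {f f' : ℝ × ℝ → ℝ} {t x E F G H : ℝ} (hE : E ≠ 0) (hG : G ≠ 0)
    (h : ∀ᶠ p in 𝓝 (t, x), f' (E * p.1 + F, G * p.2) = H * f p) :
    f' =ᶠ[𝓝 (E * t + F, G * x)] (fun p => H * f (E⁻¹ * (p.1 - F), G⁻¹ * p.2)) ∧
    dt f' (E * t + F) (G * x) = H / E * dt f t x ∧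
    ∀ᶠ y in 𝓝 (G * x), dx f' (E * t + F) y = H / G * dx f t (G⁻¹ * y) := by
  have h1 : f' =ᶠ[𝓝 (E * t + F, G * x)] (fun p => H * f (E⁻¹ * (p.1 - F), G⁻¹ * p.2)) := by
    have c : Tendsto (fun p : ℝ × ℝ => (E⁻¹ * (p.1 - F), G⁻¹ * p.2)) (𝓝 (E * t + F, G * x))
        (𝓝 (t, x)) := by
      have : Continuous (fun p : ℝ × ℝ => (E⁻¹ * (p.1 - F), G⁻¹ * p.2)) := by fun_prop
      simpa [hE, hG] using this.tendsto (E * t + F, G * x)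
    filter_upwards [c.eventually h] with p hp
    rw [← hp]
    congr 1
    ext <;> field_simp
    ring
  refine ⟨h1, ?_, ?_⟩
  · have c : Tendsto (fun s : ℝ => (s, G * x)) (𝓝 (E * t + F)) (𝓝 (E * t + F, G * x)) :=
      Continuous.tendsto (by fun_prop) _
    have h1' : (fun s => f' (s, G * x)) =ᶠ[𝓝 (E * t + F)]
        fun s => H * f (E⁻¹ * (s - F), G⁻¹ * (G * x)) := c.eventually h1
    have h2 := h1'.deriv_eq
    have h3 : ∀ s, H * f (E⁻¹ * (s - F), G⁻¹ * (G * x)) = H * (fun r => f (r - E⁻¹ * F, x)) (E⁻¹ * s) := by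
      intro s
      simp only [mul_sub, inv_mul_cancel_left₀ hG]
    simp only [h3] at h2
    rw [dt, h2, deriv_const_mul_field,
      deriv_comp_mul_left E⁻¹ (fun r => f (r - E⁻¹ * F, x)),
      deriv_comp_sub_const (f := fun r => f (r, x)), dt]
    rw [mul_add, inv_mul_cancel_left₀ hE, add_sub_cancel_right, smul_eq_mul]
    ring
  · have c : Tendsto (fun s : ℝ => (E * t + F, s)) (𝓝 (G * x)) (𝓝 (E * t + F, G * x)) :=
      Continuous.tendsto (by fun_prop) _
    filter_upwards [(c.eventually h1).eventually_nhds] with y hy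
    have h2 := Filter.EventuallyEq.deriv_eq hy
    have h3 : ∀ s, H * f (E⁻¹ * (E * t + F - F), G⁻¹ * s) = H * (fun r => f (t, r)) (G⁻¹ * s) := by
      intro s
      simp only [add_sub_cancel_right, inv_mul_cancel_left₀ hE]
    simp only [h3] at h2
    rw [dx, h2, deriv_const_mul_field, deriv_comp_mul_left G⁻¹ (fun r => f (t, r)), dx, smul_eq_mul]
    ring

/-- The interval I consists of positive numbers and has 0 in its closure, so it reaches down to 0.
Thus scalings of low temperatures stay in I, as invariance near infinity requires. -/
theorem Problem.exists_Ioo_subset_I {B : Problem} (hI : B.I ⊆ Ioi 0) (h0 : B.uInf = 0) :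
    ∃ v, 0 < v ∧ Ioo 0 v ⊆ B.I := by
  obtain ⟨v, hv⟩ := B.nonempty_I
  refine ⟨v, hI hv, fun w hw => ?_⟩
  have h1 : (0 : ℝ) ∈ closure B.I := h0 ▸ B.uInf_mem
  obtain ⟨w', hw', hlt⟩ := Metric.mem_closure_iff.1 h1 w hw.1
  have h2 := hI hw'
  rw [Real.dist_eq, zero_sub, abs_neg, abs_of_pos h2] at hlt
  exact B.ordConnected_I.out hw' hv ⟨hlt.le, hw.2.le⟩

/-- Coefficients of a global action `t* = e^α t + β`, `x* = e^γ x`, `u* = e^a u` of a semidirect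
product of lines: the coordinates with `w i = 1` are scaled by `e^α`. -/
structure AffineAction (N : ℕ) where
  w : Fin N → ℝ
  (α β γ a : (Fin N → ℝ) → ℝ)
  α_smooth : ContDiff ℝ ∞ α
  β_smooth : ContDiff ℝ ∞ β
  γ_smooth : ContDiff ℝ ∞ γ
  a_smooth : ContDiff ℝ ∞ a
  α_mul : ∀ δ ε, α (fun i => δ i + Real.exp (w i * α δ) * ε i) = α δ + α ε
  β_mul : ∀ δ ε, β (fun i => δ i + Real.exp (w i * α δ) * ε i) = β δ + Real.exp (α δ) * β ε
  γ_mul : ∀ δ ε, γ (fun i => δ i + Real.exp (w i * α δ) * ε i) = γ δ + γ ε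
  a_mul : ∀ δ ε, a (fun i => δ i + Real.exp (w i * α δ) * ε i) = a δ + a ε

namespace AffineAction

variable {N : ℕ} (D : AffineAction N)

protected noncomputable def mul (δ ε : Fin N → ℝ) : Fin N → ℝ := fun i => δ i + Real.exp (D.w i * D.α δ) * ε i

protected noncomputable def inv (ε : Fin N → ℝ) : Fin N → ℝ := fun i => -(Real.exp (-(D.w i * D.α ε)) * ε i)

noncomputable def act (ε : Fin N → ℝ) (z : ℝ × ℝ × ℝ) : ℝ × ℝ × ℝ :=
  (Real.exp (D.α ε) * z.1 + D.β ε, Real.exp (D.γ ε) * z.2.1, Real.exp (D.a ε) * z.2.2)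

protected theorem zero_mul (ε : Fin N → ℝ) : D.mul 0 ε = ε := by
  have h0 : D.α 0 = 0 := by
    have := D.α_mul 0 0
    simp only [Pi.zero_apply, mul_zero, add_zero] at this
    change D.α 0 = _ at this
    linarith
  funext i; simp [AffineAction.mul, h0]

protected theorem mul_zero (ε : Fin N → ℝ) : D.mul ε 0 = ε := by
  funext i; simp [AffineAction.mul]

theorem α_zero : D.α 0 = 0 := by
  have := D.α_mul 0 0
  change D.α (D.mul 0 0) = _ at this
  rw [D.mul_zero] at this
  linarith

theorem γ_zero : D.γ 0 = 0 := by
  have := D.γ_mul 0 0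
  change D.γ (D.mul 0 0) = _ at this
  rw [D.mul_zero] at this
  linarith

theorem a_zero : D.a 0 = 0 := by
  have := D.a_mul 0 0
  change D.a (D.mul 0 0) = _ at this
  rw [D.mul_zero] at this
  linarith

theorem β_zero : D.β 0 = 0 := by
  have := D.β_mul 0 0
  change D.β (D.mul 0 0) = _ at this
  rw [D.mul_zero, D.α_zero, Real.exp_zero] at this
  linarith

protected theorem mul_inv (ε : Fin N → ℝ) : D.mul ε (D.inv ε) = 0 := by
  funext i
  have := (Real.exp_pos (D.w i * D.α ε)).ne'
  simp only [AffineAction.mul, AffineAction.inv, Real.exp_neg, Pi.zero_apply]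
  field_simp
  ring

theorem α_inv (ε : Fin N → ℝ) : D.α (D.inv ε) = -D.α ε := by
  have := D.α_mul ε (D.inv ε)
  change D.α (D.mul _ _) = _ at this
  rw [D.mul_inv, D.α_zero] at this
  linarith

protected theorem inv_mul (ε : Fin N → ℝ) : D.mul (D.inv ε) ε = 0 := by
  funext i
  simp only [AffineAction.mul, D.α_inv, AffineAction.inv, Pi.zero_apply, mul_neg]
  ring

protected theorem mul_assoc (δ ε ζ : Fin N → ℝ) : D.mul δ (D.mul ε ζ) = D.mul (D.mul δ ε) ζ := by
  funext i
  have h : D.α (D.mul δ ε) = D.α δ + D.α ε := D.α_mul δ ε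
  simp only [AffineAction.mul] at h ⊢
  rw [h, mul_add (D.w i), Real.exp_add]
  ring

theorem act_mul (δ ε : Fin N → ℝ) (z : ℝ × ℝ × ℝ) :
    D.act δ (D.act ε z) = D.act (D.mul δ ε) z := by
  have h1 : D.α (D.mul δ ε) = D.α δ + D.α ε := D.α_mul δ ε
  have h2 : D.β (D.mul δ ε) = D.β δ + Real.exp (D.α δ) * D.β ε := D.β_mul δ ε
  have h3 : D.γ (D.mul δ ε) = D.γ δ + D.γ ε := D.γ_mul δ ε
  have h4 : D.a (D.mul δ ε) = D.a δ + D.a ε := D.a_mul δ ε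
  simp only [act, h1, h2, h3, h4, Real.exp_add, Prod.mk.injEq]
  refine ⟨by ring, by ring, by ring⟩

theorem act_zero (z : ℝ × ℝ × ℝ) : D.act 0 z = z := by
  simp [act, D.α_zero, D.β_zero, D.γ_zero, D.a_zero]

theorem contDiff_act : ContDiff ℝ ∞ (fun p : (Fin N → ℝ) × (ℝ × ℝ × ℝ) => D.act p.1 p.2) := by
  have h1 := D.α_smooth
  have h2 := D.β_smooth
  have h3 := D.γ_smooth
  have h4 := D.a_smooth
  unfold act
  fun_prop

/-- The action restricted to the strip `t > τ`, `u ∈ I`. -/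
noncomputable def group (B : Problem) : PointGroup N where
  V := univ
  V₀ := univ
  isOpen_V := isOpen_univ
  isOpen_V₀ := isOpen_univ
  isConnected_V := convex_univ.isConnected ⟨0, trivial⟩
  isConnected_V₀ := convex_univ.isConnected ⟨0, trivial⟩
  V₀_subset := subset_rfl
  zero_mem := trivial
  mul := D.mul
  inv := D.inv
  mul_smooth := by
    have h1 := D.α_smooth
    unfold AffineAction.mul
    exact ContDiff.contDiffOn (by fun_prop)
  inv_smooth := by
    have h1 := D.α_smooth
    unfold AffineAction.inv
    exact ContDiff.contDiffOn (by fun_prop)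
  inv_mem _ _ := trivial
  mul_assoc a _ b _ c _ _ _ := D.mul_assoc a b c
  zero_mul a _ := D.zero_mul a
  mul_zero a _ := D.mul_zero a
  mul_inv a _ := D.mul_inv a
  inv_mul a _ := D.inv_mul a
  M := {z | B.τ < z.1 ∧ z.2.2 ∈ B.I}
  isOpen_M := (isOpen_Ioi.preimage continuous_fst).inter
    (B.isOpen_I.preimage (continuous_snd.comp continuous_snd))
  -- The formulas define a global action; locality lies only in the requirement that the image stay
  -- in the strip.
  dom := {p | (B.τ < p.2.1 ∧ p.2.2.2 ∈ B.I) ∧ B.τ < (D.act p.1 p.2).1 ∧ (D.act p.1 p.2).2.2 ∈ B.I}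
  isOpen_dom := by
    have h := D.contDiff_act.continuous
    exact ((isOpen_Ioi.preimage (f := fun p : (Fin N → ℝ) × (ℝ × ℝ × ℝ) => p.2.1) (by fun_prop)).inter
      (B.isOpen_I.preimage (f := fun p : (Fin N → ℝ) × (ℝ × ℝ × ℝ) => p.2.2.2) (by fun_prop))).inter
      ((isOpen_Ioi.preimage h.fst).inter (B.isOpen_I.preimage h.snd.snd))
  dom_subset p hp := ⟨trivial, hp.1⟩
  zero_mem_dom z hz := ⟨hz, by rw [D.act_zero]; exact hz⟩
  act := D.act
  act_smooth := D.contDiff_act.contDiffOn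
  act_mem ε z h := h.2
  act_zero z _ := D.act_zero z
  act_mul δ ε z _ _ _ := D.act_mul δ ε z
  act_inv ε z _ h := by
    have : D.act (D.inv ε) (D.act ε z) = z := by rw [D.act_mul, D.inv_mul, D.act_zero]
    refine ⟨⟨h.2, ?_⟩, this⟩
    simp only [this]
    exact h.1
  act_fibre ε t x u u' _ _ := ⟨rfl, rfl⟩

variable {D} {B : Problem}

/-- An action by scalings that respects the arbitrary elements of the problem is a group of
invariance. -/
theorem isInvariant
    (hd : ∀ ε, ∀ u ∈ B.I, Real.exp (D.a ε) * u ∈ B.I →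
      B.d (Real.exp (D.a ε) * u) * Real.exp (D.α ε) = Real.exp (D.γ ε) ^ 2 * B.d u)
    (hq : ∀ ε t, B.τ < t → B.τ < Real.exp (D.α ε) * t + D.β ε →
      B.q (Real.exp (D.α ε) * t + D.β ε) * Real.exp (D.α ε)
        = Real.exp (D.a ε) * Real.exp (D.γ ε) * B.q t)
    (hI : (B.uInf = 0 ∧ B.I ⊆ Ioi 0) ∨ ∀ ε, D.a ε = 0) : IsInvariant B (D.group B) where
  region_subset z hz := ⟨hz.1, hz.2.2⟩
  subset_strip z hz := hz
  domain ε t x u _ hx := mul_pos (Real.exp_pos _) hx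
  equation ε t x u hdom hx f f' hf hfu heq hf' hc := by
    have hE := (Real.exp_pos (D.α ε)).ne'
    have hG := (Real.exp_pos (D.γ ε)).ne'
    obtain ⟨h1, h2, h3⟩ := jet_of_scaling (f := f) (F := D.β ε) (H := Real.exp (D.a ε)) hE hG hc
    simp only [group, act] at hdom ⊢
    unfold Problem.HeatEqAt at heq ⊢
    rw [h2, heq]
    have c : Tendsto (fun s : ℝ => (Real.exp (D.α ε) * t + D.β ε, s)) (𝓝 (Real.exp (D.γ ε) * x))
        (𝓝 (Real.exp (D.α ε) * t + D.β ε, Real.exp (D.γ ε) * x)) :=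
      Continuous.tendsto (by fun_prop) _
    have cf : Tendsto (fun y => f (t, (Real.exp (D.γ ε))⁻¹ * y)) (𝓝 (Real.exp (D.γ ε) * x)) (𝓝 u) := by
      have := hf.continuousAt
      rw [ContinuousAt, hfu] at this
      refine this.comp ?_
      have c2 : Continuous (fun y => (t, (Real.exp (D.γ ε))⁻¹ * y)) := by fun_prop
      simpa [hG] using c2.tendsto (Real.exp (D.γ ε) * x)
    have i1 := cf.eventually (B.isOpen_I.mem_nhds hdom.1.2)
    have i2 := (cf.const_mul (Real.exp (D.a ε))).eventually (B.isOpen_I.mem_nhds hdom.2.2)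
    -- Near the point the flux d u_x is multiplied by the constant e^(γ + a - α). The scaling law of
    -- d is available only when the old and the new temperatures both lie in I.
    have key : (fun y => B.d (f' (Real.exp (D.α ε) * t + D.β ε, y)) *
        dx f' (Real.exp (D.α ε) * t + D.β ε) y) =ᶠ[𝓝 (Real.exp (D.γ ε) * x)] fun y =>
        (Real.exp (D.γ ε) * Real.exp (D.a ε) / Real.exp (D.α ε)) *
          (fun y => B.d (f (t, y)) * dx f t y) ((Real.exp (D.γ ε))⁻¹ * y) := by
      filter_upwards [h3, c.eventually h1, i1, i2] with y k1 k2 k3 k4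
      rw [k1, k2]
      simp only [add_sub_cancel_right, inv_mul_cancel_left₀ hE] at k4 ⊢
      have := hd ε _ k3 k4
      rw [← eq_div_iff hE] at this
      rw [this]
      field_simp
    rw [key.deriv_eq, deriv_const_mul_field,
      deriv_comp_mul_left (Real.exp (D.γ ε))⁻¹ (fun y => B.d (f (t, y)) * dx f t y),
      inv_mul_cancel_left₀ hG,      smul_eq_mul]
    field_simp
  boundary ε t u _ := by simp [group, act]
  flux ε t u hdom f f' hf hfu heq hf' hc := by
    have hE := (Real.exp_pos (D.α ε)).ne'
    have hG := (Real.exp_pos (D.γ ε)).ne'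
    obtain ⟨h1, h2, h3⟩ := jet_of_scaling (f := f) (F := D.β ε) (H := Real.exp (D.a ε)) hE hG hc
    simp only [group, act] at hdom ⊢
    unfold Problem.FluxAt at heq ⊢
    rw [h3.self_of_nhds, h1.self_of_nhds]
    simp only [add_sub_cancel_right, inv_mul_cancel_left₀ hE, inv_mul_cancel_left₀ hG, hfu] at heq ⊢
    have e1 := hd ε u hdom.1.2 hdom.2.2
    have e2 := hq ε t hdom.1.1 hdom.2.1
    rw [← eq_div_iff hE] at e1 e2
    rw [e1, e2, ← heq]
    field_simp
  near_infinity t ht := by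
    have c1 : Tendsto (fun ε => Real.exp (D.α ε) * t + D.β ε) (𝓝 0) (𝓝 t) := by
      have h1 := D.α_smooth.continuous
      have h2 := D.β_smooth.continuous
      have : Continuous (fun ε => Real.exp (D.α ε) * t + D.β ε) := by fun_prop
      simpa [D.α_zero, D.β_zero] using this.tendsto 0
    have e1 : ∀ᶠ p in 𝓝 (0 : Fin N → ℝ) ×ˢ (atTop ×ˢ 𝓝[B.I] B.uInf : Filter (ℝ × ℝ)),
        B.τ < Real.exp (D.α p.1) * t + D.β p.1 :=
      tendsto_fst.eventually (c1.eventually_const_lt ht)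
    have e2 : ∀ᶠ p in 𝓝 (0 : Fin N → ℝ) ×ˢ (atTop ×ˢ 𝓝[B.I] B.uInf : Filter (ℝ × ℝ)),
        p.2.2 ∈ B.I :=
      (tendsto_snd.comp tendsto_snd).eventually self_mem_nhdsWithin
    have e3 : ∀ᶠ p in 𝓝 (0 : Fin N → ℝ) ×ˢ (atTop ×ˢ 𝓝[B.I] B.uInf : Filter (ℝ × ℝ)),
        Real.exp (D.a p.1) * p.2.2 ∈ B.I := by
      rcases hI with ⟨h0, hI⟩ | h
      · obtain ⟨v, hv, hIv⟩ := Problem.exists_Ioo_subset_I hI h0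
        have c2 : Tendsto (fun p : (Fin N → ℝ) × (ℝ × ℝ) => Real.exp (D.a p.1) * p.2.2)
            (𝓝 (0 : Fin N → ℝ) ×ˢ (atTop ×ˢ 𝓝[B.I] B.uInf)) (𝓝 (1 * 0)) := by
          refine Tendsto.mul ?_ ?_
          · have : Tendsto (fun ε => Real.exp (D.a ε)) (𝓝 0) (𝓝 1) := by
              have h1 := D.a_smooth.continuous
              have : Continuous (fun ε => Real.exp (D.a ε)) := by fun_prop
              simpa [D.a_zero] using this.tendsto 0
            exact this.comp tendsto_fst
          · rw [h0]
            exact (tendsto_id.mono_left nhdsWithin_le_nhds).comp (tendsto_snd.comp tendsto_snd)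
        filter_upwards [c2.eventually_lt_const (u := v) (by simpa using hv), e2] with p h1 h2
        exact hIv ⟨mul_pos (Real.exp_pos _) (hI h2), h1⟩
      · simpa [h] using e2
    filter_upwards [e1, e2, e3] with p h1 h2 h3
    exact ⟨⟨ht, h2⟩, h1, h3⟩
  at_infinity t ht := Filter.Eventually.of_forall fun ε => by
    refine ⟨tendsto_fst.const_mul_atTop (Real.exp_pos _), ?_⟩
    have h1 : Tendsto (fun p : ℝ × ℝ => p.2) (atTop ×ˢ 𝓝[B.I] B.uInf) (𝓝 B.uInf) :=
      (tendsto_id.mono_left nhdsWithin_le_nhds).comp tendsto_snd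
    have h2 := h1.const_mul (Real.exp (D.a ε))
    rcases hI with ⟨h0, hI⟩ | h
    · simpa [h0, group, act] using h2
    · simpa [h, group, act] using h1

/-- The parameters of the subgroup `Φ` of the group `D.group B`. -/
structure Embeds {N' : ℕ} {Φ : PointGroup N'} (D : AffineAction N) (A : AffineForm B Φ)
    (σ : (Fin N' → ℝ) → (Fin N → ℝ)) : Prop where
  smooth : ContDiffAt ℝ ∞ σ 0
  zero : σ 0 = 0
  α_eq : ∀ᶠ ε in 𝓝 0, D.α (σ ε) = Real.log (A.E ε)
  β_eq : ∀ᶠ ε in 𝓝 0, D.β (σ ε) = A.F ε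
  γ_eq : ∀ᶠ ε in 𝓝 0, D.γ (σ ε) = Real.log (A.G ε)
  a_eq : ∀ᶠ ε in 𝓝 0, D.a (σ ε) = Real.log (A.H ε)

/-- σ is a homomorphism because the coefficients obey the same composition laws on both sides and
they determine the parameter. The explicit action scales `u` about 0 and not about u_∞; hence the
assumption that u_∞ = 0 or that `u` is fixed. -/
theorem Embeds.isContained {N' : ℕ} {Φ : PointGroup N'} {A : AffineForm B Φ}
    {σ : (Fin N' → ℝ) → (Fin N → ℝ)} (h : Embeds D A σ) (hB : IsInvariant B Φ)
    (hI : B.uInf = 0 ∨ ∀ ε, D.a ε = 0)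
    (inj : ∀ δ ε, D.α δ = D.α ε → D.β δ = D.β ε → D.γ δ = D.γ ε → D.a δ = D.a ε → δ = ε) :
    IsContained B Φ (D.group B) := by
  have ev : ∀ᶠ ε in 𝓝 (0 : Fin N' → ℝ), (0 < A.E ε ∧ 0 < A.G ε ∧ 0 < A.H ε) ∧
      D.α (σ ε) = Real.log (A.E ε) ∧ D.β (σ ε) = A.F ε ∧ D.γ (σ ε) = Real.log (A.G ε) ∧
      D.a (σ ε) = Real.log (A.H ε) := by
    filter_upwards [A.eventually_pos, h.α_eq, h.β_eq, h.γ_eq, h.a_eq] with ε h1 h2 h3 h4 h5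
      using ⟨h1, h2, h3, h4, h5⟩
  refine ⟨σ, h.zero, h.smooth, ?_, fun z hz => ?_⟩
  · have hmul : Tendsto (fun p : (Fin N' → ℝ) × (Fin N' → ℝ) => Φ.mul p.1 p.2) (𝓝 (0, 0)) (𝓝 0) := by
      have h1 := (Φ.contDiffAt_mul Φ.zero_mem_V Φ.zero_mem_V).continuousAt
      rw [ContinuousAt] at h1
      simpa [Φ.zero_mul 0 Φ.zero_mem_V] using h1
    filter_upwards [A.mul_eq hB, (continuous_fst.tendsto ((0 : Fin N' → ℝ), (0 : Fin N' → ℝ))).eventually ev,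
      (continuous_snd.tendsto ((0 : Fin N' → ℝ), (0 : Fin N' → ℝ))).eventually ev,
      hmul.eventually ev] with p h0 h1 h2 h3
    obtain ⟨m1, m2, m3, m4⟩ := h0
    obtain ⟨⟨p1, p2, p3⟩, a1, a2, a3, a4⟩ := h1
    obtain ⟨⟨q1, q2, q3⟩, b1, b2, b3, b4⟩ := h2
    obtain ⟨-, c1, c2, c3, c4⟩ := h3
    refine inj _ _ ?_ ?_ ?_ ?_
    · rw [c1, m1, Real.log_mul p1.ne' q1.ne', ← a1, ← b1]; exact (D.α_mul _ _).symm
    · refine Eq.trans ?_ (D.β_mul _ _).symm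
      rw [c2, m2, a2, b2, a1, Real.exp_log p1]; ring
    · rw [c3, m3, Real.log_mul p2.ne' q2.ne', ← a3, ← b3]; exact (D.γ_mul _ _).symm
    · rw [c4, m4, Real.log_mul p3.ne' q3.ne', ← a4, ← b4]; exact (D.a_mul _ _).symm
  · filter_upwards [A.act_eq z hz, (continuous_fst.tendsto ((0 : Fin N' → ℝ), z)).eventually ev]
      with p h0 h1 hp
    obtain ⟨⟨p1, p2, p3⟩, a1, a2, a3, a4⟩ := h1
    rw [h0 hp]
    change _ = D.act _ _
    simp only [act, a1, a2, a3, a4, Real.exp_log p1, Real.exp_log p2, Real.exp_log p3]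
    refine Prod.ext rfl (Prod.ext rfl ?_)
    rcases hI with hI | hI
    · simp [hI]
    · rw [hI] at a4
      have : A.H p.1 = 1 := by rw [← Real.exp_log p3, ← a4, Real.exp_zero]
      simp [this]

end AffineAction

end HeatBVP

/-! ### Equivalence transformations and power conductivities -/

namespace HeatBVP

namespace Equivalent

variable {B B' B'' : Problem}

theorem symm (h : Equivalent B B') : Equivalent B' B := by
  obtain ⟨e₁, e₂, e₃, t₀, u₀, h1, h2, h3, hτ, hI, hd, hq, hu⟩ := h
  refine ⟨e₁⁻¹, e₂⁻¹, e₃⁻¹, -t₀ / e₁, -u₀ / e₃, inv_ne_zero h1, inv_pos.2 h2, inv_ne_zero h3,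
    fun t => ?_, fun u => ?_, fun u hu' => ?_, fun t ht => ?_, ?_⟩
  · rw [← hτ, show e₁ * (e₁⁻¹ * t + -t₀ / e₁) + t₀ = t by field_simp; ring]
  · rw [← hI, show e₃ * (e₃⁻¹ * u + -u₀ / e₃) + u₀ = u by field_simp; ring]
  · have e : e₃ * (e₃⁻¹ * u + -u₀ / e₃) + u₀ = u := by field_simp; ring
    have := hd (e₃⁻¹ * u + -u₀ / e₃) ((hI _).1 (by rwa [e]))
    rw [e] at this
    rw [this]
    field_simp
  · have e : e₁ * (e₁⁻¹ * t + -t₀ / e₁) + t₀ = t := by field_simp; ring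
    have := hq (e₁⁻¹ * t + -t₀ / e₁) ((hτ _).1 (by rwa [e]))
    rw [e] at this
    rw [this]
    field_simp
  · rw [hu]; field_simp; ring

theorem trans (h : Equivalent B B') (h' : Equivalent B' B'') : Equivalent B B'' := by
  obtain ⟨e₁, e₂, e₃, t₀, u₀, h1, h2, h3, hτ, hI, hd, hq, hu⟩ := h
  obtain ⟨f₁, f₂, f₃, s₀, v₀, k1, k2, k3, kτ, kI, kd, kq, ku⟩ := h'
  refine ⟨f₁ * e₁, f₂ * e₂, f₃ * e₃, f₁ * t₀ + s₀, f₃ * u₀ + v₀, mul_ne_zero k1 h1, mul_pos k2 h2,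
    mul_ne_zero k3 h3, fun t => ?_, fun u => ?_, fun u hu' => ?_, fun t ht => ?_, ?_⟩
  · rw [← hτ, ← kτ, show f₁ * e₁ * t + (f₁ * t₀ + s₀) = f₁ * (e₁ * t + t₀) + s₀ by ring]
  · rw [← hI, ← kI, show f₃ * e₃ * u + (f₃ * u₀ + v₀) = f₃ * (e₃ * u + u₀) + v₀ by ring]
  · rw [show f₃ * e₃ * u + (f₃ * u₀ + v₀) = f₃ * (e₃ * u + u₀) + v₀ by ring, kd _ ((hI u).2 hu'),
      hd u hu']
    field_simp
  · rw [show f₁ * e₁ * t + (f₁ * t₀ + s₀) = f₁ * (e₁ * t + t₀) + s₀ by ring, kq _ ((hτ t).2 ht),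
      hq t ht]
    field_simp
  · rw [ku, hu]; ring

/-- An equivalence transformation preserves the direction of time. -/
theorem exists_pos (h : Equivalent B B') : ∃ e₁ e₂ e₃ t₀ u₀ : ℝ, 0 < e₁ ∧ 0 < e₂ ∧ e₃ ≠ 0 ∧
    (∀ t, B'.τ < e₁ * t + t₀ ↔ B.τ < t) ∧
    (∀ u, e₃ * u + u₀ ∈ B'.I ↔ u ∈ B.I) ∧
    (∀ u ∈ B.I, B'.d (e₃ * u + u₀) = e₂ ^ 2 / e₁ * B.d u) ∧
    (∀ t, B.τ < t → B'.q (e₁ * t + t₀) = e₂ * e₃ / e₁ * B.q t) ∧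
    B'.uInf = e₃ * B.uInf + u₀ := by
  obtain ⟨e₁, e₂, e₃, t₀, u₀, h1, h2, h3, hτ, hI, hd, hq, hu⟩ := h
  refine ⟨e₁, e₂, e₃, t₀, u₀, lt_of_le_of_ne (not_lt.1 fun hn => ?_) h1.symm, h2, h3, hτ, hI, hd,
    hq, hu⟩
  -- A negative e₁ would send large times below the initial time of the second problem.
  have h4 := (hτ (max (B.τ + 1) ((B'.τ - t₀) / e₁))).2
    (lt_of_lt_of_le (lt_add_one _) (le_max_left _ _))
  have h5 := mul_le_mul_of_nonpos_left (le_max_right (B.τ + 1) ((B'.τ - t₀) / e₁)) hn.le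
  rw [mul_div_cancel₀ _ h1] at h5
  linarith

end Equivalent

/-- The image of a problem under an equivalence transformation. -/
noncomputable def Problem.transform (B : Problem) (e₁ e₂ e₃ t₀ u₀ : ℝ) (h₁ : 0 < e₁) (h₂ : 0 < e₂)
    (h₃ : e₃ ≠ 0) : Problem where
  τ := e₁ * B.τ + t₀
  I := (fun v => e₃⁻¹ * (v - u₀)) ⁻¹' B.I
  d v := e₂ ^ 2 / e₁ * B.d (e₃⁻¹ * (v - u₀))
  q t := e₂ * e₃ / e₁ * B.q (e₁⁻¹ * (t - t₀))
  uInf := e₃ * B.uInf + u₀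
  isOpen_I := B.isOpen_I.preimage (by fun_prop)
  ordConnected_I := by
    rcases lt_or_gt_of_ne h₃ with h | h
    · exact B.ordConnected_I.preimage_anti fun a b hab =>
        mul_le_mul_of_nonpos_left (sub_le_sub_right hab _) (inv_nonpos.2 h.le)
    · exact B.ordConnected_I.preimage_mono fun a b hab =>
        mul_le_mul_of_nonneg_left (sub_le_sub_right hab _) (inv_nonneg.2 h.le)
  d_smooth := contDiffOn_const.mul (B.d_smooth.comp (ContDiff.contDiffOn (by fun_prop))
    (mapsTo_preimage _ _))
  d_pos u hu := mul_pos (by positivity) (B.d_pos _ hu)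
  d_nonconst := by
    rintro ⟨c, hc⟩
    refine B.d_nonconst ⟨e₁ / e₂ ^ 2 * c, fun u hu => ?_⟩
    have e : e₃⁻¹ * (e₃ * u + u₀ - u₀) = u := by field_simp; ring
    have := hc (e₃ * u + u₀) (by rw [mem_preimage, e]; exact hu)
    rw [e] at this
    rw [← this]
    field_simp
  q_smooth := contDiffOn_const.mul (B.q_smooth.comp (ContDiff.contDiffOn (by fun_prop))
    (fun t ht => by
      rw [mem_Ioi] at ht ⊢
      rw [inv_mul_eq_div, lt_div_iff₀ h₁]
      linarith))
  uInf_mem := map_mem_closure (f := fun v => e₃ * v + u₀) (by fun_prop) B.uInf_mem fun u hu => by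
    rw [mem_preimage, add_sub_cancel_right, inv_mul_cancel_left₀ h₃]
    exact hu

theorem Problem.equivalent_transform (B : Problem) (e₁ e₂ e₃ t₀ u₀ : ℝ) (h₁ : 0 < e₁) (h₂ : 0 < e₂)
    (h₃ : e₃ ≠ 0) : Equivalent B (B.transform e₁ e₂ e₃ t₀ u₀ h₁ h₂ h₃) := by
  refine ⟨e₁, e₂, e₃, t₀, u₀, h₁.ne', h₂, h₃, fun t => ?_, fun u => ?_, fun u hu => ?_,
    fun t ht => ?_, rfl⟩
  · change e₁ * B.τ + t₀ < _ ↔ _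
    rw [add_lt_add_iff_right, mul_lt_mul_iff_right₀ h₁]
  · change e₃⁻¹ * (e₃ * u + u₀ - u₀) ∈ B.I ↔ _
    rw [add_sub_cancel_right, inv_mul_cancel_left₀ h₃]
  · change _ * B.d (e₃⁻¹ * (e₃ * u + u₀ - u₀)) = _
    rw [add_sub_cancel_right, inv_mul_cancel_left₀ h₃]
  · change _ * B.q (e₁⁻¹ * (e₁ * t + t₀ - t₀)) = _
    rw [add_sub_cancel_right, inv_mul_cancel_left₀ h₁.ne']

theorem Equivalent.refl (B : Problem) : Equivalent B B :=
  (B.equivalent_transform 1 1 1 0 0 one_pos one_pos one_ne_zero).trans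
    (B.equivalent_transform 1 1 1 0 0 one_pos one_pos one_ne_zero).symm

/-- The conductivity is a power of `|u - u_∞|`. -/
def Problem.PowerAt (B : Problem) (k : ℝ) : Prop :=
  ∀ u ∈ B.I, (u - B.uInf) * deriv B.d u = k * B.d u

variable {B B' : Problem} {k k' : ℝ}

theorem Problem.PowerAt.unique (h : B.PowerAt k) (h' : B.PowerAt k') : k = k' := by
  obtain ⟨u, hu⟩ := B.nonempty_I
  exact mul_right_cancel₀ (B.d_pos u hu).ne' ((h u hu).symm.trans (h' u hu))

/-- For k = 0, a point with d' ≠ 0 would have to be u_∞; differentiating (u - u_∞)d' = 0 there gives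
d' = 0 after all. -/
theorem Problem.PowerAt.ne_zero (h : B.PowerAt k) : k ≠ 0 := by
  rintro rfl
  obtain ⟨u, hu, hne⟩ := B.exists_deriv_ne_zero
  have h0 := h u hu
  rw [zero_mul] at h0
  have hu0 : u = B.uInf := sub_eq_zero.1 ((mul_eq_zero.1 h0).resolve_right hne)
  have h1 := ((hasDerivAt_id u).sub_const B.uInf).fun_mul (B.differentiableAt_deriv_d hu).hasDerivAt
  have h2 : (fun v => (id v - B.uInf) * deriv B.d v) =ᶠ[𝓝 u] fun _ => 0 := by
    filter_upwards [B.isOpen_I.mem_nhds hu] with v hv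
    rw [id, h v hv, zero_mul]
  have h3 := (h1.congr_of_eventuallyEq h2.symm).unique (hasDerivAt_const u 0)
  simp [hu0] at h3
  exact hne (hu0 ▸ h3)

theorem Problem.PowerAt.uInf_notMem (h : B.PowerAt k) : B.uInf ∉ B.I := fun hu => by
  have h1 := h _ hu
  rw [sub_self, zero_mul] at h1
  exact (mul_ne_zero h.ne_zero (B.d_pos _ hu).ne') h1.symm

/-- I is an interval that avoids u_∞, so it lies on one side of it; s = ±1 records which. -/
theorem Problem.PowerAt.exists_sign (h : B.PowerAt k) :
    ∃ s : ℝ, s * s = 1 ∧ ∀ u ∈ B.I, 0 < s * (u - B.uInf) := by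
  obtain ⟨u₀, hu₀⟩ := B.nonempty_I
  have hne {u : ℝ} (hu : u ∈ B.I) : u ≠ B.uInf := fun h0 => h.uInf_notMem (h0 ▸ hu)
  rcases lt_or_gt_of_ne (hne hu₀) with h0 | h0
  · refine ⟨-1, by ring, fun u hu => ?_⟩
    have : u < B.uInf := by
      by_contra! hle
      exact h.uInf_notMem (B.ordConnected_I.out hu₀ hu ⟨h0.le, hle⟩)
    linarith
  · refine ⟨1, by ring, fun u hu => ?_⟩
    have : B.uInf < u := by
      by_contra! hle
      exact h.uInf_notMem (B.ordConnected_I.out hu hu₀ ⟨hle, h0.le⟩)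
    linarith

theorem Problem.PowerAt.exists_eq_rpow (h : B.PowerAt k) {s : ℝ} (hs : s * s = 1)
    (hpos : ∀ u ∈ B.I, 0 < s * (u - B.uInf)) :
    ∃ c, 0 < c ∧ ∀ u ∈ B.I, B.d u = c * (s * (u - B.uInf)) ^ k := by
  obtain ⟨u₀, hu₀⟩ := B.nonempty_I
  have hc : ∀ u ∈ B.I, HasDerivAt (fun u => B.d u * (s * (u - B.uInf)) ^ (-k)) 0 u := by
    intro u hu
    have hp := hpos u hu
    have h1 : HasDerivAt (fun u => s * (u - B.uInf)) s u :=
      (((hasDerivAt_id u).sub_const B.uInf).const_mul s).congr_deriv (mul_one s)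
    refine ((B.hasDerivAt_d hu).fun_mul (h1.rpow_const (p := -k) (Or.inl hp.ne'))).congr_deriv ?_
    rw [Real.rpow_sub hp, Real.rpow_one]
    have h2 := h u hu
    have h3 : u - B.uInf ≠ 0 := fun h0 => by simp [h0] at hp
    have h4 : s ≠ 0 := fun h0 => by simp [h0] at hs
    field_simp
    linear_combination (s * (u - B.uInf)) ^ (-k) * h2
  refine ⟨B.d u₀ * (s * (u₀ - B.uInf)) ^ (-k), mul_pos (B.d_pos _ hu₀)
    (Real.rpow_pos_of_pos (hpos _ hu₀) _), fun u hu => ?_⟩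
  rw [eq_of_hasDerivAt_zero B.isOpen_I B.isPreconnected_I hc hu₀ hu, mul_assoc,
    ← Real.rpow_add (hpos u hu)]
  simp

theorem Problem.IsPower.powerAt (h : B.IsPower k) : B.PowerAt k := by
  obtain ⟨hI, hd, h0⟩ := h
  intro u hu
  have hp : 0 < u := hI hu
  have h1 : B.d =ᶠ[𝓝 u] fun v => v ^ k := by
    filter_upwards [B.isOpen_I.mem_nhds hu] with v hv using hd v hv
  rw [h1.deriv_eq, Real.deriv_rpow_const, hd u hu, h0, Real.rpow_sub hp, Real.rpow_one]
  field_simp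
  ring

/-- The relation (u - u_∞)d' = kd is homogeneous in d and unchanged by affine changes of `u` that
carry u_∞ along. This makes k an invariant. -/
theorem Problem.PowerAt.of_equivalent (hB : Equivalent B B') (h : B.PowerAt k) : B'.PowerAt k := by
  obtain ⟨e₁, e₂, e₃, t₀, u₀, h1, h2, h3, hτ, hI, hd, hq, hu⟩ := hB.symm
  intro v hv
  have hv' := (hI v).2 hv
  have d1 : HasDerivAt (fun v => B.d (e₃ * v + u₀)) (deriv B.d (e₃ * v + u₀) * e₃) v := by
    have h : HasDerivAt (fun v => e₃ * v + u₀) e₃ v :=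
      (((hasDerivAt_id v).const_mul e₃).add_const u₀).congr_deriv (mul_one _)
    exact HasDerivAt.comp (h₂ := B.d) v (B.hasDerivAt_d hv') h
  have d2 := (B'.hasDerivAt_d hv).const_mul (e₂ ^ 2 / e₁)
  have e : (fun v => B.d (e₃ * v + u₀)) =ᶠ[𝓝 v] fun v => e₂ ^ 2 / e₁ * B'.d v := by
    filter_upwards [B'.isOpen_I.mem_nhds hv] with w hw using hd w hw
  have h4 := d1.unique (d2.congr_of_eventuallyEq e)
  have h5 := h _ hv'
  rw [hd v hv, hu] at h5
  have h6 : e₂ ^ 2 / e₁ ≠ 0 := div_ne_zero (pow_ne_zero _ h2.ne') h1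
  refine mul_left_cancel₀ h6 ?_
  linear_combination h5 - (v - B'.uInf) * h4

/-- Normal form of a problem whose conductivity is a power. -/
theorem Problem.PowerAt.normalize (h : B.PowerAt k) {e₁ : ℝ} (h₁ : 0 < e₁) (t₀ : ℝ) :
    ∃ B', Equivalent B B' ∧ B'.IsPower k ∧ ∃ C, C ≠ 0 ∧ ∀ t, B'.τ < t →
      B.τ < e₁⁻¹ * (t - t₀) ∧ B'.q t = C * B.q (e₁⁻¹ * (t - t₀)) := by
  obtain ⟨s, hs, hpos⟩ := h.exists_sign
  obtain ⟨c, hc, hd⟩ := h.exists_eq_rpow hs hpos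
  have hs0 : s ≠ 0 := fun h0 => by simp [h0] at hs
  have hsi : s⁻¹ = s := inv_eq_of_mul_eq_one_left hs
  -- The choice e₂ = √(e₁/c) makes the factor e₂²c/e₁ equal to 1; e₃ = s and u₀ = -s u_∞ bring u_∞
  -- to 0 and I to the positive side. The time change e₁, t₀ stays free for normalising the flux.
  have h₂ : 0 < Real.sqrt (e₁ / c) := Real.sqrt_pos.2 (div_pos h₁ hc)
  have hsq : Real.sqrt (e₁ / c) ^ 2 = e₁ / c := Real.sq_sqrt (div_pos h₁ hc).le
  refine ⟨B.transform e₁ (Real.sqrt (e₁ / c)) s t₀ (-(s * B.uInf)) h₁ h₂ hs0,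
    B.equivalent_transform _ _ _ _ _ _ _ _, ⟨fun v hv => ?_, fun v hv => ?_, ?_⟩,
    Real.sqrt (e₁ / c) * s / e₁, by positivity, fun t ht => ⟨?_, rfl⟩⟩
  · have h3 := hpos _ hv
    rw [hsi] at h3
    rw [mem_Ioi]
    linear_combination h3 + (v + s * B.uInf) * hs
  · change _ / e₁ * B.d _ = _
    rw [hd _ hv, hsq, hsi]
    have : s * (s * (v - -(s * B.uInf)) - B.uInf) = v := by
      linear_combination (v + s * B.uInf) * hs
    rw [this]
    field_simp
  · change s * B.uInf + -(s * B.uInf) = 0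
    ring
  · change e₁ * B.τ + t₀ < t at ht
    rw [inv_mul_eq_div, lt_div_iff₀ h₁]
    linarith

end HeatBVP

/-! ### Fluxes as solutions of first order equations -/

namespace HeatBVP

/-- The vector field `(α t + β) ∂_t + μ q ∂_q` is tangent to the graph of the flux. -/
def Problem.FluxODE (B : Problem) (α β μ : ℝ) : Prop :=
  ∀ t, B.τ < t → (α * t + β) * deriv B.q t = μ * B.q t

/-- The flux is a nonzero multiple of a power of a shifted time. -/
def Problem.IsShiftedPowerFlux (B : Problem) (p : ℝ) : Prop :=
  ¬ B.HasZeroFlux ∧ ∃ b, B.FluxODE 1 b p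

/-- The flux is a nonzero multiple of an exponential whose exponent has the sign of `s`. -/
def Problem.IsRescaledExpFlux (B : Problem) (s : ℝ) : Prop :=
  ¬ B.HasZeroFlux ∧ ∃ m, 0 < m ∧ B.FluxODE 0 m s

variable {B B' : Problem} {α β μ α' β' μ' p s : ℝ}

theorem Problem.hasDerivAt_q (B : Problem) {t : ℝ} (ht : B.τ < t) :
    HasDerivAt B.q (deriv B.q t) t :=
  (diffAt (B.q_smooth.contDiffAt (Ioi_mem_nhds ht))).hasDerivAt

/-- Eliminating q' between the two equations leaves an affine function of t times q. Near a time
where q ≠ 0 this affine function vanishes identically, so both its coefficients are zero. -/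
theorem Problem.FluxODE.proportional (h0 : ¬ B.HasZeroFlux) (h : B.FluxODE α β μ)
    (h' : B.FluxODE α' β' μ') : α' * μ = α * μ' ∧ β' * μ = β * μ' := by
  unfold Problem.HasZeroFlux at h0
  push Not at h0
  obtain ⟨t₀, ht₀, hq⟩ := h0
  have ev : ∀ᶠ t in 𝓝 t₀, (α' * μ - α * μ') * t + (β' * μ - β * μ') = 0 := by
    filter_upwards [Ioi_mem_nhds ht₀, (B.hasDerivAt_q ht₀).continuousAt.eventually_ne hq]
      with t ht hqt
    refine mul_right_cancel₀ hqt ?_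
    linear_combination (α * t + β) * h' t ht - (α' * t + β') * h t ht
  have e0 := ev.self_of_nhds
  have d : HasDerivAt (fun t => (α' * μ - α * μ') * t + (β' * μ - β * μ')) (α' * μ - α * μ') t₀ :=
    (((hasDerivAt_id t₀).const_mul _).add_const _).congr_deriv (mul_one _)
  have ev' : (fun t => (α' * μ - α * μ') * t + (β' * μ - β * μ')) =ᶠ[𝓝 t₀] fun _ => 0 := ev
  have e1 := (d.congr_of_eventuallyEq ev'.symm).unique (hasDerivAt_const t₀ 0)
  rw [e1] at e0
  constructor <;> linarith

theorem Problem.hasConstFlux_iff : B.HasConstFlux ↔ ¬ B.HasZeroFlux ∧ B.FluxODE 0 1 0 := by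
  constructor
  · rintro ⟨q₀, hq₀, h⟩
    refine ⟨fun h0 => hq₀ ?_, fun t ht => ?_⟩
    · rw [← h (B.τ + 1) (by linarith), h0 _ (by linarith)]
    · have : B.q =ᶠ[𝓝 t] fun _ => q₀ := by
        filter_upwards [Ioi_mem_nhds ht] with s hs using h s hs
      rw [this.deriv_eq]; simp
  · rintro ⟨h0, h⟩
    have hc : ∀ t ∈ Ioi B.τ, B.q t = B.q (B.τ + 1) := fun t ht =>
      eq_of_hasDerivAt_zero isOpen_Ioi isPreconnected_Ioi (fun v hv => by
        have := h v hv
        rw [zero_mul, zero_mul, zero_add, one_mul] at this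
        exact (B.hasDerivAt_q hv).congr_deriv this) ht (by simp)
    refine ⟨B.q (B.τ + 1), fun hz => h0 fun t ht => ?_, hc⟩
    rw [hc t ht, hz]

theorem Equivalent.hasZeroFlux (hB : Equivalent B B') (h : B.HasZeroFlux) : B'.HasZeroFlux := by
  obtain ⟨e₁, e₂, e₃, t₀, u₀, h1, h2, h3, hτ, -, -, hq, -⟩ := hB
  intro t ht
  have e : e₁ * ((t - t₀) / e₁) + t₀ = t := by field_simp; ring
  have ht' := (hτ ((t - t₀) / e₁)).1 (by rwa [e])
  rw [← e, hq _ ht', h _ ht', mul_zero]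

/-- Multiplying q by a constant changes nothing, and the time change ct + t₀ alters only β. Since c
> 0, the sign of μ/β is kept when α = 0. -/
theorem Equivalent.fluxODE (hB : Equivalent B B') :
    ∃ c, 0 < c ∧ ∃ t₀, ∀ α β μ, B.FluxODE α β μ → B'.FluxODE α (c * β - α * t₀) μ := by
  obtain ⟨e₁, e₂, e₃, t₀, u₀, h1, h2, h3, hτ, -, -, hq, -⟩ := hB.exists_pos
  refine ⟨e₁, h1, t₀, fun α β μ h t ht => ?_⟩
  obtain ⟨s, rfl⟩ : ∃ s, t = e₁ * s + t₀ := ⟨(t - t₀) / e₁, by field_simp; ring⟩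
  have hs := (hτ s).1 ht
  have d1 : HasDerivAt (fun s => B'.q (e₁ * s + t₀)) (deriv B'.q (e₁ * s + t₀) * e₁) s := by
    have h : HasDerivAt (fun s => e₁ * s + t₀) e₁ s :=
      (((hasDerivAt_id s).const_mul e₁).add_const t₀).congr_deriv (mul_one _)
    exact HasDerivAt.comp (h₂ := B'.q) s (B'.hasDerivAt_q ht) h
  have d2 := (B.hasDerivAt_q hs).const_mul (e₂ * e₃ / e₁)
  have e : (fun s => B'.q (e₁ * s + t₀)) =ᶠ[𝓝 s] fun s => e₂ * e₃ / e₁ * B.q s := by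
    filter_upwards [Ioi_mem_nhds hs] with w hw using hq w hw
  have h4 := d1.unique (d2.congr_of_eventuallyEq e)
  rw [hq s hs]
  linear_combination (α * s + β) * h4 + e₂ * e₃ / e₁ * h s hs

theorem Equivalent.not_hasZeroFlux (hB : Equivalent B B') (h : ¬ B.HasZeroFlux) :
    ¬ B'.HasZeroFlux := fun h' => h (hB.symm.hasZeroFlux h')

theorem Equivalent.hasConstFlux (hB : Equivalent B B') (h : B.HasConstFlux) : B'.HasConstFlux := by
  obtain ⟨h0, h⟩ := Problem.hasConstFlux_iff.1 h
  obtain ⟨c, hc, t₀, H⟩ := hB.fluxODE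
  refine Problem.hasConstFlux_iff.2 ⟨hB.not_hasZeroFlux h0, fun t ht => ?_⟩
  have := H _ _ _ h t ht
  refine mul_left_cancel₀ hc.ne' ?_
  linear_combination this

theorem Equivalent.isShiftedPowerFlux (hB : Equivalent B B') (h : B.IsShiftedPowerFlux p) :
    B'.IsShiftedPowerFlux p := by
  obtain ⟨c, hc, t₀, H⟩ := hB.fluxODE
  exact ⟨hB.not_hasZeroFlux h.1, _, H _ _ _ h.2.choose_spec⟩

theorem Equivalent.isRescaledExpFlux (hB : Equivalent B B') (h : B.IsRescaledExpFlux s) :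
    B'.IsRescaledExpFlux s := by
  obtain ⟨c, hc, t₀, H⟩ := hB.fluxODE
  obtain ⟨h0, m, hm, h⟩ := h
  refine ⟨hB.not_hasZeroFlux h0, c * m, mul_pos hc hm, ?_⟩
  simpa using H _ _ _ h

theorem Problem.HasPowerFlux.not_hasZeroFlux_and (h : B.HasPowerFlux p) :
    ¬ B.HasZeroFlux ∧ ∀ t, B.τ < t → 0 < t → t * deriv B.q t = p * B.q t := by
  obtain ⟨q₀, hq₀, h⟩ := h
  constructor
  · intro h0
    have h1 : B.τ < max B.τ 0 + 1 := (le_max_left _ _).trans_lt (lt_add_one _)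
    have h2 : 0 < max B.τ 0 + 1 := (le_max_right _ _).trans_lt (lt_add_one _)
    have := h _ h1
    rw [h0 _ h1] at this
    exact mul_ne_zero hq₀ (Real.rpow_pos_of_pos h2 p).ne' this.symm
  · intro t ht htp
    have : B.q =ᶠ[𝓝 t] fun s => q₀ * s ^ p := by
      filter_upwards [Ioi_mem_nhds ht] with s hs using h s hs
    rw [this.deriv_eq, deriv_const_mul_field, Real.deriv_rpow_const, h t ht, Real.rpow_sub htp,
      Real.rpow_one]
    field_simp

/-- The initial time may be negative. For t < 0 the real power is cos(pπ)(-t)^p, which satisfies the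
same equation; at t = 0 both sides vanish, since 0^p = 0 for p ≠ 0. -/
theorem Problem.HasPowerFlux.fluxODE (h : B.HasPowerFlux p) : B.FluxODE 1 0 p := by
  obtain ⟨q₀, hq₀, h2⟩ := h
  obtain ⟨h0, h1⟩ := Problem.HasPowerFlux.not_hasZeroFlux_and ⟨q₀, hq₀, h2⟩
  intro t ht
  rw [one_mul, add_zero]
  rcases lt_trichotomy t 0 with h3 | h3 | h3
  · have : B.q =ᶠ[𝓝 t] fun s => q₀ * Real.cos (p * Real.pi) * (-s) ^ p := by
      filter_upwards [Ioi_mem_nhds ht, Iio_mem_nhds h3] with s hs hs0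
      rw [h2 s hs, Real.rpow_def_of_neg hs0, Real.rpow_def_of_pos (neg_pos.2 hs0), Real.log_neg_eq_log]
      ring
    have d : HasDerivAt (fun s : ℝ => (-s) ^ p) (-1 * p * (-t) ^ (p - 1)) t :=
      (hasDerivAt_neg t).rpow_const (Or.inl (neg_pos.2 h3).ne')
    rw [this.deriv_eq, deriv_const_mul_field, d.deriv, this.self_of_nhds,
      Real.rpow_sub (neg_pos.2 h3), Real.rpow_one]
    have := h3.ne
    field_simp
  · subst h3
    rcases eq_or_ne p 0 with rfl | hp
    · simp
    · rw [h2 0 ht, Real.zero_rpow hp]; simp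
  · exact h1 t ht h3

theorem Problem.HasPowerFlux.isShiftedPowerFlux (h : B.HasPowerFlux p) :
    B.IsShiftedPowerFlux p :=
  ⟨h.not_hasZeroFlux_and.1, 0, h.fluxODE⟩

theorem Problem.HasExpFlux.fluxODE (h : B.HasExpFlux s) : B.FluxODE 0 1 s := by
  obtain ⟨q₀, hq₀, h⟩ := h
  intro t ht
  have e : B.q =ᶠ[𝓝 t] fun r => q₀ * Real.exp (s * r) := by
    filter_upwards [Ioi_mem_nhds ht] with r hr using h r hr
  have d : HasDerivAt (fun r => Real.exp (s * r)) (Real.exp (s * t) * s) t :=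
    (((hasDerivAt_id t).const_mul s).congr_deriv (mul_one s)).exp
  rw [e.deriv_eq, deriv_const_mul_field, d.deriv, h t ht]
  ring

theorem Problem.HasExpFlux.isRescaledExpFlux (h : B.HasExpFlux s) : B.IsRescaledExpFlux s := by
  refine ⟨fun h0 => ?_, 1, one_pos, h.fluxODE⟩
  obtain ⟨q₀, hq₀, h⟩ := h
  have h1 : B.τ < B.τ + 1 := lt_add_one _
  have := h _ h1
  rw [h0 _ h1] at this
  exact mul_ne_zero hq₀ (Real.exp_pos _).ne' this.symm

/-- Smooth solutions of `(t - t₀) q' = p q` on a half-line that contains `t₀` in its interior. -/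
theorem eq_pow_of_euler {τ t₀ : ℝ} (ht₀ : τ < t₀) (n : ℕ) : ∀ (q : ℝ → ℝ) (p : ℝ), p < n →
    ContDiffOn ℝ ∞ q (Ioi τ) → (∀ t, τ < t → (t - t₀) * deriv q t = p * q t) →
    (∀ t, τ < t → q t = 0) ∨ ∃ m : ℕ, p = m ∧ ∃ c, ∀ t, τ < t → q t = c * (t - t₀) ^ m := by
  have hder {q : ℝ → ℝ} (hs : ContDiffOn ℝ ∞ q (Ioi τ)) {t : ℝ} (ht : τ < t) :
      HasDerivAt q (deriv q t) t := (diffAt (hs.contDiffAt (Ioi_mem_nhds ht))).hasDerivAt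
  induction n with
  | zero =>
    intro q p hp hs h
    left
    rw [Nat.cast_zero] at hp
    have hd : ∀ t, τ < t → HasDerivAt (fun t => q t ^ 2) (2 * q t * deriv q t) t := fun t ht =>
      ((hder hs ht).fun_pow 2).congr_deriv (by simp)
    have h0 : q t₀ = 0 := by
      have := h t₀ ht₀
      rw [sub_self, zero_mul] at this
      exact (mul_eq_zero.1 this.symm).resolve_left hp.ne
    -- For p < 0 one has (t - t₀)(q²)' = 2pq² ≤ 0, so q² increases before t₀ and decreases after it,
    -- while q(t₀) = 0. Hence q = 0.
    have sgn : ∀ t, τ < t → (t - t₀) * (2 * q t * deriv q t) ≤ 0 := fun t ht => by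
      have h1 : (t - t₀) * (2 * q t * deriv q t) = 2 * p * q t ^ 2 := by
        linear_combination 2 * q t * h t ht
      rw [h1]
      nlinarith [sq_nonneg (q t)]
    intro t ht
    have hle : q t ^ 2 ≤ q t₀ ^ 2 := by
      rcases le_total t t₀ with hle | hle
      · refine monotoneOn_of_deriv_nonneg (D := Icc t t₀) (f := fun t => q t ^ 2) (convex_Icc _ _)
          (fun v hv => (hd v (ht.trans_le hv.1)).continuousAt.continuousWithinAt)
          (fun v hv => ?_) (fun v hv => ?_) (left_mem_Icc.2 hle) (right_mem_Icc.2 hle) hle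
        · rw [interior_Icc] at hv
          exact (hd v (ht.trans hv.1)).differentiableAt.differentiableWithinAt
        · rw [interior_Icc] at hv
          rw [(hd v (ht.trans hv.1)).deriv]
          have := sgn v (ht.trans hv.1)
          have h2 : v - t₀ < 0 := sub_neg.2 hv.2
          nlinarith
      · refine antitoneOn_of_deriv_nonpos (D := Icc t₀ t) (f := fun t => q t ^ 2) (convex_Icc _ _)
          (fun v hv => (hd v (ht₀.trans_le hv.1)).continuousAt.continuousWithinAt)
          (fun v hv => ?_) (fun v hv => ?_) (left_mem_Icc.2 hle) (right_mem_Icc.2 hle) hle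
        · rw [interior_Icc] at hv
          exact (hd v (ht₀.trans hv.1)).differentiableAt.differentiableWithinAt
        · rw [interior_Icc] at hv
          rw [(hd v (ht₀.trans hv.1)).deriv]
          have := sgn v (ht₀.trans hv.1)
          have h2 : 0 < v - t₀ := sub_pos.2 hv.1
          nlinarith
    rw [h0] at hle
    exact pow_eq_zero_iff (two_ne_zero) |>.1 (le_antisymm (by simpa using hle) (sq_nonneg _))
  | succ n ih =>
    intro q p hp hs h
    have hs' : ContDiffOn ℝ ∞ (deriv q) (Ioi τ) :=
      ((contDiffOn_infty_iff_deriv_of_isOpen isOpen_Ioi).1 hs).2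
    -- Differentiation lowers the exponent: q' solves the equation with p - 1. The induction is on a
    -- natural number exceeding p.
    have h' : ∀ t, τ < t → (t - t₀) * deriv (deriv q) t = (p - 1) * deriv q t := by
      intro t ht
      have d1 := ((hasDerivAt_id t).sub_const t₀).fun_mul (hder hs' ht)
      have d2 := (hder hs ht).const_mul p
      have e : (fun t => (id t - t₀) * deriv q t) =ᶠ[𝓝 t] fun t => p * q t := by
        filter_upwards [Ioi_mem_nhds ht] with v hv using h v hv
      have := d1.unique (d2.congr_of_eventuallyEq e)
      simp only [id, one_mul] at this
      linarith
    push_cast at hp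
    rcases ih (deriv q) (p - 1) (by linarith) hs' h' with h1 | ⟨m, hm, c, h1⟩
    · rcases eq_or_ne p 0 with rfl | hp0
      · right
        refine ⟨0, by simp, q t₀, fun t ht => ?_⟩
        rw [pow_zero, mul_one]
        exact eq_of_hasDerivAt_zero isOpen_Ioi isPreconnected_Ioi
          (fun v hv => (hder hs hv).congr_deriv (h1 v hv)) ht ht₀
      · left
        intro t ht
        have := h t ht
        rw [h1 t ht, mul_zero] at this
        exact (mul_eq_zero.1 this.symm).resolve_left hp0
    · right
      have hpm : p = m + 1 := by linarith
      have hp0 : p ≠ 0 := by rw [hpm]; positivity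
      refine ⟨m + 1, by rw [hpm]; push_cast; rfl, c / p, fun t ht => ?_⟩
      have := h t ht
      rw [h1 t ht] at this
      refine mul_left_cancel₀ hp0 ?_
      rw [← this]
      field_simp
      ring

/-- If the singular time -b lies inside the half-line, smoothness forces p to be a natural number
and the power makes sense on both sides of -b. Otherwise t + b > 0 throughout and an integrating
factor solves the equation. -/
theorem Problem.IsShiftedPowerFlux.exists_eq (h : B.IsShiftedPowerFlux p) :
    ∃ t₀ c, c ≠ 0 ∧ ∀ t, B.τ < t → B.q t = c * (t - t₀) ^ p := by
  obtain ⟨h0, b, h⟩ := h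
  have h1 : ∀ t, B.τ < t → (t - -b) * deriv B.q t = p * B.q t := fun t ht => by
    rw [← h t ht]; ring
  have hc {c : ℝ} (e : ∀ t, B.τ < t → B.q t = c * (t - -b) ^ p) : c ≠ 0 := by
    rintro rfl
    exact h0 fun t ht => by rw [e t ht, zero_mul]
  refine ⟨-b, ?_⟩
  rcases lt_or_ge B.τ (-b) with hb | hb
  · obtain ⟨n, hn⟩ := exists_nat_gt p
    rcases eq_pow_of_euler hb n B.q p hn B.q_smooth h1 with h2 | ⟨m, rfl, c, h2⟩
    · exact absurd h2 h0
    · have e : ∀ t, B.τ < t → B.q t = c * (t - -b) ^ (m : ℝ) := fun t ht => by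
        rw [h2 t ht, Real.rpow_natCast]
      exact ⟨c, hc e, e⟩
  · have hd : ∀ t ∈ Ioi B.τ, HasDerivAt (fun t => B.q t * (t - -b) ^ (-p)) 0 t := by
      intro t ht
      have hp : 0 < t - -b := sub_pos.2 (hb.trans_lt ht)
      have d : HasDerivAt (fun t => t - -b) 1 t := (hasDerivAt_id t).sub_const _
      refine ((B.hasDerivAt_q ht).fun_mul (d.rpow_const (p := -p) (Or.inl hp.ne'))).congr_deriv ?_
      rw [Real.rpow_sub hp, Real.rpow_one]
      have := h1 t ht
      field_simp
      linear_combination (t - -b) ^ (-p) * this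
    have e : ∀ t, B.τ < t →
        B.q t = (B.q (B.τ + 1) * (B.τ + 1 - -b) ^ (-p)) * (t - -b) ^ p := fun t ht => by
      have hp : 0 < t - -b := sub_pos.2 (hb.trans_lt ht)
      have e1 := eq_of_hasDerivAt_zero isOpen_Ioi isPreconnected_Ioi hd (w := B.τ + 1) ht (by simp)
      rw [← e1, mul_assoc, ← Real.rpow_add hp]
      simp
    exact ⟨_, hc e, e⟩

theorem Problem.IsRescaledExpFlux.exists_eq (h : B.IsRescaledExpFlux s) :
    ∃ m c, 0 < m ∧ c ≠ 0 ∧ ∀ t, B.τ < t → B.q t = c * Real.exp (s * (m * t)) := by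
  obtain ⟨h0, m, hm, h⟩ := h
  have hd : ∀ t ∈ Ioi B.τ, HasDerivAt (fun t => B.q t * Real.exp (-(s * (m⁻¹ * t)))) 0 t := by
    intro t ht
    have d : HasDerivAt (fun t => -(s * (m⁻¹ * t))) (-(s * m⁻¹)) t :=
      ((((hasDerivAt_id t).const_mul m⁻¹).const_mul s).fun_neg).congr_deriv (by simp)
    refine ((B.hasDerivAt_q ht).fun_mul d.exp).congr_deriv ?_
    have := h t ht
    field_simp
    linear_combination Real.exp (-(s * t / m)) * this
  refine ⟨m⁻¹, B.q (B.τ + 1) * Real.exp (-(s * (m⁻¹ * (B.τ + 1)))), inv_pos.2 hm, fun hc => h0 ?_, ?_⟩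
  all_goals
    have e : ∀ t, B.τ < t → B.q t = (B.q (B.τ + 1) * Real.exp (-(s * (m⁻¹ * (B.τ + 1))))) *
        Real.exp (s * (m⁻¹ * t)) := fun t ht => by
      have e1 := eq_of_hasDerivAt_zero isOpen_Ioi isPreconnected_Ioi hd (w := B.τ + 1) ht (by simp)
      rw [← e1, mul_assoc, ← Real.exp_add]
      simp
  · intro t ht
    rw [e t ht, hc, zero_mul]
  · exact e

end HeatBVP

/-! ### Rows of the table through invariant properties -/

namespace HeatBVP

variable {B B' : Problem} {r r' : Row} {k p s : ℝ}

/-- The properties, invariant under equivalence transformations, that characterise the problems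
reducible to a row. -/
def Row.Characterises : Row → Problem → Prop
  | case1, B => B.IsShiftedPowerFlux (-1 / 2) ∧ ¬ B.PowerAt (-2)
  | case2, B => B.HasConstFlux ∧ ∀ k, ¬ B.PowerAt k
  | case3, B => B.HasZeroFlux ∧ ∀ k, ¬ B.PowerAt k
  | case4 k p, B => k ≠ -2 ∧ p ≠ -1 / 2 ∧ p ≠ 0 ∧ B.PowerAt k ∧ B.IsShiftedPowerFlux p
  | case5 k s, B => k ≠ -2 ∧ (s = 1 ∨ s = -1) ∧ B.PowerAt k ∧ B.IsRescaledExpFlux s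
  | case6 k, B => B.PowerAt k ∧ B.HasConstFlux
  | case7 k, B => B.PowerAt k ∧ B.HasZeroFlux
  | case8, B => B.PowerAt (-2) ∧ ¬ B.HasConstFlux ∧ ¬ B.HasZeroFlux ∧
      ¬ B.IsShiftedPowerFlux (-1 / 2)
  | case9, B => B.PowerAt (-2) ∧ B.IsShiftedPowerFlux (-1 / 2)

theorem Equivalent.powerAt_iff (h : Equivalent B B') : B.PowerAt k ↔ B'.PowerAt k :=
  ⟨.of_equivalent h, .of_equivalent h.symm⟩

theorem Equivalent.hasZeroFlux_iff (h : Equivalent B B') : B.HasZeroFlux ↔ B'.HasZeroFlux :=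
  ⟨h.hasZeroFlux, h.symm.hasZeroFlux⟩

theorem Equivalent.hasConstFlux_iff (h : Equivalent B B') : B.HasConstFlux ↔ B'.HasConstFlux :=
  ⟨h.hasConstFlux, h.symm.hasConstFlux⟩

theorem Equivalent.isShiftedPowerFlux_iff (h : Equivalent B B') :
    B.IsShiftedPowerFlux p ↔ B'.IsShiftedPowerFlux p :=
  ⟨h.isShiftedPowerFlux, h.symm.isShiftedPowerFlux⟩

theorem Equivalent.isRescaledExpFlux_iff (h : Equivalent B B') :
    B.IsRescaledExpFlux s ↔ B'.IsRescaledExpFlux s :=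
  ⟨h.isRescaledExpFlux, h.symm.isRescaledExpFlux⟩

theorem Row.Characterises.of_equivalent (h : Equivalent B B') (hr : r.Characterises B) :
    r.Characterises B' := by
  cases r <;>
  simpa only [Characterises, ← h.powerAt_iff, ← h.hasZeroFlux_iff, ← h.hasConstFlux_iff,
    ← h.isShiftedPowerFlux_iff, ← h.isRescaledExpFlux_iff] using hr

theorem Problem.IsShiftedPowerFlux.unique {p' : ℝ} (h : B.IsShiftedPowerFlux p)
    (h' : B.IsShiftedPowerFlux p') : p = p' := by
  obtain ⟨h0, b, h⟩ := h
  obtain ⟨-, b', h'⟩ := h'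
  linarith [(h.proportional h0 h').1]

theorem Problem.IsShiftedPowerFlux.not_hasConstFlux (h : B.IsShiftedPowerFlux p) (hp : p ≠ 0) :
    ¬ B.HasConstFlux := fun hc => by
  obtain ⟨h0, b, h⟩ := h
  exact hp (by linarith [(h.proportional h0 (Problem.hasConstFlux_iff.1 hc).2).2])

theorem Problem.IsShiftedPowerFlux.not_isRescaledExpFlux (h : B.IsShiftedPowerFlux p) (hs : s ≠ 0) :
    ¬ B.IsRescaledExpFlux s := fun hc => by
  obtain ⟨h0, b, h⟩ := h
  obtain ⟨-, m, hm, h'⟩ := hc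
  exact hs (by linarith [(h.proportional h0 h').1])

theorem Problem.IsRescaledExpFlux.not_hasConstFlux (h : B.IsRescaledExpFlux s) (hs : s ≠ 0) :
    ¬ B.HasConstFlux := fun hc => by
  obtain ⟨h0, m, hm, h⟩ := h
  exact hs (by linarith [(h.proportional h0 (Problem.hasConstFlux_iff.1 hc).2).2])

theorem Problem.HasConstFlux.not_hasZeroFlux (h : B.HasConstFlux) : ¬ B.HasZeroFlux :=
  (Problem.hasConstFlux_iff.1 h).1

theorem Problem.IsRescaledExpFlux.unique {s' : ℝ} (hs : s = 1 ∨ s = -1) (hs' : s' = 1 ∨ s' = -1)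
    (h : B.IsRescaledExpFlux s) (h' : B.IsRescaledExpFlux s') : s = s' := by
  obtain ⟨h0, m, hm, h⟩ := h
  obtain ⟨-, m', hm', h'⟩ := h'
  have := (h.proportional h0 h').2
  rcases hs with rfl | rfl <;> rcases hs' with rfl | rfl <;> first | rfl | (exfalso; linarith)

/-- The exponent k, the exponent p and the sign s are each determined by the problem, and the zero,
constant, nonconstant power and exponential fluxes exclude one another. Every pair of rows then
either contradicts itself or has equal parameters. -/
theorem Row.Characterises.unique (h : r.Characterises B) (h' : r'.Characterises B) : r = r' := by
  have n1 : (-1 / 2 : ℝ) ≠ 0 := by norm_num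
  have sign_ne {s : ℝ} (hs : s = 1 ∨ s = -1) : s ≠ 0 := by rcases hs with rfl | rfl <;> norm_num
  have pow_const : ∀ p, B.IsShiftedPowerFlux p → p ≠ 0 → ¬ B.HasConstFlux :=
    fun p h hp => h.not_hasConstFlux hp
  have pow_zero : ∀ p, B.IsShiftedPowerFlux p → ¬ B.HasZeroFlux := fun p h => h.1
  have pow_exp : ∀ p s, B.IsShiftedPowerFlux p → (s = 1 ∨ s = -1) → ¬ B.IsRescaledExpFlux s :=
    fun p s h hs => h.not_isRescaledExpFlux (sign_ne hs)
  have exp_const : ∀ s, B.IsRescaledExpFlux s → (s = 1 ∨ s = -1) → ¬ B.HasConstFlux :=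
    fun s h hs => h.not_hasConstFlux (sign_ne hs)
  have exp_zero : ∀ s, B.IsRescaledExpFlux s → ¬ B.HasZeroFlux := fun s h => h.1
  have key2 := @Problem.HasConstFlux.not_hasZeroFlux B
  have uk := @Problem.PowerAt.unique B
  have up := @Problem.IsShiftedPowerFlux.unique B
  have us := @Problem.IsRescaledExpFlux.unique B
  cases r <;> cases r' <;> simp only [Characterises] at h h' <;> grind

/-- Reduction to the normal forms of the table. -/
theorem Row.Characterises.exists_matches (h : r.Characterises B) :
    ∃ B', Equivalent B B' ∧ r.Matches B' := by
  have hpow {k p : ℝ} (hk : B.PowerAt k) (hp : B.IsShiftedPowerFlux p) :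
      ∃ B', Equivalent B B' ∧ B'.IsPower k ∧ B'.HasPowerFlux p := by
    obtain ⟨t₀, c, hc, hq⟩ := hp.exists_eq
    obtain ⟨B', hB, h1, C, hC, h2⟩ := hk.normalize one_pos (-t₀)
    refine ⟨B', hB, h1, C * c, mul_ne_zero hC hc, fun t ht => ?_⟩
    rw [(h2 t ht).2, hq _ (h2 t ht).1, mul_assoc]
    simp
  cases r with
  | case1 =>
    obtain ⟨t₀, c, hc, hq⟩ := h.1.exists_eq
    refine ⟨B.transform 1 1 1 (-t₀) 0 one_pos one_pos one_ne_zero,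
      B.equivalent_transform _ _ _ _ _ _ _ _, c, hc, fun t ht => ?_⟩
    change 1 * B.τ + -t₀ < t at ht
    change 1 * 1 / 1 * B.q (1⁻¹ * (t - -t₀)) = _
    rw [hq _ (by linarith)]
    simp
  | case2 => exact ⟨B, .refl B, h.1⟩
  | case3 => exact ⟨B, .refl B, h.1⟩
  | case4 k p =>
    obtain ⟨h1, h2, h3, h4, h5⟩ := h
    obtain ⟨B', hB, h6⟩ := hpow h4 h5
    exact ⟨B', hB, h1, h2, h3, h6⟩
  | case5 k s =>
    obtain ⟨h1, h2, h3, h4⟩ := h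
    obtain ⟨m, c, hm, hc, hq⟩ := h4.exists_eq
    obtain ⟨B', hB, h5, C, hC, h6⟩ := h3.normalize hm 0
    refine ⟨B', hB, h1, h2, h5, C * c, mul_ne_zero hC hc, fun t ht => ?_⟩
    rw [(h6 t ht).2, hq _ (h6 t ht).1, mul_assoc, sub_zero, mul_inv_cancel_left₀ hm.ne']
  | case6 k =>
    obtain ⟨B', hB, h5, -⟩ := h.1.normalize one_pos 0
    exact ⟨B', hB, h5, hB.hasConstFlux h.2⟩
  | case7 k =>
    obtain ⟨B', hB, h5, -⟩ := h.1.normalize one_pos 0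
    exact ⟨B', hB, h5, hB.hasZeroFlux h.2⟩
  | case8 =>
    obtain ⟨B', hB, h5, -⟩ := h.1.normalize one_pos 0
    exact ⟨B', hB, h5⟩
  | case9 => exact hpow h.1 h.2

theorem Row.Characterises.reducesTo (h : r.Characterises B) : B.ReducesTo r := h.exists_matches

/-- The exclusions of later rows become negations of invariant properties: a problem having such a
property would be reducible to the excluded row. -/
theorem Row.Mem.characterises (h : r.Mem B) : r.Characterises B := by
  cases r with
  | case1 =>
    have h1 := Problem.HasPowerFlux.isShiftedPowerFlux h.1
    exact ⟨h1, fun hk => h.2 (Row.Characterises.reducesTo (r := case9) ⟨hk, h1⟩)⟩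
  | case2 =>
    exact ⟨h.1, fun k hk => h.2 ⟨k, Row.Characterises.reducesTo (r := case6 k) ⟨hk, h.1⟩⟩⟩
  | case3 =>
    exact ⟨h.1, fun k hk => h.2 ⟨k, Row.Characterises.reducesTo (r := case7 k) ⟨hk, h.1⟩⟩⟩
  | case4 k p =>
    obtain ⟨h1, h2, h3, h4, h5⟩ := h
    exact ⟨h1, h2, h3, h4.powerAt, h5.isShiftedPowerFlux⟩
  | case5 k s =>
    obtain ⟨h1, h2, h3, h4⟩ := h
    exact ⟨h1, h2, h3.powerAt, h4.isRescaledExpFlux⟩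
  | case6 k => exact ⟨h.1.powerAt, h.2⟩
  | case7 k => exact ⟨h.1.powerAt, h.2⟩
  | case8 =>
    obtain ⟨h1, h2, h3, h4⟩ := h
    have hk := Problem.IsPower.powerAt h1
    exact ⟨hk, fun h => h2 (Row.Characterises.reducesTo (r := case6 (-2)) ⟨hk, h⟩),
      fun h => h3 (Row.Characterises.reducesTo (r := case7 (-2)) ⟨hk, h⟩),
      fun h => h4 (Row.Characterises.reducesTo (r := case9) ⟨hk, h⟩)⟩
  | case9 => exact ⟨h.1.powerAt, h.2.isShiftedPowerFlux⟩

/-- Were the problem reducible to an excluded row, it would have the characteristic properties of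
both rows, which must then coincide. The excluded rows carry no exclusions of their own. -/
theorem Row.Matches.mem (h : r.Matches B) (hr : r.Characterises B) : r.Mem B := by
  have key {r₁ : Row} (h1 : B.ReducesTo r₁) (h2 : ∀ B', r₁.Matches B' → r₁.Mem B') : r = r₁ := by
    obtain ⟨B', hB, hm⟩ := h1
    exact hr.unique ((h2 B' hm).characterises.of_equivalent hB.symm)
  cases r with
  | case1 => exact ⟨h, fun h1 => by simpa using key h1 fun _ h => h⟩
  | case2 => exact ⟨h, fun ⟨k, h1⟩ => by simpa using key h1 fun _ h => h⟩
  | case3 => exact ⟨h, fun ⟨k, h1⟩ => by simpa using key h1 fun _ h => h⟩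
  | case8 =>
    exact ⟨h, fun h1 => by simpa using key h1 fun _ h => h,
      fun h1 => by simpa using key h1 fun _ h => h, fun h1 => by simpa using key h1 fun _ h => h⟩
  | case4 k p => exact h
  | case5 k s => exact h
  | case6 k => exact h
  | case7 k => exact h
  | case9 => exact h

theorem Row.Characterises.exists_mem (h : r.Characterises B) :
    ∃ B', Equivalent B B' ∧ r.Mem B' := by
  obtain ⟨B', hB, hm⟩ := h.exists_matches
  exact ⟨B', hB, hm.mem (h.of_equivalent hB)⟩

theorem Row.Mem.unique (h : r.Mem B) (h' : r'.Mem B') (hB : Equivalent B B') : r = r' :=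
  h.characterises.unique (h'.characterises.of_equivalent hB.symm)

/-- A symmetry that really scales the temperature is possible only for a power conductivity. -/
theorem IsSymmetry.powerAt {α β γ a : ℝ} (h : IsSymmetry B α β γ a) (ha : a ≠ 0) :
    B.PowerAt ((2 * γ - α) / a) := fun u hu => by
  have := h.1 u hu
  field_simp
  linarith

theorem IsSymmetry.eq_of_powerAt {α β γ a : ℝ} (h : IsSymmetry B α β γ a) (hk : B.PowerAt k) :
    a * k = 2 * γ - α := by
  obtain ⟨u, hu⟩ := B.nonempty_I
  refine mul_right_cancel₀ (B.d_pos u hu).ne' ?_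
  linear_combination h.1 u hu - a * hk u hu

theorem IsSymmetry.fluxODE {α β γ a : ℝ} (h : IsSymmetry B α β γ a) :
    B.FluxODE α β (a + γ - α) := h.2

theorem IsSymmetry.eq_of_a_eq_zero {α β γ : ℝ} (h : IsSymmetry B α β γ 0) : α = 2 * γ := by
  obtain ⟨u, hu⟩ := B.nonempty_I
  have := h.1 u hu
  rw [zero_mul, zero_mul] at this
  linarith [(mul_eq_zero.1 this.symm).resolve_right (B.d_pos u hu).ne']

/-- The classification of the fluxes by their infinitesimal symmetries. -/
theorem Problem.FluxODE.cases {α β μ : ℝ} (h : B.FluxODE α β μ) (h0 : ¬ B.HasZeroFlux)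
    (hc : ¬ B.HasConstFlux) : (α ≠ 0 ∧ B.IsShiftedPowerFlux (μ / α) ∧ μ ≠ 0) ∨
      (α = 0 ∧ β ≠ 0 ∧ ∃ s : ℝ, (s = 1 ∨ s = -1) ∧ B.IsRescaledExpFlux s) ∨
      (α = 0 ∧ β = 0 ∧ μ = 0) := by
  -- From (t + b)q' = 0 the constancy of q is not immediate at t = -b; the explicit form of shifted
  -- powers, with exponent 0, covers that time too.
  have const_of {b : ℝ} (h1 : B.FluxODE 1 b 0) : B.HasConstFlux := by
    obtain ⟨t₀, c, hc, hq⟩ := Problem.IsShiftedPowerFlux.exists_eq ⟨h0, b, h1⟩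
    exact ⟨c, hc, fun t ht => by rw [hq t ht, Real.rpow_zero, mul_one]⟩
  rcases ne_or_eq α 0 with hα | rfl
  · have h1 : B.FluxODE 1 (β / α) (μ / α) := fun t ht => by
      have := h t ht
      field_simp
      linarith
    refine Or.inl ⟨hα, ⟨h0, _, h1⟩, ?_⟩
    rintro rfl
    exact hc (const_of (by simpa using h1))
  · refine Or.inr ?_
    rcases ne_or_eq β 0 with hβ | rfl
    · refine Or.inl ⟨rfl, hβ, ?_⟩
      have h1 : ∀ t, B.τ < t → β * deriv B.q t = μ * B.q t := fun t ht => by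
        have := h t ht
        rwa [zero_mul, zero_add] at this
      rcases lt_trichotomy (μ / β) 0 with hm | hm | hm
      -- The rate μ/β is negative; scaling the equation by -1/μ brings its right side to -q and
      -- leaves the positive coefficient -β/μ.
      · refine ⟨-1, Or.inr rfl, h0, -(β / μ), ?_, fun t ht => ?_⟩
        · rw [← inv_div, ← inv_neg, inv_pos]; linarith
        · have hμ : μ ≠ 0 := by rintro rfl; simp at hm
          have := h1 t ht
          field_simp
          linear_combination -this
      · have hμ : μ = 0 := (div_eq_zero_iff.1 hm).resolve_right hβ
        refine absurd (Problem.hasConstFlux_iff.2 ⟨h0, fun t ht => ?_⟩) hc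
        have := h1 t ht
        rw [hμ, zero_mul] at this
        rw [(mul_eq_zero.1 this).resolve_left hβ]; ring
      · refine ⟨1, Or.inl rfl, h0, β / μ, ?_, fun t ht => ?_⟩
        · rw [← inv_div, inv_pos]; exact hm
        · have hμ : μ ≠ 0 := by rintro rfl; simp at hm
          have := h1 t ht
          field_simp
          linear_combination this
    · refine Or.inr ⟨rfl, rfl, ?_⟩
      unfold Problem.HasZeroFlux at h0
      push Not at h0
      obtain ⟨t, ht, hq⟩ := h0
      have := h t ht
      simp only [zero_mul, add_zero] at this
      exact (mul_eq_zero.1 this.symm).resolve_right hq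

/-- A problem outside the table has no infinitesimal symmetries. -/
theorem IsSymmetry.eq_zero {α β γ a : ℝ} (h : IsSymmetry B α β γ a)
    (hr : ∀ r : Row, ¬ r.Characterises B) : α = 0 ∧ β = 0 ∧ γ = 0 ∧ a = 0 := by
  by_cases hk : ∃ k, B.PowerAt k
  · obtain ⟨k, hk⟩ := hk
    have h0 : ¬ B.HasZeroFlux := fun h => hr (.case7 k) ⟨hk, h⟩
    have hc : ¬ B.HasConstFlux := fun h => hr (.case6 k) ⟨hk, h⟩
    have hk2 : k ≠ -2 := by
      rintro rfl
      by_cases h1 : B.IsShiftedPowerFlux (-1 / 2)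
      · exact hr .case9 ⟨hk, h1⟩
      · exact hr .case8 ⟨hk, hc, h0, h1⟩
    have hak := h.eq_of_powerAt hk
    rcases h.fluxODE.cases h0 hc with ⟨hα, h1, hμ⟩ | ⟨-, -, s, hs, h1⟩ | ⟨hα, hβ, hμ⟩
    · exfalso
      by_cases hp : (a + γ - α) / α = -1 / 2
      · rw [hp] at h1
        exact hr .case1 ⟨h1, fun h2 => hk2 (hk.unique h2)⟩
      · exact hr (.case4 k ((a + γ - α) / α)) ⟨hk2, hp, div_ne_zero hμ hα, hk, h1⟩
    · exact absurd ⟨hk2, hs, hk, h1⟩ (hr (.case5 k s))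
    -- With α = 0 and μ = 0, the relations a + γ = 0 and ak = 2γ combine to a(k + 2) = 0. This is
    -- why k = -2 is special.
    · have ha : a * (k + 2) = 0 := by linarith
      have ha := (mul_eq_zero.1 ha).resolve_right fun h2 => hk2 (by linarith)
      refine ⟨hα, hβ, by linarith, ha⟩
  · have ha : a = 0 := by
      by_contra ha
      exact hk ⟨_, h.powerAt ha⟩
    push Not at hk
    subst ha
    have hγ := h.eq_of_a_eq_zero
    have h0 : ¬ B.HasZeroFlux := fun h => hr .case3 ⟨h, hk⟩
    have hc : ¬ B.HasConstFlux := fun h => hr .case2 ⟨h, hk⟩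
    rcases h.fluxODE.cases h0 hc with ⟨hα, h1, hμ⟩ | ⟨hα, hβ, s, hs, h1⟩ | ⟨hα, hβ, hμ⟩
    · exfalso
      -- Without temperature scaling 2γ = α, so the only possible power of time is -1/2.
      have : (0 + γ - α) / α = -1 / 2 := by
        rw [div_eq_iff hα]; linarith
      rw [this] at h1
      exact hr .case1 ⟨h1, hk _⟩
    · exfalso
      have hγ0 : γ = 0 := by linarith
      have h2 := h.fluxODE
      rw [hα, hγ0, sub_zero, add_zero] at h2
      refine hc (Problem.hasConstFlux_iff.2 ⟨h0, fun t ht => ?_⟩)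
      refine mul_left_cancel₀ hβ ?_
      linear_combination h2 t ht
    · exact ⟨hα, hβ, by linarith, rfl⟩

end HeatBVP

/-! ### Groups with prescribed generators and their maximality -/

namespace HeatBVP

/-- The base t may be negative because the initial time is arbitrary; both sides then acquire the
same factor cos(pπ). -/
theorem mul_rpow_of_pos {E : ℝ} (hE : 0 < E) (t p : ℝ) : (E * t) ^ p = E ^ p * t ^ p := by
  rcases lt_trichotomy t 0 with h | rfl | h
  · rw [Real.rpow_def_of_neg (mul_neg_of_pos_of_neg hE h), Real.rpow_def_of_neg h,
      Real.rpow_def_of_pos hE, Real.log_mul hE.ne' h.ne, add_mul, Real.exp_add]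
    ring
  · rcases eq_or_ne p 0 with rfl | hp
    · simp
    · simp [Real.zero_rpow hp]
  · exact Real.mul_rpow hE.le h.le

namespace AffineAction

variable {N : ℕ} {w A b Γ H : Fin N → ℝ}

/-- The group generated by the vector fields
`(A i t + b i) ∂_t + Γ i x ∂_x + H i u ∂_u`. -/
noncomputable def ofGenerators (w A b Γ H : Fin N → ℝ)
    (hA : ∀ i, w i = 0 ∨ (A i = 0 ∧ Γ i = 0 ∧ H i = 0))
    (hb : ∀ i, b i = 0 ∨ w i = 1 ∨ A = 0) : AffineAction N where
  w := w
  α ε := ∑ i, A i * ε i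
  β ε := ∑ i, b i * ε i
  γ ε := ∑ i, Γ i * ε i
  a ε := ∑ i, H i * ε i
  α_smooth := by fun_prop
  β_smooth := by fun_prop
  γ_smooth := by fun_prop
  a_smooth := by fun_prop
  -- A coordinate with nonzero weight contributes only a time shift, so the twist by the time
  -- scaling does not reach α, γ or a. In β the twist is exactly the factor of the shift, unless
  -- time is not scaled at all.
  α_mul δ ε := by
    rw [← Finset.sum_add_distrib]
    refine Finset.sum_congr rfl fun i _ => ?_
    rcases hA i with h | h <;> simp [h]; ring
  β_mul δ ε := by
    rw [Finset.mul_sum, ← Finset.sum_add_distrib]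
    refine Finset.sum_congr rfl fun i _ => ?_
    rcases hb i with h | h | h <;> simp [h] <;> ring
  γ_mul δ ε := by
    rw [← Finset.sum_add_distrib]
    refine Finset.sum_congr rfl fun i _ => ?_
    rcases hA i with h | h <;> simp [h]; ring
  a_mul δ ε := by
    rw [← Finset.sum_add_distrib]
    refine Finset.sum_congr rfl fun i _ => ?_
    rcases hA i with h | h <;> simp [h]; ring

variable {hA : ∀ i, w i = 0 ∨ (A i = 0 ∧ Γ i = 0 ∧ H i = 0)}
  {hb : ∀ i, b i = 0 ∨ w i = 1 ∨ A = 0} {B : Problem} {k : ℝ}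

/-- Invariance under scalings amounts to linear conditions on the generators, which are summed over
the coordinates and exponentiated: A + kH = 2Γ preserves u^k, and each kind of flux adds one
relation. The last alternative fixes time and the boundary flux, so it allows any q. -/
theorem ofGenerators_isInvariant
    (hd : (∃ k, B.IsPower k ∧ ∀ i, A i + k * H i = 2 * Γ i) ∨ ∀ i, H i = 0 ∧ A i = 2 * Γ i)
    (hq : B.HasZeroFlux ∨ (B.HasConstFlux ∧ ∀ i, A i = H i + Γ i) ∨
      (∃ p, B.HasPowerFlux p ∧ ∀ i, b i = 0 ∧ A i * (p + 1) = H i + Γ i) ∨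
      (∃ s, B.HasExpFlux s ∧ ∀ i, A i = 0 ∧ s * b i = H i + Γ i) ∨
      ∀ i, A i = 0 ∧ b i = 0 ∧ H i + Γ i = 0) :
    IsInvariant B ((ofGenerators w A b Γ H hA hb).group B) := by
  refine isInvariant (fun ε u hu hu' => ?_) (fun ε t ht ht' => ?_) ?_
  · simp only [ofGenerators] at hu' ⊢
    rcases hd with ⟨k, ⟨hI, hd, -⟩, h⟩ | h
    · have h1 : ∑ i, A i * ε i + k * ∑ i, H i * ε i = 2 * ∑ i, Γ i * ε i := by
        simp only [Finset.mul_sum, ← Finset.sum_add_distrib]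
        refine Finset.sum_congr rfl fun i _ => ?_
        linear_combination ε i * h i
      rw [hd _ hu', hd _ hu, mul_rpow_of_pos (Real.exp_pos _), ← Real.exp_mul, ← Real.exp_nat_mul,
        mul_right_comm, ← Real.exp_add]
      congr 2
      push_cast
      linarith
    · have h1 : ∑ i, A i * ε i = 2 * ∑ i, Γ i * ε i := by
        simp only [Finset.mul_sum]
        refine Finset.sum_congr rfl fun i _ => ?_
        rw [(h i).2]; ring
      simp only [h, zero_mul, Finset.sum_const_zero, Real.exp_zero, one_mul] at h1 ⊢
      rw [h1, mul_comm, ← Real.exp_nat_mul]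
      norm_num
  · simp only [ofGenerators] at ht' ⊢
    rcases hq with h | ⟨⟨q₀, -, h⟩, h1⟩ | ⟨p, ⟨q₀, -, h⟩, h1⟩ | ⟨s, ⟨q₀, -, h⟩, h1⟩ | h
    · rw [h _ ht', h _ ht]; ring
    · rw [h _ ht', h _ ht, ← Real.exp_add, ← Finset.sum_add_distrib]
      simp only [h1, add_mul]
      ring
    · have h2 : (∑ i, A i * ε i) * (p + 1) = ∑ i, H i * ε i + ∑ i, Γ i * ε i := by
        simp only [Finset.sum_mul, ← Finset.sum_add_distrib]
        refine Finset.sum_congr rfl fun i _ => ?_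
        linear_combination ε i * (h1 i).2
      rw [h _ ht', h _ ht]
      simp only [h1, zero_mul, Finset.sum_const_zero, add_zero]
      rw [mul_rpow_of_pos (Real.exp_pos _), ← Real.exp_mul, ← Real.exp_add, ← h2, mul_add,
        mul_one, Real.exp_add]
      ring
    · have h2 : s * (∑ i, b i * ε i) = ∑ i, H i * ε i + ∑ i, Γ i * ε i := by
        simp only [Finset.mul_sum, ← Finset.sum_add_distrib]
        refine Finset.sum_congr rfl fun i _ => ?_
        linear_combination ε i * (h1 i).2
      rw [h _ ht', h _ ht, ← Real.exp_add, ← h2]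
      simp only [h1, zero_mul, Finset.sum_const_zero, Real.exp_zero, one_mul, mul_one, mul_add,
        Real.exp_add]
      ring
    · have h2 : ∑ i, H i * ε i + ∑ i, Γ i * ε i = 0 := by
        rw [← Finset.sum_add_distrib]
        refine Finset.sum_eq_zero fun i _ => ?_
        linear_combination ε i * (h i).2.2
      rw [← Real.exp_add, h2]
      simp [h]
  · rcases hd with ⟨k, ⟨hI, -, h0⟩, -⟩ | h
    · exact Or.inl ⟨h0, hI⟩
    · right; intro ε; simp [ofGenerators, h]

variable {p q r : Fin N → ℝ}

/-- The parameters of a group of invariance inside the group with the given generators, as linear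
combinations of `log E`, `log H` and `F`. -/
theorem embeds_ofGenerators {N' : ℕ} {Φ : PointGroup N'} (F : AffineForm B Φ)
    (hB : IsInvariant B Φ) (p q r : Fin N → ℝ)
    (hr : ∑ i, A i * r i = 0 ∧ ∑ i, Γ i * r i = 0 ∧ ∑ i, H i * r i = 0)
    (hα : ∀ α β γ a, IsSymmetry B α β γ a → (∑ i, A i * p i) * α + (∑ i, A i * q i) * a = α)
    (hγ : ∀ α β γ a, IsSymmetry B α β γ a → (∑ i, Γ i * p i) * α + (∑ i, Γ i * q i) * a = γ)
    (ha : ∀ α β γ a, IsSymmetry B α β γ a → (∑ i, H i * p i) * α + (∑ i, H i * q i) * a = a)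
    (hβ : (∑ i, b i * p i = 0 ∧ ∑ i, b i * q i = 0 ∧ ∑ i, b i * r i = 1) ∨
      ((∀ α β γ a, IsSymmetry B α β γ a → β = 0) ∧ ∀ i, b i = 0) ∨
      ((∀ α β γ a, IsSymmetry B α β γ a → α = 0 ∧ β = (∑ i, b i * q i) * a) ∧
        ∑ i, b i * r i = 0)) :
    Embeds (ofGenerators w A b Γ H hA hb) F
      (fun ε i => p i * Real.log (F.E ε) + q i * Real.log (F.H ε) + r i * F.F ε) := by
  have sym := F.isSymmetry hB
  have expand (c : Fin N → ℝ) (x y z : ℝ) : ∑ i, c i * (p i * x + q i * y + r i * z) =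
      (∑ i, c i * p i) * x + (∑ i, c i * q i) * y + (∑ i, c i * r i) * z := by
    simp only [Finset.sum_mul, ← Finset.sum_add_distrib]
    exact Finset.sum_congr rfl fun i _ => by ring
  refine ⟨?_, ?_, ?_, ?_, ?_, ?_⟩
  · have h1 := F.E_smooth.log (by rw [F.E_zero]; exact one_ne_zero)
    have h2 := F.H_smooth.log (by rw [F.H_zero]; exact one_ne_zero)
    have h3 := F.F_smooth
    exact contDiffAt_pi.2 fun i => by fun_prop
  · funext i; simp [F.E_zero, F.H_zero, F.F_zero]
  · filter_upwards [F.log_relation (p := ∑ i, A i * p i - 1) (q := 0) (r := ∑ i, A i * q i)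
      fun e => by linarith [hα _ _ _ _ (sym e)]] with ε h
    simp only [ofGenerators, expand, hr]
    linarith
  · simp only [ofGenerators, expand]
    -- The shift F is an independent parameter of the group, or it is absent, or it is tied to log
    -- H.
    rcases hβ with h | ⟨h, h'⟩ | ⟨h, h'⟩
    · simp [h]
    · filter_upwards [F.F_eq_zero fun e => h _ _ _ _ (sym e)] with ε h1
      simp [h1, h']
    · filter_upwards [F.F_eq_log (fun e => (h _ _ _ _ (sym e)).1) fun e => (h _ _ _ _ (sym e)).2,
        F.log_relation (p := 1) (q := 0) (r := 0) fun e => by simp [(h _ _ _ _ (sym e)).1]]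
        with ε h1 h2
      have h3 : Real.log (F.E ε) = 0 := by linarith
      rw [h3, h', ← h1]
      ring
  · filter_upwards [F.log_relation (p := ∑ i, Γ i * p i) (q := -1) (r := ∑ i, Γ i * q i)
      fun e => by linarith [hγ _ _ _ _ (sym e)]] with ε h
    simp only [ofGenerators, expand, hr]
    linarith
  · filter_upwards [F.log_relation (p := ∑ i, H i * p i) (q := 0) (r := ∑ i, H i * q i - 1)
      fun e => by linarith [ha _ _ _ _ (sym e)]] with ε h
    simp only [ofGenerators, expand, hr]
    linarith

/-- The group with the given generators is the maximal group of invariance. -/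
theorem ofGenerators_isMaximal (hinv : IsInvariant B ((ofGenerators w A b Γ H hA hb).group B))
    (hI : B.uInf = 0 ∨ ∀ i, H i = 0)
    (inj : ∀ δ : Fin N → ℝ, ∑ i, A i * δ i = 0 → ∑ i, b i * δ i = 0 → ∑ i, Γ i * δ i = 0 →
      ∑ i, H i * δ i = 0 → δ = 0)
    (p q r : Fin N → ℝ)
    (hr : ∑ i, A i * r i = 0 ∧ ∑ i, Γ i * r i = 0 ∧ ∑ i, H i * r i = 0)
    (hsym : ∀ α β γ a, IsSymmetry B α β γ a →
      (∑ i, A i * p i) * α + (∑ i, A i * q i) * a = α ∧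
      (∑ i, Γ i * p i) * α + (∑ i, Γ i * q i) * a = γ ∧
      (∑ i, H i * p i) * α + (∑ i, H i * q i) * a = a)
    (hβ : (∑ i, b i * p i = 0 ∧ ∑ i, b i * q i = 0 ∧ ∑ i, b i * r i = 1) ∨
      ((∀ α β γ a, IsSymmetry B α β γ a → β = 0) ∧ ∀ i, b i = 0) ∨
      ((∀ α β γ a, IsSymmetry B α β γ a → α = 0 ∧ β = (∑ i, b i * q i) * a) ∧
        ∑ i, b i * r i = 0)) :
    IsMaximal B ((ofGenerators w A b Γ H hA hb).group B) := by
  refine ⟨hinv, fun N' Φ hB => ?_⟩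
  obtain ⟨F⟩ := hB.affineForm
  refine (embeds_ofGenerators F hB p q r hr (fun α β γ a h => (hsym α β γ a h).1)
    (fun α β γ a h => (hsym α β γ a h).2.1) (fun α β γ a h => (hsym α β γ a h).2.2)
    hβ).isContained hB ?_ fun δ ε h1 h2 h3 h4 => ?_
  · exact hI.imp_right fun h ε => by simp [ofGenerators, h]
  · refine sub_eq_zero.1 (inj (δ - ε) ?_ ?_ ?_ ?_) <;>
    simp only [Pi.sub_apply, mul_sub, Finset.sum_sub_distrib, sub_eq_zero] <;> assumption

end AffineAction

end HeatBVP

/-! ### The maximal group in each row -/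

namespace HeatBVP

open AffineAction

variable {B : Problem} {k p s : ℝ}

theorem Problem.HasPowerFlux.symmetry (h : B.HasPowerFlux p) {α β γ a : ℝ}
    (hs : IsSymmetry B α β γ a) (hp : p ≠ 0) : β = 0 ∧ a + γ - α = α * p := by
  have h1 := Problem.FluxODE.proportional h.not_hasZeroFlux_and.1 hs.fluxODE h.fluxODE
  refine ⟨(mul_eq_zero.1 (h1.2.symm.trans (zero_mul _))).resolve_right hp, ?_⟩
  linarith [h1.1]

theorem Problem.HasConstFlux.symmetry (h : B.HasConstFlux) {α β γ a : ℝ}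
    (hs : IsSymmetry B α β γ a) : a + γ = α := by
  obtain ⟨h0, h1⟩ := Problem.hasConstFlux_iff.1 h
  linarith [(Problem.FluxODE.proportional h0 hs.fluxODE h1).2]

theorem Problem.HasExpFlux.symmetry (h : B.HasExpFlux s) {α β γ a : ℝ}
    (hs : IsSymmetry B α β γ a) (hs0 : s ≠ 0) : α = 0 ∧ a + γ = β * s := by
  have h1 := Problem.FluxODE.proportional h.isRescaledExpFlux.1 hs.fluxODE h.fluxODE
  have hα := (mul_eq_zero.1 (h1.1.symm.trans (zero_mul _))).resolve_right hs0
  refine ⟨hα, ?_⟩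
  rw [hα] at h1
  linarith [h1.2]

theorem IsSymmetry.a_eq_zero (h : ∀ k, ¬ B.PowerAt k) {α β γ a : ℝ} (hs : IsSymmetry B α β γ a) :
    a = 0 ∧ α = 2 * γ := by
  have ha : a = 0 := by
    by_contra ha
    exact h _ (hs.powerAt ha)
  subst ha
  exact ⟨rfl, hs.eq_of_a_eq_zero⟩

theorem Problem.IsPower.symmetry (h : B.IsPower k) {α β γ a : ℝ} (hs : IsSymmetry B α β γ a) :
    γ = (a * k + α) / 2 := by
  linarith [hs.eq_of_powerAt h.powerAt]

theorem IsMaximal.hasMGI_nil {Ψ : PointGroup 0} (h : IsMaximal B Ψ)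
    (hT : ∀ ε z, Ψ.act ε z = z) : HasMGI B [] :=
  ⟨Ψ, h, fun ε z _ => hT ε z⟩

theorem IsMaximal.hasMGI_singleton {Ψ : PointGroup 1} (h : IsMaximal B Ψ)
    {T : ℝ → ℝ × ℝ × ℝ → ℝ × ℝ × ℝ} (hT : ∀ ε z, Ψ.act ε z = T (ε 0) z) : HasMGI B [T] :=
  ⟨Ψ, h, fun ε z _ => hT ε z⟩

theorem IsMaximal.hasMGI_pair {Ψ : PointGroup 2} (h : IsMaximal B Ψ)
    {T T' : ℝ → ℝ × ℝ × ℝ → ℝ × ℝ × ℝ} (hT : ∀ ε z, Ψ.act ε z = T (ε 0) (T' (ε 1) z)) :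
    HasMGI B [T, T'] :=
  ⟨Ψ, h, fun ε z _ => hT ε z⟩

theorem IsMaximal.hasMGI_triple {Ψ : PointGroup 3} (h : IsMaximal B Ψ)
    {T T' T'' : ℝ → ℝ × ℝ × ℝ → ℝ × ℝ × ℝ}
    (hT : ∀ ε z, Ψ.act ε z = T (ε 0) (T' (ε 1) (T'' (ε 2) z))) : HasMGI B [T, T', T''] :=
  ⟨Ψ, h, fun ε z _ => hT ε z⟩

theorem hasMGI_nil (h : ∀ r : Row, ¬ r.Characterises B) : HasMGI B [] := by
  have M : IsMaximal B ((ofGenerators (N := 0) ![] ![] ![] ![] ![] (by simp) (by simp)).group B) :=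
    ofGenerators_isMaximal (ofGenerators_isInvariant (by simp) (by simp)) (by simp)
      (fun δ _ _ _ _ => Subsingleton.elim _ _) ![] ![] ![] (by simp)
      (fun α β γ a hs => by simp [hs.eq_zero h])
      (Or.inr (Or.inl ⟨fun α β γ a hs => (hs.eq_zero h).2.1, by simp⟩))
  refine M.hasMGI_nil fun ε ⟨t, x, u⟩ => ?_
  simp [AffineAction.group, AffineAction.act, ofGenerators]

theorem hasMGI_Td_of_case1 (h : Row.case1.Mem B) : HasMGI B [Td] := by
  have hp := h.characterises.2
  have hq : B.HasPowerFlux (-1 / 2) := h.1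
  have sym {α β γ a : ℝ} (hs : IsSymmetry B α β γ a) : β = 0 ∧ a = 0 ∧ α = 2 * γ := by
    obtain ⟨h1, h2⟩ := hq.symmetry hs (by norm_num)
    have ha : a = 0 := by
      by_contra ha
      refine hp ?_
      have h3 := hs.powerAt ha
      -- The flux t^(-1/2) gives 2a + 2γ = α. A nonzero a would therefore mean k = -2, which belongs
      -- to the last row.
      rwa [show (2 * γ - α) / a = -2 by rw [div_eq_iff ha]; linarith] at h3
    subst ha
    exact ⟨h1, rfl, hs.eq_of_a_eq_zero⟩
  have M : IsMaximal B ((ofGenerators (N := 1) ![0] ![2] ![0] ![1] ![0]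
      (by simp) (by simp)).group B) := by
    refine ofGenerators_isMaximal (ofGenerators_isInvariant (Or.inr (by simp))
      (Or.inr (Or.inr (Or.inl ⟨_, hq, by norm_num⟩)))) (Or.inr (by simp))
      (fun δ h _ _ _ => ?_) ![1 / 2] ![0] ![0] (by simp) (fun α β γ a hs => ?_)
      (Or.inr (Or.inl ⟨fun α β γ a hs => (sym hs).1, by simp⟩))
    · funext i
      fin_cases i
      simpa using h
    · obtain ⟨h1, h2, h3⟩ := sym hs
      simp [h2, h3]
  refine M.hasMGI_singleton fun ε ⟨t, x, u⟩ => ?_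
  simp [AffineAction.group, AffineAction.act, ofGenerators, Td, mul_comm]

theorem hasMGI_Tt_of_case2 (h : Row.case2.Mem B) : HasMGI B [Tt] := by
  obtain ⟨hq, hp⟩ := h.characterises
  have sym {α β γ a : ℝ} (hs : IsSymmetry B α β γ a) : α = 0 ∧ a = 0 ∧ γ = 0 := by
    obtain ⟨h1, h2⟩ := hs.a_eq_zero hp
    have h3 := hq.symmetry hs
    exact ⟨by linarith, h1, by linarith⟩
  have M : IsMaximal B ((ofGenerators (N := 1) ![0] ![0] ![1] ![0] ![0]
      (by simp) (by simp)).group B) := by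
    refine ofGenerators_isMaximal (ofGenerators_isInvariant (Or.inr (by simp))
      (Or.inr (Or.inl ⟨hq, by simp⟩))) (Or.inr (by simp))
      (fun δ _ h _ _ => ?_) ![0] ![0] ![1] (by simp) (fun α β γ a hs => ?_) (Or.inl (by simp))
    · funext i
      fin_cases i
      simpa using h
    · obtain ⟨h1, h2, h3⟩ := sym hs
      simp [h1, h2, h3]
  refine M.hasMGI_singleton fun ε ⟨t, x, u⟩ => ?_
  simp [AffineAction.group, AffineAction.act, ofGenerators, Tt]

theorem hasMGI_Tt_Td_of_case3 (h : Row.case3.Mem B) : HasMGI B [Tt, Td] := by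
  obtain ⟨hq, hp⟩ := h.characterises
  have M : IsMaximal B ((ofGenerators (N := 2) ![1, 0] ![0, 2] ![1, 0] ![0, 1] ![0, 0]
      (by simp [Fin.forall_fin_two]) (by simp [Fin.forall_fin_two])).group B) := by
    refine ofGenerators_isMaximal
      (ofGenerators_isInvariant (Or.inr (by simp [Fin.forall_fin_two])) (Or.inl hq))
      (Or.inr (by simp [Fin.forall_fin_two]))
      (fun δ h1 h2 _ _ => ?_) ![0, 1 / 2] ![0, 0] ![1, 0] (by simp) (fun α β γ a hs => ?_)
      (Or.inl (by simp))
    · simp at h1 h2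
      funext i
      fin_cases i <;> simpa
    · obtain ⟨h1, h2⟩ := hs.a_eq_zero hp
      simp [h1, h2]
  refine M.hasMGI_pair fun ε ⟨t, x, u⟩ => ?_
  simp [AffineAction.group, AffineAction.act, ofGenerators, Tt, Td, mul_comm]

theorem hasMGI_Tkp (hk : B.IsPower k) (hk2 : k ≠ -2) (hp : p ≠ 0) (hq : B.HasPowerFlux p) :
    HasMGI B [Tkp k p] := by
  have hk2' : k + 2 ≠ 0 := fun h => hk2 (by linarith)
  have M : IsMaximal B ((ofGenerators (N := 1) ![0] ![k + 2] ![0] ![k * (p + 1) + 1] ![2 * p + 1]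
      (by simp) (by simp)).group B) := by
    refine ofGenerators_isMaximal (ofGenerators_isInvariant (Or.inl ⟨k, hk, ?_⟩)
      (Or.inr (Or.inr (Or.inl ⟨_, hq, ?_⟩)))) (Or.inl hk.2.2)
      (fun δ h _ _ _ => ?_) ![(k + 2)⁻¹] ![0] ![0] (by simp) (fun α β γ a hs => ?_)
      (Or.inr (Or.inl ⟨fun α β γ a hs => (hq.symmetry hs hp).1, by simp⟩))
    · simp; ring
    · simp; ring
    · funext i
      fin_cases i
      simpa [hk2'] using h
    · have h1 := hk.symmetry hs
      have h2 := (hq.symmetry hs hp).2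
      -- The power laws of d and q leave one relation between a and α; for k ≠ -2 it makes a a
      -- multiple of α, and the group has one parameter.
      have h3 : a * (k + 2) = α * (2 * p + 1) := by rw [h1] at h2; linarith
      have ha : a = α * (2 * p + 1) / (k + 2) := by rw [eq_div_iff hk2', h3]
      rw [ha] at h1
      simp [hk2', h1, ha]
      constructor <;> field_simp
      ring
  refine M.hasMGI_singleton fun ε ⟨t, x, u⟩ => ?_
  simp [AffineAction.group, AffineAction.act, ofGenerators, Tkp, mul_comm]

theorem hasMGI_Tke (hk : B.IsPower k) (hk2 : k ≠ -2) (hs : s = 1 ∨ s = -1) (hq : B.HasExpFlux s) :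
    HasMGI B [Tke k s] := by
  have hk2' : k + 2 ≠ 0 := fun h => hk2 (by linarith)
  have hs2 : s * s = 1 := by rcases hs with rfl | rfl <;> norm_num
  have hs0 : s ≠ 0 := by rintro rfl; simp at hs2
  -- Time is not scaled, so the parameter is read off as half of log H. The shift is tied to it: a(k
  -- + 2)/2 = sβ, that is β = s(k + 2)a/2, because s² = 1.
  have M : IsMaximal B ((ofGenerators (N := 1) ![0] ![0] ![s * (k + 2)] ![k] ![2]
      (by simp) (by simp)).group B) := by
    refine ofGenerators_isMaximal (ofGenerators_isInvariant (Or.inl ⟨k, hk, ?_⟩)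
      (Or.inr (Or.inr (Or.inr (Or.inl ⟨_, hq, ?_⟩))))) (Or.inl hk.2.2)
      (fun δ _ _ _ h => ?_) ![0] ![1 / 2] ![0] (by simp) (fun α β γ a hs => ?_)
      (Or.inr (Or.inr ⟨fun α β γ a hs => ?_, by simp⟩))
    · simp; ring
    · simp
      linear_combination (k + 2) * hs2
    · funext i
      fin_cases i
      simpa using h
    · have h1 := hk.symmetry hs
      have h2 := (hq.symmetry hs hs0).1
      simp [h1, h2]
      ring
    · have h1 := hk.symmetry hs
      obtain ⟨h2, h3⟩ := hq.symmetry hs hs0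
      rw [h1, h2] at h3
      simp [h2]
      linear_combination -s * h3 - β * hs2
  refine M.hasMGI_singleton fun ε ⟨t, x, u⟩ => ?_
  simp [AffineAction.group, AffineAction.act, ofGenerators, Tke, mul_comm]

theorem hasMGI_Tt_Tkp (hk : B.IsPower k) (hq : B.HasConstFlux) : HasMGI B [Tt, Tkp k 0] := by
  -- The first coordinate, of weight 1, is the shift of time. The second is read off from log H and
  -- not from log E, so that k = -2, where time is not scaled, needs no separate treatment.
  have M : IsMaximal B ((ofGenerators (N := 2) ![1, 0] ![0, k + 2] ![1, 0] ![0, k + 1] ![0, 1]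
      (by simp [Fin.forall_fin_two]) (by simp [Fin.forall_fin_two])).group B) := by
    refine ofGenerators_isMaximal (ofGenerators_isInvariant (Or.inl ⟨k, hk, ?_⟩)
      (Or.inr (Or.inl ⟨hq, ?_⟩))) (Or.inl hk.2.2)
      (fun δ _ h1 _ h2 => ?_) ![0, 0] ![0, 1] ![1, 0] (by simp) (fun α β γ a hs => ?_)
      (Or.inl (by simp))
    · simp [Fin.forall_fin_two]; ring
    · simp [Fin.forall_fin_two]; ring
    · simp at h1 h2
      funext i
      fin_cases i <;> simpa
    · have h1 := hk.symmetry hs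
      have h2 := hq.symmetry hs
      simp
      constructor <;> linarith
  refine M.hasMGI_pair fun ε ⟨t, x, u⟩ => ?_
  simp [AffineAction.group, AffineAction.act, ofGenerators, Tt, Tkp, mul_comm]

theorem hasMGI_Tt_Td_Tk (hk : B.IsPower k) (hq : B.HasZeroFlux) : HasMGI B [Tt, Td, Tk k] := by
  have hk0 := hk.powerAt.ne_zero
  have M : IsMaximal B ((ofGenerators (N := 3) ![1, 0, 0] ![0, 2, 0] ![1, 0, 0] ![0, 1, k]
      ![0, 0, 2] (by simp [Fin.forall_fin_succ]) (by simp [Fin.forall_fin_succ])).group B) := by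
    refine ofGenerators_isMaximal (ofGenerators_isInvariant (Or.inl ⟨k, hk, ?_⟩)
      (Or.inl hq)) (Or.inl hk.2.2)
      (fun δ h1 h2 _ h3 => ?_) ![0, 1 / 2, 0] ![0, 0, 1 / 2] ![1, 0, 0]
      (by simp [Fin.sum_univ_succ]) (fun α β γ a hs => ?_)
      (Or.inl (by simp [Fin.sum_univ_succ]))
    · simp [Fin.forall_fin_succ]; ring
    · simp [Fin.sum_univ_succ] at h1 h2 h3
      funext i
      fin_cases i <;> simpa
    · have h1 := hk.symmetry hs
      simp [Fin.sum_univ_succ]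
      linarith
  refine M.hasMGI_triple fun ε ⟨t, x, u⟩ => ?_
  simp [AffineAction.group, AffineAction.act, ofGenerators, Tt, Td, Tk, Fin.sum_univ_succ,
    Real.exp_add]
  refine ⟨?_, ?_, ?_⟩ <;> ring_nf

theorem hasMGI_Tk_of_case8 (h : Row.case8.Mem B) : HasMGI B [Tk (-2)] := by
  obtain ⟨-, hc, h0, hp⟩ := h.characterises
  have hk : B.IsPower (-2) := h.1
  have sym {α β γ a : ℝ} (hs : IsSymmetry B α β γ a) : α = 0 ∧ β = 0 ∧ γ = -a := by
    have h1 := hk.symmetry hs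
    rcases hs.fluxODE.cases h0 hc with ⟨hα, h2, -⟩ | ⟨hα, hβ, -⟩ | ⟨hα, hβ, hμ⟩
    -- For k = -2 the balance gives a + γ - α = -α/2, so a symmetry with α ≠ 0 would make the flux a
    -- shifted power -1/2; one with α = 0 and β ≠ 0 would make it constant.
    · refine absurd ?_ hp
      rwa [show (a + γ - α) / α = -1 / 2 by rw [div_eq_iff hα]; linarith] at h2
    · exfalso
      have h2 := hs.fluxODE
      rw [hα, show a + γ - 0 = 0 by linarith] at h2
      refine hc (Problem.hasConstFlux_iff.2 ⟨h0, fun t ht => ?_⟩)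
      refine mul_left_cancel₀ hβ ?_
      linear_combination h2 t ht
    · exact ⟨hα, hβ, by linarith⟩
  have M : IsMaximal B ((ofGenerators (N := 1) ![0] ![0] ![0] ![-2] ![2]
      (by simp) (by simp)).group B) := by
    refine ofGenerators_isMaximal (ofGenerators_isInvariant (Or.inl ⟨-2, hk, by simp⟩)
      (Or.inr (Or.inr (Or.inr (Or.inr (by simp)))))) (Or.inl hk.2.2)
      (fun δ _ _ _ h => ?_) ![0] ![1 / 2] ![0] (by simp) (fun α β γ a hs => ?_)
      (Or.inr (Or.inl ⟨fun α β γ a hs => (sym hs).2.1, by simp⟩))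
    · funext i
      fin_cases i
      simpa using h
    · obtain ⟨h1, h2, h3⟩ := sym hs
      simp [h1, h3]
  refine M.hasMGI_singleton fun ε ⟨t, x, u⟩ => ?_
  simp [AffineAction.group, AffineAction.act, ofGenerators, Tk, mul_comm]

theorem hasMGI_Td_Tk (hk : B.IsPower (-2)) (hq : B.HasPowerFlux (-1 / 2)) :
    HasMGI B [Td, Tk (-2)] := by
  have M : IsMaximal B ((ofGenerators (N := 2) ![0, 0] ![2, 0] ![0, 0] ![1, -2] ![0, 2]
      (by simp [Fin.forall_fin_two]) (by simp [Fin.forall_fin_two])).group B) := by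
    refine ofGenerators_isMaximal (ofGenerators_isInvariant
      (Or.inl ⟨-2, hk, by simp [Fin.forall_fin_two]⟩)
      (Or.inr (Or.inr (Or.inl ⟨_, hq, ?_⟩)))) (Or.inl hk.2.2)
      (fun δ h1 _ _ h2 => ?_) ![1 / 2, 0] ![0, 1 / 2] ![0, 0] (by simp) (fun α β γ a hs => ?_)
      (Or.inr (Or.inl ⟨fun α β γ a hs => (hq.symmetry hs (by norm_num)).1, ?_⟩))
    · simp [Fin.forall_fin_two]; norm_num
    · simp at h1 h2
      funext i
      fin_cases i <;> simpa
    · have h1 := hk.symmetry hs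
      simp
      linarith
    · simp [Fin.forall_fin_two]
  refine M.hasMGI_pair fun ε ⟨t, x, u⟩ => ?_
  simp [AffineAction.group, AffineAction.act, ofGenerators, Td, Tk, Real.exp_add]
  refine ⟨?_, ?_, ?_⟩ <;> ring_nf

theorem Row.Mem.hasMGI {r : Row} (h : r.Mem B) : HasMGI B r.groups := by
  cases r with
  | case1 => exact hasMGI_Td_of_case1 h
  | case2 => exact hasMGI_Tt_of_case2 h
  | case3 => exact hasMGI_Tt_Td_of_case3 h
  | case4 k p =>
    obtain ⟨h1, -, h2, h3, h4⟩ := h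
    exact hasMGI_Tkp h3 h1 h2 h4
  | case5 k s =>
    obtain ⟨h1, h2, h3, h4⟩ := h
    exact hasMGI_Tke h3 h1 h2 h4
  | case6 k => exact hasMGI_Tt_Tkp h.1 h.2
  | case7 k => exact hasMGI_Tt_Td_Tk h.1 h.2
  | case8 => exact hasMGI_Tk_of_case8 h
  | case9 => exact hasMGI_Td_Tk h.1 h.2

theorem exists_row_or_hasMGI_nil (B : Problem) :
    (∃ (r : Row) (B' : Problem), Equivalent B B' ∧ r.Mem B') ∨ HasMGI B [] := by
  by_cases h : ∃ r : Row, r.Characterises B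
  · obtain ⟨r, hr⟩ := h
    exact Or.inl ⟨r, hr.exists_mem⟩
  · push Not at h
    exact Or.inr (hasMGI_nil h)

end HeatBVP
/-- Group classification of the boundary value problems: (1) the maximal group of invariance of
every problem that belongs to a row of the table is the one listed there; (2) a problem that is
not equivalent to one belonging to a row of the table admits only the trivial group;
(3) problems that belong to different rows are not equivalent. -/
theorem theorem2 :
    (∀ (r : HeatBVP.Row) (B : HeatBVP.Problem), r.Mem B → HeatBVP.HasMGI B r.groups) ∧
    (∀ B : HeatBVP.Problem,
      (∃ (r : HeatBVP.Row) (B' : HeatBVP.Problem), HeatBVP.Equivalent B B' ∧ r.Mem B') ∨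
        HeatBVP.HasMGI B []) ∧
    (∀ (r r' : HeatBVP.Row) (B B' : HeatBVP.Problem),
      r.Mem B → r'.Mem B' → HeatBVP.Equivalent B B' → r = r') := by
  exact ⟨fun _ _ h => h.hasMGI, HeatBVP.exists_row_or_hasMGI_nil,
    fun _ _ _ _ h h' hB => h.unique h' hB⟩
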